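/- Let $n\ge 1$ and $0<s<1$. Put $$\omega(x,y)=|y-x|\,\phi(|y-x|),\quad \phi(r)=r^{-(n+1+s)},\qquad \alpha(x,y)=\rho(x,y)=\frac{y-x}{|y-x|}\quad(\text{interaction radius }\delta=\infty),$$ so that $\alpha(x,y)\,\omega(x,y)=(y-x)\,|y-x|^{-(n+s+1)}$. Let $$C_{n,s}=\frac{4^s\,\Gamma(s+\frac n2)}{\pi^{n/2}\,|\Gamma(-s)|},\qquad G_s=\frac{s}{\Gamma(1-s)},$$ and let $D_{n,s}$ be the constant determined by $$\int_{|\theta|=1}\int_{|\theta'|=1}\theta\cdot\theta'\,(i\,\theta\cdot\xi)^s\,(i\,\theta'\cdot\xi)^s\,d\theta\,d\theta'=D_{n,s}\,|\xi|^{2s}\qquad(\xi\in\mathbb R^n);$$ it exists and is a negative real number. Define the equivalence kernel, for $x\ne y$, by $$2\gamma_{\rm eq}(x,y)=\mathrm{p.v.}\!\int_{\mathbb R^n}\big[\alpha(x,y)\omega(x,y)\cdot\alpha(x,z)\omega(x,z)+\alpha(z,y)\omega(z,y)\cdot\alpha(x,y)\omega(x,y)+\alpha(z,y)\omega(z,y)\cdot\alpha(x,z)\omega(x,z)\big]\,dz,$$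 the limit as $\varepsilon\to0^+$ of the absolutely convergent integrals over $\{z:|z-x|>\varepsilon,\ |z-y|>\varepsilon\}$. Then this limit exists and $$2\gamma_{\rm eq}(x,y)=-\frac{C_{n,s}D_{n,s}}{G_s^2}\,\frac1{|x-y|^{n+2s}}\qquad(x\neq y).$$ For $u\in H^s(\mathbb R^n)$ real-valued, consider $$\mathcal G_\omega u(x)=\mathrm{p.v.}\!\int (u(y)-u(x))\,\alpha(x,y)\,\omega(x,y)\,dy,\qquad \mathcal D_\omega v(x)=\mathrm{p.v.}\!\int(\omega(x,y)v(x)+\omega(y,x)v(y))\cdot\alpha(x,y)\,dy,$$ $$\mathcal L_\omega u=\mathcal D_\omega(\mathcal G_\omega u),\qquad \mathcal L u(x)=2\,\mathrm{p.v.}\!\int(u(y)-u(x))\,\gamma_{\rm eq}(x,y)\,dy,\qquad (-\Delta)^su(x)=C_{n,s}\,\mathrm{p.v.}\!\int\frac{u(x)-u(y)}{|x-y|^{n+2s}}\,dy,$$ where each principal value is the limit, as $\varepsilon\to0^+$, of the absolutely convergent integrals over $\{y:|y-x|>\varepsilon\}$, taken in $L^2(\mathbb R^n;\mathbb R^n)$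 for $\mathcal G_\omega u$ and in $H^{-s}(\mathbb R^n)$ for $\mathcal D_\omega(\mathcal G_\omega u)$, $\mathcal L u$ and $(-\Delta)^su$. Then for every $u\in H^s(\mathbb R^n)$ all these limits exist, and $$\mathcal L u=\mathcal L_\omega u=\frac{D_{n,s}}{G_s^2}\,(-\Delta)^su\qquad\text{in }H^{-s}(\mathbb R^n).$$ -/

import Mathlib

open MeasureTheory Filter Topology
open scoped ENNReal SchwartzMap

namespace NonlocalCalculus

/-- Euclidean space `ℝⁿ`. -/
abbrev E (n : ℕ) : Type := EuclideanSpace ℝ (Fin n)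

noncomputable section

/-! ### Constants -/

/-- The normalization constant `C_{n,s}` of the fractional Laplacian. -/
def fracLapConst (n : ℕ) (s : ℝ) : ℝ :=
  (4 : ℝ) ^ s * Real.Gamma (s + (n : ℝ) / 2) /
    (Real.pi ^ ((n : ℝ) / 2) * |Real.Gamma (-s)|)

/-- The constant `G_s = s / Γ(1 - s)`. -/
def dirConst (s : ℝ) : ℝ := s / Real.Gamma (1 - s)

/-- `D` is the constant `D_{n,s}`: it is negative, and for every `ξ ∈ ℝⁿ`
`∫_{|θ|=1} ∫_{|θ'|=1} (θ · θ') (i θ · ξ)^s (i θ' · ξ)^s dθ dθ' = D |ξ|^{2s}`,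
with surface measure on the unit sphere and the principal branch of the power. -/
def IsSphereConst (n : ℕ) (s D : ℝ) : Prop :=
  D < 0 ∧ ∀ ξ : E n,
    ∫ θ : Metric.sphere (0 : E n) 1, ∫ θ' : Metric.sphere (0 : E n) 1,
        ((inner ℝ (θ : E n) (θ' : E n) : ℝ) : ℂ)
          * (Complex.I * ((inner ℝ (θ : E n) ξ : ℝ) : ℂ)) ^ (s : ℂ)
          * (Complex.I * ((inner ℝ (θ' : E n) ξ : ℝ) : ℂ)) ^ (s : ℂ)
        ∂(volume : Measure (E n)).toSphere ∂(volume : Measure (E n)).toSphere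
      = ((D * ‖ξ‖ ^ (2 * s) : ℝ) : ℂ)

/-! ### Interaction kernels and weights -/

/-- The interaction kernel `α(x,y) = ρ(x,y) 1(|x - y| ≤ δ)`, where `δ = ∞` is allowed. -/
def interactionKernel {n : ℕ} (ρ : E n → E n → E n) (δ : ℝ≥0∞) (x y : E n) : E n :=
  if edist x y ≤ δ then ρ x y else 0

/-- `ρ(x,y) = (y - x) / |y - x|`. -/
def unitKernel (n : ℕ) (x y : E n) : E n := ‖y - x‖⁻¹ • (y - x)

/-- The untruncated (`δ = ∞`) interaction kernel of the unit vector field. -/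
def fracKernel (n : ℕ) : E n → E n → E n := interactionKernel (unitKernel n) ⊤

/-- `ω(x,y) = |y - x| φ(|y - x|)` with `φ(r) = r^{-(n + 1 + s)}`. -/
def fracWeight (n : ℕ) (s : ℝ) (x y : E n) : ℝ :=
  ‖y - x‖ * ‖y - x‖ ^ (-((n : ℝ) + 1 + s))

/-! ### The equivalence kernel -/

/-- The integrand, as a function of `z`, in the definition of `2 γ_eq(x,y)`. -/
def equivIntegrand {n : ℕ} (ω : E n → E n → ℝ) (α : E n → E n → E n) (x y z : E n) : ℝ :=
  inner ℝ (ω x y • α x y) (ω x z • α x z)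
    + inner ℝ (ω z y • α z y) (ω x y • α x y)
    + inner ℝ (ω z y • α z y) (ω x z • α x z)

/-- Points `z` at distance more than `ε` from both singularities `x` and `y` of the integrand. -/
def awayFrom {n : ℕ} (ε : ℝ) (x y : E n) : Set (E n) := {z | ε < ‖z - x‖ ∧ ε < ‖z - y‖}

/-- The equivalence kernel `γ_eq`; the defining integral is a principal value at `z = x`, `z = y`.
The existence of the limit has to be (and is) asserted separately. -/
def equivKernel {n : ℕ} (ω : E n → E n → ℝ) (α : E n → E n → E n) (x y : E n) : ℝ :=
  (1 / 2) * limUnder (𝓝[>] (0 : ℝ))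
    (fun ε : ℝ => ∫ z in awayFrom ε x y, equivIntegrand ω α x y z)

/-! ### Sobolev spaces and convergence in them -/

/-- The (real-valued) function `u` belongs to `H^s(ℝⁿ)`. -/
def MemHs {n : ℕ} (s : ℝ) (u : E n → ℝ) : Prop :=
  ∃ hu : MemLp (fun x => (u x : ℂ)) 2 (volume : Measure (E n)),
    TemperedDistribution.MemSobolev s 2 ((hu.toLp _ : Lp ℂ 2 (volume : Measure (E n))) : 𝓢'(E n, ℂ))

/-- The functions `f ε` (`ε > 0`) are in `L²`, and they converge, as `ε → 0+`, to the tempered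
distribution `F` in the norm `‖(1 + |ξ|²)^{r/2} 𝓕(·)‖_{L²}` of `H^r(ℝⁿ)`. -/
def TendstoSobolev {n : ℕ} (r : ℝ) (f : ℝ → E n → ℝ) (F : 𝓢'(E n, ℂ)) : Prop :=
  ∃ hf : ∀ ε : ℝ, 0 < ε → MemLp (fun x => (f ε x : ℂ)) 2 (volume : Measure (E n)),
  ∃ d : ℝ → Lp ℂ 2 (volume : Measure (E n)),
    (∀ (ε : ℝ) (hε : 0 < ε),
      TemperedDistribution.besselPotential (E n) ℂ r
        ((((hf ε hε).toLp _ : Lp ℂ 2 (volume : Measure (E n))) : 𝓢'(E n, ℂ)) - F)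
          = (d ε : 𝓢'(E n, ℂ))) ∧
    Tendsto d (𝓝[>] 0) (𝓝 0)

/-! ### Nonlocal operators

All integrals are principal values: the ball `|y - x| ≤ ε` is removed and `ε → 0+`.  The gradient
converges in `L²`, the second order operators converge in `H^{-s}`.  The relations below also
contain the absolute convergence of the truncated integrals, so that no default value of the
integral is ever used. -/

/-- The complement of the closed ball of radius `ε` about `x`. -/
def offBall {n : ℕ} (ε : ℝ) (x : E n) : Set (E n) := {y | ε < ‖y - x‖}

/-- Integrand of `𝒢_ω u(x) = ∫ (u(y) - u(x)) α(x,y) ω(x,y) dy`. -/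
def gradIntegrand {n : ℕ} (ω : E n → E n → ℝ) (α : E n → E n → E n) (u : E n → ℝ)
    (x y : E n) : E n :=
  ((u y - u x) * ω x y) • α x y

/-- Integrand of `𝒟_ω v(x) = ∫ (ω(x,y) v(x) + ω(y,x) v(y)) · α(x,y) dy`. -/
def divIntegrand {n : ℕ} (ω : E n → E n → ℝ) (α : E n → E n → E n) (v : E n → E n)
    (x y : E n) : ℝ :=
  inner ℝ (ω x y • v x + ω y x • v y) (α x y)

/-- Integrand of the unweighted Laplacian `ℒ u(x) = 2 ∫ (u(y) - u(x)) γ(x,y) dy`. -/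
def lapIntegrand {n : ℕ} (γ : E n → E n → ℝ) (u : E n → ℝ) (x y : E n) : ℝ :=
  2 * ((u y - u x) * γ x y)

/-- Integrand of `(-Δ)^s u(x) = C_{n,s} ∫ (u(x) - u(y)) / |x - y|^{n+2s} dy`. -/
def fracLapIntegrand {n : ℕ} (s : ℝ) (u : E n → ℝ) (x y : E n) : ℝ :=
  fracLapConst n s * ((u x - u y) / ‖x - y‖ ^ ((n : ℝ) + 2 * s))

/-- `F` is the principal value, in `H^{-s}(ℝⁿ)`, of the integral `∫ k(x,y) dy`. -/
def IsPVIntegral {n : ℕ} (s : ℝ) (k : E n → E n → ℝ) (F : 𝓢'(E n, ℂ)) : Prop :=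
  (∀ ε : ℝ, 0 < ε → ∀ᵐ x : E n, IntegrableOn (k x) (offBall ε x)) ∧
  TendstoSobolev (-s) (fun ε x => ∫ y in offBall ε x, k x y) F

/-- `g = 𝒢_ω u`, as a principal value in `L²(ℝⁿ; ℝⁿ)`. -/
def IsWeightedGradient {n : ℕ} (ω : E n → E n → ℝ) (α : E n → E n → E n) (u : E n → ℝ)
    (g : E n → E n) : Prop :=
  MemLp g 2 (volume : Measure (E n)) ∧
  (∀ ε : ℝ, 0 < ε → ∀ᵐ x : E n, IntegrableOn (gradIntegrand ω α u x) (offBall ε x)) ∧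
  (∀ ε : ℝ, 0 < ε →
    MemLp (fun x => ∫ y in offBall ε x, gradIntegrand ω α u x y) 2 (volume : Measure (E n))) ∧
  Tendsto (fun ε : ℝ =>
      eLpNorm (fun x => (∫ y in offBall ε x, gradIntegrand ω α u x y) - g x) 2
        (volume : Measure (E n)))
    (𝓝[>] 0) (𝓝 0)

/-- `F = 𝒟_ω v`, as a principal value in `H^{-s}(ℝⁿ)`. -/
def IsWeightedDivergence {n : ℕ} (s : ℝ) (ω : E n → E n → ℝ) (α : E n → E n → E n)
    (v : E n → E n) (F : 𝓢'(E n, ℂ)) : Prop :=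
  IsPVIntegral s (divIntegrand ω α v) F

/-- `F = ℒ_ω u = 𝒟_ω (𝒢_ω u)`. -/
def IsWeightedLaplacian {n : ℕ} (s : ℝ) (ω : E n → E n → ℝ) (α : E n → E n → E n)
    (u : E n → ℝ) (F : 𝓢'(E n, ℂ)) : Prop :=
  ∃ g : E n → E n, IsWeightedGradient ω α u g ∧ IsWeightedDivergence s ω α g F

/-- `F = ℒ u` for the unweighted Laplacian `ℒ` with kernel `γ`. -/
def IsUnweightedLaplacian {n : ℕ} (s : ℝ) (γ : E n → E n → ℝ) (u : E n → ℝ)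
    (F : 𝓢'(E n, ℂ)) : Prop :=
  IsPVIntegral s (lapIntegrand γ u) F

/-- `F = (-Δ)^s u`. -/
def IsFracLaplacian {n : ℕ} (s : ℝ) (u : E n → ℝ) (F : 𝓢'(E n, ℂ)) : Prop :=
  IsPVIntegral s (fracLapIntegrand s u) F

end

end NonlocalCalculus

open NonlocalCalculus

set_option linter.unusedSectionVars false

namespace NonlocalCalculus

/-! ### One-dimensional integrals -/

/-! Every operator here is a Fourier multiplier. Put k(w) = w |w|^{-(n+s+1)}, so that α(x,y) ω(x,y)
= k(y - x), and let k_ε be its restriction to |w| > ε. Since k_ε is odd it has integral zero, so the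
terms with u(x) or v(x) drop out: the truncated gradient is the correlation of u with k_ε, with
symbol i V_ε(ξ), where V_ε is the sine transform `sinSymbol`. The truncated divergence acts as the
scalar product with i V_ε, so the composition has symbol -|V_0(ξ)|² in the limit. V_0 is homogeneous
of degree s and commutes with orthogonal maps, hence |V_0(ξ)| = |V_0(e)| |ξ|^s for any unit vector
e, and the composition is -(|V_0(e)| / (2π)^s)² times (-Δ)^s.

For the equivalence kernel put p = y - x. The first two terms of the integrand contribute nothing in
the limit, by oddness; the third is the self-convolution of k_ε at p. Oddness also cancels the
leading singularities at z = 0 and z = p, so this converges, and scaling and rotation force the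
limit to be c |p|^{-(n+2s)}. The constant c is found by integrating against 1 - cos(2π p·e): for
each ε > 0 this gives exactly |V_ε(e)|², while the limit is c (2π)^{2s} / C_{n,s}.

Polar coordinates write V_0(ξ) as (2π)^s sin(πs/2) / G_s times ∫ sign(θ·ξ) |θ·ξ|^s θ dθ. In the
double sphere integral the even part of (iθ·ξ)^s disappears by antipodal symmetry and each odd part
carries a factor i sin(πs/2). So D = -(|V_0(e)| G_s / (2π)^s)², and both constants above are
expressed through D / G_s².

The bound |V_ε(ξ)| ≤ M |ξ|^s, uniform in ε, gives convergence in L² and H^{-s} by dominated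
convergence on the Fourier side. The main lemmas are `fracLapConst_mul_integral_one_sub_cos`,
`isSphereConst_neg_sq`, `tendsto_autoConv`, `HasL2Fourier.correlation` and
`HasSobolevFourier.tendstoSobolev`. -/

theorem integrableOn_min_one_rpow_mul_rpow {a b : ℝ} (ha : 0 < a) (hab : a < b) :
    IntegrableOn (fun t : ℝ => min 1 (t ^ b) * t ^ (-1 - a)) (Set.Ioi 0) := by
  rw [← Set.Ioc_union_Ioi_eq_Ioi (zero_le_one' ℝ)]
  refine IntegrableOn.union ?_ ?_
  · have h : IntegrableOn (fun t : ℝ => t ^ (b - 1 - a)) (Set.Ioc 0 1) := by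
      rw [integrableOn_Ioc_iff_integrableOn_Ioo,
        intervalIntegral.integrableOn_Ioo_rpow_iff one_pos]
      linarith
    refine h.congr_fun (fun t ht => ?_) measurableSet_Ioc
    have : t ^ b ≤ 1 := Real.rpow_le_one ht.1.le ht.2 (by linarith)
    simp only [min_eq_right this]
    rw [← Real.rpow_add ht.1]
    ring_nf
  · have h : IntegrableOn (fun t : ℝ => t ^ (-1 - a)) (Set.Ioi 1) :=
      integrableOn_Ioi_rpow_of_lt (by linarith) one_pos
    refine h.congr_fun (fun t ht => ?_) measurableSet_Ioi
    have : 1 ≤ t ^ b := Real.one_le_rpow (le_of_lt ht) (by linarith)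
    simp [min_eq_left this]

theorem one_sub_exp_neg_le_min {x : ℝ} (_hx : 0 ≤ x) : 1 - Real.exp (-x) ≤ min 1 x := by
  refine le_min ?_ ?_
  · linarith [Real.exp_pos (-x)]
  · linarith [Real.add_one_le_exp (-x)]

theorem integrableOn_rpow_mul_one_sub_exp {s A : ℝ} (hs0 : 0 < s) (hs1 : s < 1) (hA : 0 < A) :
    IntegrableOn (fun t : ℝ => t ^ (-1 - s) * (1 - Real.exp (-(A * t)))) (Set.Ioi 0) := by
  have h := (integrableOn_min_one_rpow_mul_rpow hs0 hs1).const_mul (max 1 A)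
  refine Integrable.mono' h ?_ ?_
  · refine ContinuousOn.aestronglyMeasurable (fun t ht => ?_) measurableSet_Ioi
    refine ContinuousAt.continuousWithinAt ?_
    exact (Real.continuousAt_rpow_const _ _ (Or.inl (ne_of_gt ht))).mul (by fun_prop)
  · refine (ae_restrict_iff' measurableSet_Ioi).2 (.of_forall fun t ht => ?_)
    have ht : 0 < t := ht
    have h1 : 1 - Real.exp (-(A * t)) ≤ max 1 A * min 1 t := by
      refine (one_sub_exp_neg_le_min (by positivity)).trans ?_
      rcases le_total 1 t with h | h
      · rw [min_eq_left h, mul_one]; exact (min_le_left _ _).trans (le_max_left _ _)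
      · rw [min_eq_right h]
        exact (min_le_right _ _).trans (mul_le_mul_of_nonneg_right (le_max_right _ _) ht.le)
    have h2 : 0 ≤ 1 - Real.exp (-(A * t)) := by
      have : Real.exp (-(A * t)) ≤ 1 := Real.exp_le_one_iff.2 (by nlinarith)
      linarith
    rw [Real.norm_of_nonneg (by positivity), Real.rpow_one, ← mul_assoc, mul_comm]
    exact mul_le_mul_of_nonneg_right h1 (by positivity)

/-- Integration by parts differentiates 1 - e^{-At} and leaves the Gamma integral at 1 - s. The
boundary terms vanish because 1 - e^{-At} ≤ min(1, At) and 0 < s < 1. The factor Γ(1-s)/s is 1/G_s.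
-/
theorem integral_rpow_mul_one_sub_exp {s A : ℝ} (hs0 : 0 < s) (hs1 : s < 1) (hA : 0 ≤ A) :
    ∫ t in Set.Ioi (0 : ℝ), t ^ (-1 - s) * (1 - Real.exp (-(A * t)))
      = Real.Gamma (1 - s) / s * A ^ s := by
  rcases hA.eq_or_lt with rfl | hA
  · simp [Real.zero_rpow hs0.ne']
  have hG := Real.integral_rpow_mul_exp_neg_mul_Ioi (a := 1 - s) (r := A) (by linarith) hA
  have hGint : IntegrableOn (fun t : ℝ => t ^ (-s) * Real.exp (-(A * t))) (Set.Ioi 0) := by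
    have := integrableOn_rpow_mul_exp_neg_mul_rpow (s := -s) (p := 1) (b := A) (by linarith)
      one_pos hA
    simpa using this
  have hlim0 : Tendsto ((fun t : ℝ => 1 - Real.exp (-(A * t))) * fun t => t ^ (-s) / (-s))
      (𝓝[>] 0) (𝓝 0) := by
    have h1 : Tendsto (fun t : ℝ => A / s * t ^ (1 - s)) (𝓝[>] 0) (𝓝 0) := by
      have : Tendsto (fun t : ℝ => A / s * t ^ (1 - s)) (𝓝 0) (𝓝 (A / s * 0 ^ (1 - s))) :=
        ((Real.continuousAt_rpow_const _ _ (Or.inr (by linarith))).const_mul _)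
      rw [Real.zero_rpow (by linarith), mul_zero] at this
      exact this.mono_left nhdsWithin_le_nhds
    refine squeeze_zero_norm' ?_ h1
    filter_upwards [self_mem_nhdsWithin] with t ht
    have ht : 0 < t := ht
    have h2 : 0 ≤ 1 - Real.exp (-(A * t)) := by
      have : Real.exp (-(A * t)) ≤ 1 := Real.exp_le_one_iff.2 (by nlinarith)
      linarith
    have h3 := (one_sub_exp_neg_le_min (x := A * t) (by positivity)).trans (min_le_right _ _)
    have h4 : t ^ (1 - s) = t * t ^ (-s) := by
      rw [sub_eq_add_neg, Real.rpow_add ht, Real.rpow_one]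
    simp only [Pi.mul_apply]
    rw [norm_mul, norm_div, norm_neg, Real.norm_of_nonneg h2, Real.norm_of_nonneg hs0.le,
      Real.norm_of_nonneg (by positivity), h4]
    calc _ ≤ (A * t) * (t ^ (-s) / s) := by gcongr
      _ = _ := by ring
  have hlimi : Tendsto ((fun t : ℝ => 1 - Real.exp (-(A * t))) * fun t => t ^ (-s) / (-s))
      atTop (𝓝 0) := by
    have h1 : Tendsto (fun t : ℝ => 1 / s * t ^ (-s)) atTop (𝓝 0) := by
      simpa using (tendsto_rpow_neg_atTop hs0).const_mul (1 / s)
    refine squeeze_zero_norm' ?_ h1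
    filter_upwards [eventually_gt_atTop 0] with t ht
    have h2 : 0 ≤ 1 - Real.exp (-(A * t)) := by
      have : Real.exp (-(A * t)) ≤ 1 := Real.exp_le_one_iff.2 (by nlinarith)
      linarith
    have h3 := (one_sub_exp_neg_le_min (x := A * t) (by positivity)).trans (min_le_left _ _)
    simp only [Pi.mul_apply]
    rw [norm_mul, norm_div, norm_neg, Real.norm_of_nonneg h2, Real.norm_of_nonneg hs0.le,
      Real.norm_of_nonneg (by positivity)]
    calc _ ≤ 1 * (t ^ (-s) / s) := by gcongr
      _ = _ := by ring
  have key := integral_Ioi_mul_deriv_eq_deriv_mul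
    (u := fun t : ℝ => 1 - Real.exp (-(A * t))) (v := fun t => t ^ (-s) / (-s))
    (u' := fun t => A * Real.exp (-(A * t))) (v' := fun t => t ^ (-1 - s))
    (a := 0) (a' := 0) (b' := 0) ?_ ?_ ?_ ?_ hlim0 hlimi
  · simp_rw [mul_comm (_ ^ (-1 - s))]
    rw [key]
    have : ∀ t : ℝ, A * Real.exp (-(A * t)) * (t ^ (-s) / -s)
        = -(A / s) * (t ^ (1 - s - 1) * Real.exp (-(A * t))) := by
      intro t
      rw [show 1 - s - 1 = -s by ring]; field_simp
    simp_rw [this]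
    rw [integral_const_mul, hG, one_div, Real.inv_rpow hA.le, ← Real.rpow_neg hA.le,
      show -(1 - s) = s - 1 by ring, Real.rpow_sub hA, Real.rpow_one]
    field_simp
    simp
  · intro t _
    have := ((((hasDerivAt_id t).const_mul A).neg).exp).const_sub 1
    convert! this using 1
    simp; ring
  · intro t ht
    have := (Real.hasDerivAt_rpow_const (x := t) (p := -s) (Or.inl (ne_of_gt ht))).div_const (-s)
    convert! this using 1
    rw [show -s - 1 = -1 - s by ring]; field_simp
  · refine (integrableOn_rpow_mul_one_sub_exp hs0 hs1 hA).congr_fun (fun t _ => ?_)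
      measurableSet_Ioi
    simp [mul_comm]
  · refine IntegrableOn.congr_fun (Integrable.const_mul hGint (-(A / s))) (fun t _ => ?_) measurableSet_Ioi
    simp only [Pi.mul_apply]
    field_simp

/-! ### Radial integrability -/

section Radial

variable {V : Type*} [NormedAddCommGroup V] [InnerProductSpace ℝ V] [FiniteDimensional ℝ V]
  [MeasurableSpace V] [BorelSpace V]

/-- The common majorant of the dominated convergence arguments: the power b > a tames the origin and
a > 0 tames infinity. It is used with (a, b) = (s, 1) for the vector kernel and (2s, 2) for the
fractional Laplacian. -/
theorem integrable_min_one_norm_rpow_mul (hd : 0 < Module.finrank ℝ V) {a b : ℝ} (ha : 0 < a)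
    (hab : a < b) :
    Integrable (fun w : V => min 1 (‖w‖ ^ b) * ‖w‖ ^ (-((Module.finrank ℝ V : ℝ) + a))) := by
  have : Nontrivial V := Module.finrank_pos_iff.1 hd
  rw [integrable_fun_norm_addHaar (volume : Measure V)
    (f := fun r : ℝ => min 1 (r ^ b) * r ^ (-((Module.finrank ℝ V : ℝ) + a)))]
  refine (integrableOn_min_one_rpow_mul_rpow ha hab).congr_fun (fun t ht => ?_) measurableSet_Ioi
  have ht : 0 < t := ht
  simp only [smul_eq_mul]
  rw [← Real.rpow_natCast, mul_left_comm, ← Real.rpow_add ht]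
  congr 2
  rw [Nat.cast_sub hd]; push_cast; ring

theorem measurable_norm_rpow (c : ℝ) : Measurable (fun w : V => ‖w‖ ^ c) :=
  measurable_norm.pow_const c

theorem integrable_indicator_norm_rpow (hd : 0 < Module.finrank ℝ V) {a ε : ℝ} (ha : 0 < a)
    (hε : 0 < ε) :
    Integrable ({w : V | ε < ‖w‖}.indicator
      fun w : V => ‖w‖ ^ (-((Module.finrank ℝ V : ℝ) + a))) := by
  have hm : MeasurableSet {w : V | ε < ‖w‖} := measurableSet_lt measurable_const measurable_norm
  -- With the arbitrary choice b = a + 1, the factor min(1, |w|^b) is at least this number on |w| >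
  -- ε and can be divided out.
  have hc : 0 < min 1 (ε ^ (a + 1)) := lt_min one_pos (by positivity)
  refine ((integrable_min_one_norm_rpow_mul hd ha (lt_add_one a)).const_mul
    (min 1 (ε ^ (a + 1)))⁻¹).mono' ((measurable_norm_rpow _).indicator hm).aestronglyMeasurable
    (.of_forall fun w => ?_)
  by_cases hw : ε < ‖w‖
  · rw [Set.indicator_of_mem (by exact hw), Real.norm_of_nonneg (by positivity), ← mul_assoc]
    refine le_mul_of_one_le_left (by positivity) ?_
    rw [← div_eq_inv_mul, one_le_div hc]
    exact min_le_min le_rfl (Real.rpow_le_rpow hε.le hw.le (by linarith))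
  · rw [Set.indicator_of_notMem (by exact hw), norm_zero]
    positivity

theorem one_sub_cos_le_min (x : ℝ) : 1 - Real.cos x ≤ 2 * min 1 (x ^ 2) := by
  rcases le_total 1 (x ^ 2) with h | h
  · rw [min_eq_left h]; linarith [Real.neg_one_le_cos x]
  · rw [min_eq_right h]; nlinarith [Real.one_sub_sq_div_two_le_cos (x := x), sq_nonneg x]

theorem min_one_mul_le {A x : ℝ} (hx : 0 ≤ x) : min 1 (A * x) ≤ max 1 A * min 1 x := by
  rcases le_total 1 x with h | h
  · rw [min_eq_left h, mul_one]; exact (min_le_left _ _).trans (le_max_left _ _)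
  · rw [min_eq_right h]
    exact (min_le_right _ _).trans (mul_le_mul_of_nonneg_right (le_max_right _ _) hx)

theorem two_pi_inner_sq_le (w ξ : V) :
    (2 * Real.pi * inner ℝ w ξ) ^ 2 ≤ (2 * Real.pi * ‖ξ‖) ^ 2 * ‖w‖ ^ 2 := by
  have h : (inner ℝ w ξ) ^ 2 ≤ (‖w‖ * ‖ξ‖) ^ 2 :=
    sq_le_sq' (by linarith [neg_le_of_abs_le (abs_real_inner_le_norm w ξ)])
      (real_inner_le_norm w ξ)
  calc (2 * Real.pi * inner ℝ w ξ) ^ 2 = (2 * Real.pi) ^ 2 * (inner ℝ w ξ) ^ 2 := by ring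
    _ ≤ (2 * Real.pi) ^ 2 * (‖w‖ * ‖ξ‖) ^ 2 := by gcongr
    _ = _ := by ring

theorem integrable_one_sub_cos_mul (hd : 0 < Module.finrank ℝ V) {s : ℝ} (hs0 : 0 < s)
    (hs1 : s < 1) (ξ : V) :
    Integrable (fun w : V => (1 - Real.cos (2 * Real.pi * inner ℝ w ξ))
      * ‖w‖ ^ (-((Module.finrank ℝ V : ℝ) + 2 * s))) := by
  refine ((integrable_min_one_norm_rpow_mul hd (a := 2 * s) (b := 2) (by linarith)
    (by linarith)).const_mul (2 * max 1 ((2 * Real.pi * ‖ξ‖) ^ 2))).mono' ?_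
    (.of_forall fun w => ?_)
  · exact ((by fun_prop : Measurable fun w : V => 1 - Real.cos (2 * Real.pi * inner ℝ w ξ)).mul
      (measurable_norm_rpow _)).aestronglyMeasurable
  · have h0 : 0 ≤ 1 - Real.cos (2 * Real.pi * inner ℝ w ξ) := by
      linarith [Real.cos_le_one (2 * Real.pi * inner ℝ w ξ)]
    rw [Real.norm_of_nonneg (by positivity), ← mul_assoc]
    refine mul_le_mul_of_nonneg_right ?_ (by positivity)
    refine (one_sub_cos_le_min _).trans ?_
    rw [mul_assoc (2 : ℝ) (max _ _)]
    refine mul_le_mul_of_nonneg_left ?_ (zero_le_two (α := ℝ))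
    rw [Real.rpow_two]
    exact (min_le_min (le_refl (1 : ℝ)) (two_pi_inner_sq_le w ξ)).trans (min_one_mul_le (by positivity))

end Radial

/-! ### Gaussian subordination and the Fourier symbol of the fractional Laplacian -/

section Subordination

variable {V : Type*} [NormedAddCommGroup V] [InnerProductSpace ℝ V] [FiniteDimensional ℝ V]
  [MeasurableSpace V] [BorelSpace V]

theorem integral_cos_mul_exp_neg_mul_norm_sq {b : ℝ} (hb : 0 < b) (ξ : V) :
    ∫ w : V, Real.cos (2 * Real.pi * inner ℝ w ξ) * Real.exp (-b * ‖w‖ ^ 2)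
      = (Real.pi / b) ^ ((Module.finrank ℝ V : ℝ) / 2)
        * Real.exp (-(Real.pi ^ 2 * ‖ξ‖ ^ 2 / b)) := by
  have h := GaussianFourier.integral_cexp_neg_mul_sq_norm_add (V := V) (b := (b : ℂ))
    (by simpa using hb) (2 * Real.pi * Complex.I) ξ
  have h2 := congrArg (fun z : ℂ => RCLike.re z) h
  beta_reduce at h2
  have hint : Integrable (fun v : V => Complex.exp (-(b : ℂ) * ‖v‖ ^ 2
      + 2 * Real.pi * Complex.I * (inner ℝ ξ v : ℝ))) :=
    GaussianFourier.integrable_cexp_neg_mul_sq_norm_add (by simpa using hb) _ ξ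
  rw [← integral_re hint] at h2
  convert! h2 using 1
  · refine integral_congr_ae (.of_forall fun v => ?_)
    have : (-(b : ℂ) * ‖v‖ ^ 2 + 2 * Real.pi * Complex.I * (inner ℝ ξ v : ℝ))
        = ((-b * ‖v‖ ^ 2 : ℝ) : ℂ) + ((2 * Real.pi * inner ℝ v ξ : ℝ) : ℂ) * Complex.I := by
      rw [real_inner_comm]; push_cast; ring
    simp only [this, RCLike.re_eq_complex_re, Complex.exp_add, Complex.re_ofReal_mul,
      ← Complex.ofReal_exp, Complex.exp_ofReal_mul_I_re]
    ring
  · rw [RCLike.re_eq_complex_re]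
    have : ((2 * Real.pi * Complex.I) ^ 2 * (‖ξ‖ : ℂ) ^ 2 / (4 * b))
        = ((-(Real.pi ^ 2 * ‖ξ‖ ^ 2 / b) : ℝ) : ℂ) := by
      rw [mul_pow, Complex.I_sq]; push_cast; field_simp; ring
    rw [this, ← Complex.ofReal_exp, ← Complex.ofReal_div,
      show ((Module.finrank ℝ V : ℂ) / 2) = (((Module.finrank ℝ V : ℝ) / 2 : ℝ) : ℂ) by push_cast; rfl,
      ← Complex.ofReal_cpow (by positivity), ← Complex.ofReal_mul, Complex.ofReal_re]

theorem integral_one_sub_cos_mul_exp_neg_mul_norm_sq {b : ℝ} (hb : 0 < b) (ξ : V) :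
    ∫ w : V, (1 - Real.cos (2 * Real.pi * inner ℝ w ξ)) * Real.exp (-b * ‖w‖ ^ 2)
      = (Real.pi / b) ^ ((Module.finrank ℝ V : ℝ) / 2)
        * (1 - Real.exp (-(Real.pi ^ 2 * ‖ξ‖ ^ 2 / b))) := by
  have hint : Integrable (fun v : V => Real.exp (-b * ‖v‖ ^ 2)) := by
    have := (GaussianFourier.integrable_cexp_neg_mul_sq_norm_add (V := V) (b := (b : ℂ))
      (by simpa using hb) 0 0).norm
    simpa [Complex.norm_exp, ← Complex.ofReal_pow] using this
  have hint2 : Integrable (fun v : V => Real.cos (2 * Real.pi * inner ℝ v ξ)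
      * Real.exp (-b * ‖v‖ ^ 2)) := by
    refine hint.bdd_mul (c := 1) (by fun_prop) (.of_forall fun v => ?_)
    exact Real.abs_cos_le_one _
  simp_rw [sub_mul, one_mul]
  rw [integral_sub hint hint2, integral_cos_mul_exp_neg_mul_norm_sq hb,
    GaussianFourier.integral_rexp_neg_mul_sq_norm hb]
  ring

/-- The substitution t ↦ 1/t. It is needed because the Gaussian integral puts the subordination
parameter in the denominator of the exponent. -/
theorem integral_rpow_mul_one_sub_exp_div {s A : ℝ} (hs0 : 0 < s) (hs1 : s < 1) (hA : 0 ≤ A) :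
    ∫ t in Set.Ioi (0 : ℝ), t ^ (s - 1) * (1 - Real.exp (-(A / t)))
      = Real.Gamma (1 - s) / s * A ^ s := by
  rw [← integral_rpow_mul_one_sub_exp hs0 hs1 hA,
    ← integral_comp_rpow_Ioi (fun t : ℝ => t ^ (s - 1) * (1 - Real.exp (-(A / t))))
      (p := -1) (by norm_num)]
  refine setIntegral_congr_fun measurableSet_Ioi fun t ht => ?_
  have ht : 0 < t := ht
  simp only [smul_eq_mul, Real.rpow_neg_one, abs_neg, abs_one, one_mul, div_inv_eq_mul]
  rw [Real.inv_rpow ht.le, ← Real.rpow_neg ht.le, ← mul_assoc, ← Real.rpow_add ht]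
  ring_nf

/-- Γ(1-s) = -s Γ(-s) shows that Γ(-s) is negative, which resolves the absolute value. -/
theorem fracLapConst_eq {n : ℕ} {s : ℝ} (hs0 : 0 < s) (hs1 : s < 1) :
    fracLapConst n s = (4 : ℝ) ^ s * Real.Gamma (s + (n : ℝ) / 2) /
    (Real.pi ^ ((n : ℝ) / 2) * (Real.Gamma (1 - s) / s)) := by
  have h : Real.Gamma (1 - s) = -s * Real.Gamma (-s) := by
    rw [← Real.Gamma_add_one (by linarith : -s ≠ 0)]; ring_nf
  have h1 : 0 < Real.Gamma (1 - s) := Real.Gamma_pos_of_pos (by linarith)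
  have h2 : |Real.Gamma (-s)| = Real.Gamma (1 - s) / s := by
    rw [abs_of_neg (by nlinarith), h]; field_simp
  rw [fracLapConst, h2]

theorem fracLapConst_pos {n : ℕ} {s : ℝ} (hs0 : 0 < s) (hs1 : s < 1) : 0 < fracLapConst n s := by
  rw [fracLapConst_eq hs0 hs1]
  have h1 : 0 < Real.Gamma (1 - s) := Real.Gamma_pos_of_pos (by linarith)
  have h2 : 0 < Real.Gamma (s + (n : ℝ) / 2) := Real.Gamma_pos_of_pos (by positivity)
  positivity

/-- The Fourier symbol of the fractional Laplacian. -/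
theorem fracLapConst_mul_integral_one_sub_cos (hd : 0 < Module.finrank ℝ V) {s : ℝ} (hs0 : 0 < s)
    (hs1 : s < 1) (ξ : V) :
    fracLapConst (Module.finrank ℝ V) s * ∫ w : V, (1 - Real.cos (2 * Real.pi * inner ℝ w ξ))
      * ‖w‖ ^ (-((Module.finrank ℝ V : ℝ) + 2 * s)) = (2 * Real.pi * ‖ξ‖) ^ (2 * s) := by
  have : Nontrivial V := Module.finrank_pos_iff.1 hd
  set d : ℝ := (Module.finrank ℝ V : ℝ) with hdd
  have hd0 : 0 < d := by rw [hdd]; exact_mod_cast hd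
  set p : ℝ := s + d / 2 with hp
  have hp0 : 0 < p := by positivity
  have hΓp : 0 < Real.Gamma p := Real.Gamma_pos_of_pos hp0
  have hπ := Real.pi_pos
  have hΓ : 0 < Real.Gamma (1 - s) := Real.Gamma_pos_of_pos (by linarith)
  -- With p = s + d/2, the Gamma integral of t^{p-1} e^{-π|w|²t} over t is π^{-p} Γ(p)
  -- |w|^{-(d+2s)}: the power of |w| is a superposition of Gaussians, and Fubini leaves a Gaussian
  -- integral in w.
  let F : V → ℝ → ℝ := fun w t => (1 - Real.cos (2 * Real.pi * inner ℝ w ξ))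
    * (t ^ (p - 1) * Real.exp (-(Real.pi * ‖w‖ ^ 2 * t)))
  have hF0 : ∀ w, ∀ t ∈ Set.Ioi (0 : ℝ), 0 ≤ F w t := fun w t ht => by
    have : 0 ≤ 1 - Real.cos (2 * Real.pi * inner ℝ w ξ) := by
      linarith [Real.cos_le_one (2 * Real.pi * inner ℝ w ξ)]
    have ht : 0 < t := ht
    positivity
  have hFm : AEStronglyMeasurable (Function.uncurry F)
      ((volume : Measure V).prod (volume.restrict (Set.Ioi 0))) := by
    refine Measurable.aestronglyMeasurable ?_
    have h1 : Measurable fun z : V × ℝ => z.2 ^ (p - 1) := measurable_snd.pow_const _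
    exact (by fun_prop : Measurable fun z : V × ℝ => 1 - Real.cos (2 * Real.pi * inner ℝ z.1 ξ)).mul
      (h1.mul (by fun_prop))
  have hFt : ∀ w : V, w ≠ 0 → IntegrableOn (F w) (Set.Ioi 0) ∧ ∫ t in Set.Ioi 0, F w t
      = Real.pi ^ (-p) * Real.Gamma p *
        ((1 - Real.cos (2 * Real.pi * inner ℝ w ξ)) * ‖w‖ ^ (-(d + 2 * s))) := by
    intro w hw
    have hw0 : 0 < ‖w‖ := norm_pos_iff.2 hw
    have hb : 0 < Real.pi * ‖w‖ ^ 2 := by positivity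
    constructor
    · have := integrableOn_rpow_mul_exp_neg_mul_rpow (s := p - 1) (p := 1) (b := Real.pi * ‖w‖ ^ 2)
        (by linarith) one_pos hb
      simp only [Real.rpow_one, neg_mul] at this
      exact Integrable.const_mul this _
    · have := Real.integral_rpow_mul_exp_neg_mul_Ioi hp0 hb
      simp only [F]
      rw [integral_const_mul, this, one_div, Real.inv_rpow hb.le, ← Real.rpow_neg hb.le,
        Real.mul_rpow hπ.le (by positivity), ← Real.rpow_natCast, ← Real.rpow_mul hw0.le]
      have : ((2 : ℕ) : ℝ) * -p = -(d + 2 * s) := by rw [hp]; push_cast; ring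
      rw [this]; ring
  have hae : ∀ᵐ w : V, w ≠ 0 := by simp [ae_iff]
  have hFint : Integrable (Function.uncurry F)
      ((volume : Measure V).prod (volume.restrict (Set.Ioi 0))) := by
    -- As F is nonnegative, integrability on the product follows from that of its t-integral, which
    -- is a multiple of the integrand in question.
    rw [integrable_prod_iff hFm]
    refine ⟨hae.mono fun w hw => (hFt w hw).1, ?_⟩
    refine ((integrable_one_sub_cos_mul hd hs0 hs1 ξ).const_mul
      (Real.pi ^ (-p) * Real.Gamma p)).congr (hae.mono fun w hw => ?_)
    simp only [Function.uncurry_apply_pair]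
    rw [← (hFt w hw).2]
    exact setIntegral_congr_fun measurableSet_Ioi fun t ht => (Real.norm_of_nonneg (hF0 w t ht)).symm
  have hswap := integral_integral_swap hFint
  have hl : ∫ w, ∫ t in Set.Ioi 0, F w t = Real.pi ^ (-p) * Real.Gamma p *
      ∫ w : V, (1 - Real.cos (2 * Real.pi * inner ℝ w ξ)) * ‖w‖ ^ (-(d + 2 * s)) := by
    rw [← integral_const_mul]
    exact integral_congr_ae (hae.mono fun w hw => (hFt w hw).2)
  have hr : ∫ t in Set.Ioi 0, ∫ w, F w t = Real.Gamma (1 - s) / s * (Real.pi * ‖ξ‖ ^ 2) ^ s := by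
    rw [← integral_rpow_mul_one_sub_exp_div hs0 hs1 (by positivity)]
    refine setIntegral_congr_fun measurableSet_Ioi fun t ht => ?_
    have ht : 0 < t := ht
    have h1 : ∀ w, F w t = t ^ (p - 1) * ((1 - Real.cos (2 * Real.pi * inner ℝ w ξ))
        * Real.exp (-(Real.pi * t) * ‖w‖ ^ 2)) := fun w => by
      simp only [F]
      rw [show -(Real.pi * t) * ‖w‖ ^ 2 = -(Real.pi * ‖w‖ ^ 2 * t) by ring]; ring
    simp_rw [h1]
    rw [integral_const_mul, integral_one_sub_cos_mul_exp_neg_mul_norm_sq (by positivity), ← hdd,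
      ← mul_assoc]
    have h2 : Real.pi / (Real.pi * t) = t⁻¹ := by field_simp
    have h3 : Real.pi ^ 2 * ‖ξ‖ ^ 2 / (Real.pi * t) = Real.pi * ‖ξ‖ ^ 2 / t := by field_simp
    rw [h2, h3, Real.inv_rpow ht.le, ← Real.rpow_neg ht.le, ← Real.rpow_add ht]
    congr 2
    rw [hp]; ring
  rw [hl, hr] at hswap
  have hI : ∫ w : V, (1 - Real.cos (2 * Real.pi * inner ℝ w ξ)) * ‖w‖ ^ (-(d + 2 * s))
      = Real.pi ^ p / Real.Gamma p * (Real.Gamma (1 - s) / s * (Real.pi * ‖ξ‖ ^ 2) ^ s) := by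
    rw [← hswap, Real.rpow_neg hπ.le]; field_simp
  rw [hI, fracLapConst_eq hs0 hs1, ← hdd, ← hp]
  have h4 : (2 * Real.pi * ‖ξ‖) ^ (2 * s) = 4 ^ s * Real.pi ^ s * (Real.pi * ‖ξ‖ ^ 2) ^ s := by
    rw [Real.rpow_mul (by positivity), ← Real.mul_rpow (by norm_num) hπ.le,
      ← Real.mul_rpow (by positivity) (by positivity), Real.rpow_two]
    ring_nf
  have h5 : Real.pi ^ p = Real.pi ^ s * Real.pi ^ (d / 2) := by rw [hp, Real.rpow_add hπ]
  rw [h4, h5]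
  field_simp

end Subordination

/-! ### The sine integral -/

theorem integrableOn_rpow_mul_one_sub_cos {s : ℝ} (hs0 : 0 < s) (hs1 : s < 1) :
    IntegrableOn (fun t : ℝ => t ^ (-2 - s) * (1 - Real.cos t)) (Set.Ioi 0) := by
  have h := (integrableOn_min_one_rpow_mul_rpow (a := 1 + s) (b := 2) (by linarith)
    (by linarith)).const_mul 2
  refine Integrable.mono' h ?_ ?_
  · refine ContinuousOn.aestronglyMeasurable (fun t ht => ?_) measurableSet_Ioi
    refine ContinuousAt.continuousWithinAt ?_
    exact (Real.continuousAt_rpow_const _ _ (Or.inl (ne_of_gt ht))).mul (by fun_prop)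
  · refine (ae_restrict_iff' measurableSet_Ioi).2 (.of_forall fun t ht => ?_)
    have ht : 0 < t := ht
    have h2 : 0 ≤ 1 - Real.cos t := by linarith [Real.cos_le_one t]
    rw [Real.norm_of_nonneg (by positivity), Real.rpow_two, ← mul_assoc, mul_comm,
      show -1 - (1 + s) = -2 - s by ring]
    exact mul_le_mul_of_nonneg_right (one_sub_cos_le_min t) (by positivity)

theorem abs_sin_le_min (x : ℝ) : |Real.sin x| ≤ min 1 |x| :=
  le_min (Real.abs_sin_le_one x) Real.abs_sin_le_abs

theorem integrableOn_rpow_mul_sin {s : ℝ} (hs0 : 0 < s) (hs1 : s < 1) :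
    IntegrableOn (fun t : ℝ => t ^ (-1 - s) * Real.sin t) (Set.Ioi 0) := by
  have h := (integrableOn_min_one_rpow_mul_rpow hs0 hs1)
  refine Integrable.mono' h ?_ ?_
  · refine ContinuousOn.aestronglyMeasurable (fun t ht => ?_) measurableSet_Ioi
    refine ContinuousAt.continuousWithinAt ?_
    exact (Real.continuousAt_rpow_const _ _ (Or.inl (ne_of_gt ht))).mul (by fun_prop)
  · refine (ae_restrict_iff' measurableSet_Ioi).2 (.of_forall fun t ht => ?_)
    have ht : 0 < t := ht
    rw [norm_mul, Real.norm_of_nonneg (by positivity : (0 : ℝ) ≤ t ^ (-1 - s)), Real.rpow_one,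
      mul_comm]
    refine mul_le_mul_of_nonneg_right ?_ (by positivity)
    simpa [abs_of_pos ht] using abs_sin_le_min t

/-- This is the symbol formula in dimension 1, at order (1+s)/2 and frequency 1/(2π), where the
right side is 1. The factor 2 comes from folding the even integrand onto the half-line. -/
theorem integral_rpow_mul_one_sub_cos {s : ℝ} (hs0 : 0 < s) (hs1 : s < 1) :
    ∫ t in Set.Ioi (0 : ℝ), t ^ (-2 - s) * (1 - Real.cos t)
      = 1 / (2 * fracLapConst 1 ((1 + s) / 2)) := by
  have hC := fracLapConst_pos (n := 1) (s := (1 + s) / 2) (by linarith) (by linarith)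
  have h := fracLapConst_mul_integral_one_sub_cos (V := ℝ) (by simp) (s := (1 + s) / 2)
    (by linarith) (by linarith) (1 / (2 * Real.pi))
  have hπ := Real.pi_pos
  have e1 : (2 * Real.pi * ‖1 / (2 * Real.pi)‖) = 1 := by
    rw [Real.norm_of_nonneg (by positivity)]; field_simp
  rw [e1, Real.one_rpow, Module.finrank_self] at h
  have e2 : ∀ w : ℝ, (1 - Real.cos (2 * Real.pi * inner ℝ w (1 / (2 * Real.pi))))
      * ‖w‖ ^ (-(((1 : ℕ) : ℝ) + 2 * ((1 + s) / 2))) =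
      (fun t : ℝ => t ^ (-2 - s) * (1 - Real.cos t)) |w| := by
    intro w
    simp only [Real.norm_eq_abs, Real.cos_abs, RCLike.inner_apply, conj_trivial]
    rw [mul_comm]
    congr 2
    · push_cast; ring
    · congr 1; field_simp
  simp_rw [e2] at h
  have h6 := integral_comp_abs (f := fun t : ℝ => t ^ (-2 - s) * (1 - Real.cos t))
  beta_reduce at h6
  rw [h6] at h
  field_simp
  linarith

/-- Integration by parts with the primitive 1 - cos reduces this to the preceding integral; what
remains is an identity between Gamma values. -/
theorem integral_rpow_mul_sin {s : ℝ} (hs0 : 0 < s) (hs1 : s < 1) :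
    ∫ t in Set.Ioi (0 : ℝ), t ^ (-1 - s) * Real.sin t
      = Real.Gamma (1 - s) / s * Real.sin (Real.pi * s / 2) := by
  have hlim0 : Tendsto ((fun t : ℝ => t ^ (-1 - s)) * fun t => 1 - Real.cos t)
      (𝓝[>] 0) (𝓝 0) := by
    have h1 : Tendsto (fun t : ℝ => 2 * t ^ (1 - s)) (𝓝[>] 0) (𝓝 0) := by
      have : Tendsto (fun t : ℝ => 2 * t ^ (1 - s)) (𝓝 0) (𝓝 (2 * 0 ^ (1 - s))) :=
        ((Real.continuousAt_rpow_const _ _ (Or.inr (by linarith))).const_mul _)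
      rw [Real.zero_rpow (by linarith), mul_zero] at this
      exact this.mono_left nhdsWithin_le_nhds
    refine squeeze_zero_norm' ?_ h1
    filter_upwards [self_mem_nhdsWithin] with t ht
    have ht : 0 < t := ht
    have h2 : 0 ≤ 1 - Real.cos t := by linarith [Real.cos_le_one t]
    have h3 : 1 - Real.cos t ≤ 2 * t ^ 2 := (one_sub_cos_le_min t).trans
      (mul_le_mul_of_nonneg_left (min_le_right _ _) zero_le_two)
    have h4 : t ^ (1 - s) = t ^ (-1 - s) * t ^ 2 := by
      rw [← Real.rpow_natCast, ← Real.rpow_add ht]; congr 1; push_cast; ring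
    simp only [Pi.mul_apply]
    rw [Real.norm_of_nonneg (by positivity), h4]
    calc _ ≤ t ^ (-1 - s) * (2 * t ^ 2) := by gcongr
      _ = _ := by ring
  have hlimi : Tendsto ((fun t : ℝ => t ^ (-1 - s)) * fun t => 1 - Real.cos t)
      atTop (𝓝 0) := by
    have h1 : Tendsto (fun t : ℝ => 2 * t ^ (-(1 + s))) atTop (𝓝 0) := by
      simpa using (tendsto_rpow_neg_atTop (by linarith : 0 < 1 + s)).const_mul 2
    refine squeeze_zero_norm' ?_ h1
    filter_upwards [eventually_gt_atTop 0] with t ht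
    have h2 : 0 ≤ 1 - Real.cos t := by linarith [Real.cos_le_one t]
    have h3 : 1 - Real.cos t ≤ 2 := by linarith [Real.neg_one_le_cos t]
    simp only [Pi.mul_apply]
    rw [Real.norm_of_nonneg (by positivity), show -(1 + s) = -1 - s by ring]
    calc _ ≤ t ^ (-1 - s) * 2 := by gcongr
      _ = _ := by ring
  have key := integral_Ioi_mul_deriv_eq_deriv_mul
    (u := fun t : ℝ => t ^ (-1 - s)) (v := fun t => 1 - Real.cos t)
    (u' := fun t => (-1 - s) * t ^ (-2 - s)) (v' := fun t => Real.sin t)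
    (a := 0) (a' := 0) (b' := 0) ?_ ?_ ?_ ?_ hlim0 hlimi
  · rw [key]
    simp_rw [mul_assoc]
    rw [integral_const_mul, integral_rpow_mul_one_sub_cos hs0 hs1, fracLapConst_eq (by linarith)
      (by linarith)]
    -- Duplication at (1-s)/2 eliminates Γ((1-s)/2), and reflection at s/2 produces sin(πs/2); the
    -- remaining Gamma factors cancel.
    have hd := Real.Gamma_mul_Gamma_add_half ((1 - s) / 2)
    have hr := Real.Gamma_mul_Gamma_one_sub (s / 2)
    have hg := Real.Gamma_add_one (s := s / 2) (by positivity)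
    have p1 : 0 < Real.Gamma (s / 2) := Real.Gamma_pos_of_pos (by positivity)
    have p2 : 0 < Real.Gamma (1 - s / 2) := Real.Gamma_pos_of_pos (by linarith)
    have p3 : 0 < Real.sin (Real.pi * (s / 2)) := Real.sin_pos_of_pos_of_lt_pi
      (by positivity) (by nlinarith [Real.pi_pos])
    rw [show (1 - s) / 2 + 1 / 2 = 1 - s / 2 by ring, show 2 * ((1 - s) / 2) = 1 - s by ring,
      show 1 - (1 - s) = s by ring] at hd
    rw [show (1 + s) / 2 + ((1 : ℕ) : ℝ) / 2 = s / 2 + 1 by push_cast; ring, hg,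
      show 1 - (1 + s) / 2 = (1 - s) / 2 by ring, show Real.pi * s / 2 = Real.pi * (s / 2) by ring]
    have h4 : (4 : ℝ) ^ ((1 + s) / 2) = 2 * 2 ^ s := by
      rw [show (4 : ℝ) = 2 ^ (2 : ℝ) by norm_num, ← Real.rpow_mul (by norm_num),
        show 2 * ((1 + s) / 2) = 1 + s by ring, Real.rpow_add (by norm_num), Real.rpow_one]
    have hsin : Real.sin (Real.pi * (s / 2))
        = Real.pi / (Real.Gamma (s / 2) * Real.Gamma (1 - s / 2)) := by
      rw [hr]; field_simp
    have hG2 : Real.Gamma ((1 - s) / 2)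
        = Real.Gamma (1 - s) * 2 ^ s * √Real.pi / Real.Gamma (1 - s / 2) := by
      rw [eq_div_iff p2.ne', hd]
    rw [h4, hsin, hG2, show ((1 : ℕ) : ℝ) / 2 = 1 / 2 by norm_num, ← Real.sqrt_eq_rpow]
    have hsq := Real.mul_self_sqrt Real.pi_pos.le
    generalize Real.Gamma (1 - s / 2) = X at *
    field_simp
    rw [sq, hsq]
    ring
  · intro t ht
    have := Real.hasDerivAt_rpow_const (x := t) (p := -1 - s) (Or.inl (ne_of_gt ht))
    convert! this using 1
    rw [show -1 - s - 1 = -2 - s by ring]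
  · intro t _
    simpa using (Real.hasDerivAt_cos t).const_sub 1
  · exact integrableOn_rpow_mul_sin hs0 hs1
  · refine IntegrableOn.congr_fun (Integrable.const_mul (integrableOn_rpow_mul_one_sub_cos hs0 hs1)
      (-1 - s)) (fun t _ => ?_) measurableSet_Ioi
    simp only [Pi.mul_apply]; ring

/-! ### The vector kernel and its sine transform -/

/-- The kernel `w |w|^{-(n+s+1)}`. -/
noncomputable def vecKernel (n : ℕ) (s : ℝ) (w : E n) : E n := ‖w‖ ^ (-((n : ℝ) + s + 1)) • w

/-- The kernel `w |w|^{-(n+s+1)}`, restricted to `|w| > ε`. -/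
noncomputable def truncKernel (n : ℕ) (s ε : ℝ) : E n → E n :=
  {w | ε < ‖w‖}.indicator (vecKernel n s)

/-- The sine transform of the truncated kernel. -/
noncomputable def sinSymbol (n : ℕ) (s ε : ℝ) (ξ : E n) : E n :=
  ∫ w : E n, Real.sin (2 * Real.pi * inner ℝ w ξ) • truncKernel n s ε w

variable {n : ℕ} {s ε : ℝ}

theorem vecKernel_neg (w : E n) : vecKernel n s (-w) = -vecKernel n s w := by
  simp [vecKernel]

theorem vecKernel_zero : vecKernel n s 0 = 0 := by simp [vecKernel]

theorem norm_vecKernel {w : E n} (hw : w ≠ 0) : ‖vecKernel n s w‖ = ‖w‖ ^ (-((n : ℝ) + s)) := by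
  have h : 0 < ‖w‖ := norm_pos_iff.2 hw
  rw [vecKernel, norm_smul, Real.norm_of_nonneg (by positivity), ← Real.rpow_add_one h.ne']
  ring_nf

theorem norm_vecKernel_le (w : E n) : ‖vecKernel n s w‖ ≤ ‖w‖ ^ (-((n : ℝ) + s)) := by
  by_cases hw : w = 0
  · rw [hw, vecKernel_zero, norm_zero]; positivity
  · exact (norm_vecKernel hw).le

theorem vecKernel_smul {t : ℝ} (ht : 0 < t) (w : E n) :
    vecKernel n s (t • w) = t ^ (-((n : ℝ) + s)) • vecKernel n s w := by
  rw [vecKernel, vecKernel, norm_smul, Real.norm_of_nonneg ht.le, Real.mul_rpow ht.le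
    (norm_nonneg _), smul_smul, smul_smul]
  congr 1
  rw [mul_right_comm, ← Real.rpow_add_one ht.ne']
  ring_nf

theorem vecKernel_map (R : E n ≃ₗᵢ[ℝ] E n) (w : E n) :
    vecKernel n s (R w) = R (vecKernel n s w) := by
  simp [vecKernel]

theorem measurable_vecKernel : Measurable (vecKernel n s) :=
  (measurable_norm_rpow _).smul measurable_id

theorem measurableSet_lt_norm (ε : ℝ) : MeasurableSet {w : E n | ε < ‖w‖} :=
  measurableSet_lt measurable_const measurable_norm

theorem truncKernel_of_lt {w : E n} (h : ε < ‖w‖) : truncKernel n s ε w = vecKernel n s w :=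
  Set.indicator_of_mem (s := {w : E n | ε < ‖w‖}) h _

theorem truncKernel_of_not_lt {w : E n} (h : ¬ ε < ‖w‖) : truncKernel n s ε w = 0 :=
  Set.indicator_of_notMem (s := {w : E n | ε < ‖w‖}) h _

/-- Truncation at ε = 0 removes only the origin, where the kernel is zero anyway because of the
factor w. So `sinSymbol n s 0` is the untruncated symbol, and statements for arbitrary ε include it.
-/
theorem truncKernel_zero : truncKernel n s 0 = vecKernel n s := by
  ext1 w
  by_cases hw : w = 0
  · rw [hw, truncKernel_of_not_lt (by simp), vecKernel_zero]
  · exact truncKernel_of_lt (norm_pos_iff.2 hw)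

theorem measurable_truncKernel : Measurable (truncKernel n s ε) :=
  measurable_vecKernel.indicator (measurableSet_lt_norm ε)

theorem truncKernel_neg (w : E n) : truncKernel n s ε (-w) = -truncKernel n s ε w := by
  by_cases h : ε < ‖w‖
  · rw [truncKernel_of_lt h, truncKernel_of_lt (by rwa [norm_neg]), vecKernel_neg]
  · rw [truncKernel_of_not_lt h, truncKernel_of_not_lt (by rwa [norm_neg]), neg_zero]

theorem truncKernel_smul {t : ℝ} (ht : 0 < t) (w : E n) :
    truncKernel n s (t * ε) (t • w) = t ^ (-((n : ℝ) + s)) • truncKernel n s ε w := by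
  have hn : ‖t • w‖ = t * ‖w‖ := by rw [norm_smul, Real.norm_of_nonneg ht.le]
  by_cases h : ε < ‖w‖
  · rw [truncKernel_of_lt h, truncKernel_of_lt (by rw [hn]; gcongr), vecKernel_smul ht]
  · rw [truncKernel_of_not_lt h, truncKernel_of_not_lt, smul_zero]
    rw [hn, mul_lt_mul_iff_right₀ ht]; exact h

theorem truncKernel_map (R : E n ≃ₗᵢ[ℝ] E n) (w : E n) :
    truncKernel n s ε (R w) = R (truncKernel n s ε w) := by
  by_cases h : ε < ‖w‖
  · rw [truncKernel_of_lt h, truncKernel_of_lt (by rwa [R.norm_map]), vecKernel_map]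
  · rw [truncKernel_of_not_lt h, truncKernel_of_not_lt (by rwa [R.norm_map]), map_zero]

theorem norm_truncKernel_le_vecKernel (w : E n) : ‖truncKernel n s ε w‖ ≤ ‖vecKernel n s w‖ :=
  norm_indicator_le_norm_self _ _

theorem norm_truncKernel_le (hs0 : 0 < s) (hε : 0 < ε) (w : E n) :
    ‖truncKernel n s ε w‖ ≤ ε ^ (-((n : ℝ) + s)) := by
  by_cases h : ε < ‖w‖
  · rw [truncKernel_of_lt h]
    refine (norm_vecKernel_le w).trans ?_
    exact Real.rpow_le_rpow_of_nonpos hε h.le (by linarith [Nat.cast_nonneg (α := ℝ) n])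
  · rw [truncKernel_of_not_lt h, norm_zero]; positivity

theorem integrable_norm_rpow_indicator (hn : 1 ≤ n) {a : ℝ} (ha : 0 < a) (hε : 0 < ε) :
    Integrable ({w : E n | ε < ‖w‖}.indicator fun w : E n => ‖w‖ ^ (-((n : ℝ) + a))) := by
  have h := integrable_indicator_norm_rpow (V := E n) (by simp; omega) ha hε
  simpa only [finrank_euclideanSpace_fin] using h

theorem integrable_truncKernel (hn : 1 ≤ n) (hs0 : 0 < s) (hε : 0 < ε) :
    Integrable (truncKernel n s ε) := by
  refine (integrable_norm_rpow_indicator hn hs0 hε).mono'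
    measurable_truncKernel.aestronglyMeasurable (.of_forall fun w => ?_)
  rw [truncKernel, norm_indicator_eq_indicator_norm]
  exact Set.indicator_le_indicator (norm_vecKernel_le w)

/-- Reflection invariance of the integral holds also for the default value 0 of a non-integrable
function, so integrability plays no role. -/
theorem integral_eq_zero_of_odd {F : Type*} [NormedAddCommGroup F] [NormedSpace ℝ F] {f : E n → F}
    (hf : ∀ w, f (-w) = -f w) : ∫ w, f w = 0 := by
  have h := integral_neg_eq_self f (volume : Measure (E n))
  simp_rw [hf, integral_neg] at h
  have h2 : (2 : ℝ) • ∫ w, f w = 0 := by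
    rw [two_smul]; nth_rewrite 1 [← h]; exact neg_add_cancel _
  exact (smul_eq_zero.1 h2).resolve_left two_ne_zero

theorem integral_truncKernel : ∫ w, truncKernel n s ε w = 0 :=
  integral_eq_zero_of_odd truncKernel_neg

theorem abs_sin_two_pi_inner_le (w ξ : E n) :
    |Real.sin (2 * Real.pi * inner ℝ w ξ)| ≤ min 1 (2 * Real.pi * (‖ξ‖ * ‖w‖)) := by
  refine (abs_sin_le_min _).trans (min_le_min le_rfl ?_)
  rw [abs_mul, abs_of_pos Real.two_pi_pos, mul_comm ‖ξ‖]
  exact mul_le_mul_of_nonneg_left (abs_real_inner_le_norm w ξ) Real.two_pi_pos.le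

theorem integrable_min_one_mul (hn : 1 ≤ n) (hs0 : 0 < s) (hs1 : s < 1) {A : ℝ} (hA : 0 ≤ A) :
    Integrable (fun w : E n => min 1 (A * ‖w‖) * ‖w‖ ^ (-((n : ℝ) + s))) := by
  have h := integrable_min_one_norm_rpow_mul (V := E n) (by simp; omega) hs0 hs1
  simp only [finrank_euclideanSpace_fin, Real.rpow_one] at h
  refine (h.const_mul (max 1 A)).mono' ?_ (.of_forall fun w => ?_)
  · exact ((by fun_prop : Measurable fun w : E n => min 1 (A * ‖w‖)).mul
      (measurable_norm_rpow _)).aestronglyMeasurable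
  · rw [Real.norm_of_nonneg (by positivity), ← mul_assoc]
    exact mul_le_mul_of_nonneg_right (min_one_mul_le (norm_nonneg _)) (by positivity)

theorem integrable_min_one_inner_bound (hn : 1 ≤ n) (hs0 : 0 < s) (hs1 : s < 1) (ξ : E n) :
    Integrable (fun w : E n => min 1 (2 * Real.pi * (‖ξ‖ * ‖w‖)) * ‖w‖ ^ (-((n : ℝ) + s))) := by
  have h := integrable_min_one_mul hn hs0 hs1 (A := 2 * Real.pi * ‖ξ‖) (by positivity)
  simpa only [mul_assoc] using h

theorem norm_sin_smul_truncKernel_le (w ξ : E n) :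
    ‖Real.sin (2 * Real.pi * inner ℝ w ξ) • truncKernel n s ε w‖
      ≤ min 1 (2 * Real.pi * (‖ξ‖ * ‖w‖)) * ‖w‖ ^ (-((n : ℝ) + s)) := by
  rw [norm_smul]
  exact mul_le_mul (abs_sin_two_pi_inner_le w ξ)
    ((norm_truncKernel_le_vecKernel w).trans (norm_vecKernel_le w)) (norm_nonneg _)
    (le_min zero_le_one (by positivity))

theorem measurable_sin_smul_truncKernel :
    Measurable fun z : E n × E n =>
      Real.sin (2 * Real.pi * inner ℝ z.2 z.1) • truncKernel n s ε z.2 :=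
  (by fun_prop : Measurable fun z : E n × E n => Real.sin (2 * Real.pi * inner ℝ z.2 z.1)).smul
    (measurable_truncKernel.comp measurable_snd)

theorem integrable_sin_smul_truncKernel (hn : 1 ≤ n) (hs0 : 0 < s) (hs1 : s < 1) (ξ : E n) :
    Integrable fun w : E n => Real.sin (2 * Real.pi * inner ℝ w ξ) • truncKernel n s ε w := by
  refine (integrable_min_one_inner_bound hn hs0 hs1 ξ).mono' ?_ (.of_forall fun w => ?_)
  · exact ((by fun_prop : Measurable fun w : E n => Real.sin (2 * Real.pi * inner ℝ w ξ)).smul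
      measurable_truncKernel).aestronglyMeasurable
  · exact norm_sin_smul_truncKernel_le w ξ

theorem measurable_sinSymbol : Measurable (sinSymbol n s ε) :=
  (StronglyMeasurable.integral_prod_right
    (measurable_sin_smul_truncKernel (n := n) (s := s) (ε := ε)).stronglyMeasurable).measurable

theorem integral_comp_pos_smul {F : Type*} [NormedAddCommGroup F] [NormedSpace ℝ F] (f : E n → F)
    {t : ℝ} (ht : 0 < t) : ∫ w, f (t • w) = t ^ (-(n : ℝ)) • ∫ w, f w := by
  rw [Measure.integral_comp_smul, finrank_euclideanSpace_fin, abs_of_pos (by positivity),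
    Real.rpow_neg ht.le, Real.rpow_natCast]

/-- The majorant min(1, 2π|ξ||w|) |w|^{-(n+s)} does not involve ε, and rescaling w by |ξ| extracts
|ξ|^s from its integral. This uniform bound makes all later limits dominated ones on H^s. -/
theorem norm_sinSymbol_le (hn : 1 ≤ n) (hs0 : 0 < s) (hs1 : s < 1) :
    ∃ M : ℝ, 0 ≤ M ∧ ∀ ε (ξ : E n), ‖sinSymbol n s ε ξ‖ ≤ M * ‖ξ‖ ^ s := by
  refine ⟨∫ w : E n, min 1 (2 * Real.pi * ‖w‖) * ‖w‖ ^ (-((n : ℝ) + s)),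
    integral_nonneg fun w => by positivity, fun ε ξ => ?_⟩
  by_cases hξ : ξ = 0
  · simp [hξ, sinSymbol, Real.zero_rpow hs0.ne']
  have ht : 0 < ‖ξ‖ := norm_pos_iff.2 hξ
  refine (norm_integral_le_integral_norm _).trans ?_
  refine (integral_mono (integrable_sin_smul_truncKernel hn hs0 hs1 ξ).norm
    (integrable_min_one_inner_bound hn hs0 hs1 ξ) fun w => norm_sin_smul_truncKernel_le w ξ).trans_eq ?_
  have h := integral_comp_pos_smul
    (fun w : E n => min 1 (2 * Real.pi * ‖w‖) * ‖w‖ ^ (-((n : ℝ) + s))) ht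
  simp only [norm_smul, norm_norm, smul_eq_mul] at h
  have h2 : ∀ w : E n, min 1 (2 * Real.pi * (‖ξ‖ * ‖w‖)) * (‖ξ‖ * ‖w‖) ^ (-((n : ℝ) + s))
      = ‖ξ‖ ^ (-((n : ℝ) + s)) * (min 1 (2 * Real.pi * (‖ξ‖ * ‖w‖)) * ‖w‖ ^ (-((n : ℝ) + s))) :=
    fun w => by rw [Real.mul_rpow ht.le (norm_nonneg _)]; ring
  simp_rw [h2] at h
  have hexp : ‖ξ‖ ^ (-((n : ℝ) + s)) = ‖ξ‖ ^ (-(n : ℝ)) * ‖ξ‖ ^ (-s) := by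
    rw [neg_add, Real.rpow_add ht]
  rw [integral_const_mul, hexp, mul_assoc] at h
  have h3 := mul_left_cancel₀ (by positivity) h
  rw [← h3, Real.rpow_neg ht.le, mul_right_comm, inv_mul_cancel₀ (by positivity), one_mul]

theorem tendsto_sinSymbol (hn : 1 ≤ n) (hs0 : 0 < s) (hs1 : s < 1) (ξ : E n) :
    Tendsto (fun ε => sinSymbol n s ε ξ) (𝓝[>] 0) (𝓝 (sinSymbol n s 0 ξ)) := by
  refine tendsto_integral_filter_of_dominated_convergence
    (fun w : E n => min 1 (2 * Real.pi * (‖ξ‖ * ‖w‖)) * ‖w‖ ^ (-((n : ℝ) + s)))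
    (.of_forall fun ε => (integrable_sin_smul_truncKernel hn hs0 hs1 ξ).aestronglyMeasurable)
    (.of_forall fun ε => .of_forall fun w => norm_sin_smul_truncKernel_le w ξ)
    (integrable_min_one_inner_bound hn hs0 hs1 ξ) (.of_forall fun w => ?_)
  refine Tendsto.congr' ?_ tendsto_const_nhds
  by_cases hw : w = 0
  · simp [hw]
  · have h : 0 < ‖w‖ := norm_pos_iff.2 hw
    filter_upwards [Ioo_mem_nhdsGT h] with ε hε
    rw [truncKernel_of_lt hε.2, truncKernel_of_lt h]

theorem sinSymbol_map (R : E n ≃ₗᵢ[ℝ] E n) (ξ : E n) :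
    sinSymbol n s ε (R ξ) = R (sinSymbol n s ε ξ) := by
  rw [sinSymbol, ← R.measurePreserving.integral_comp R.toHomeomorph.measurableEmbedding]
  simp_rw [R.inner_map_map, truncKernel_map, ← map_smul]
  exact R.toContinuousLinearEquiv.integral_comp_comm _

theorem sinSymbol_zero_smul {t : ℝ} (ht : 0 < t) (ξ : E n) :
    sinSymbol n s 0 (t • ξ) = t ^ s • sinSymbol n s 0 ξ := by
  have h := integral_comp_pos_smul
    (fun w : E n => Real.sin (2 * Real.pi * inner ℝ w ξ) • truncKernel n s 0 w) ht
  have h2 : ∀ w : E n, Real.sin (2 * Real.pi * inner ℝ (t • w) ξ) • truncKernel n s 0 (t • w)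
      = t ^ (-((n : ℝ) + s)) • (Real.sin (2 * Real.pi * inner ℝ w (t • ξ)) • truncKernel n s 0 w) :=
    fun w => by
      have := truncKernel_smul (n := n) (s := s) (ε := 0) ht w
      rw [mul_zero] at this
      rw [this, smul_comm, real_inner_smul_left, real_inner_smul_right]
  simp_rw [h2] at h
  rw [integral_smul, neg_add, Real.rpow_add ht, mul_smul] at h
  have h3 := smul_right_injective (E n) (by positivity : t ^ (-(n : ℝ)) ≠ 0) h
  rw [sinSymbol, sinSymbol, ← h3, smul_smul, ← Real.rpow_add ht]
  simp

/-- The reflection in the hyperplane orthogonal to v - w. Transitivity on spheres turns equivariance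
into dependence on the norm alone, in every dimension including n = 1. -/
theorem exists_linearIsometryEquiv_map_eq {v w : E n} (h : ‖v‖ = ‖w‖) :
    ∃ R : E n ≃ₗᵢ[ℝ] E n, R v = w :=
  ⟨Submodule.reflection _, Submodule.reflection_sub h⟩

/-- Homogeneity of degree s moves |ξ| to 1, and an isometry carries e to the resulting direction
without changing the norm of the symbol. -/
theorem norm_sinSymbol_zero (hs0 : 0 < s) {e : E n} (he : ‖e‖ = 1) (ξ : E n) :
    ‖sinSymbol n s 0 ξ‖ = ‖sinSymbol n s 0 e‖ * ‖ξ‖ ^ s := by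
  by_cases hξ : ξ = 0
  · simp [hξ, sinSymbol, Real.zero_rpow hs0.ne']
  have ht : 0 < ‖ξ‖ := norm_pos_iff.2 hξ
  obtain ⟨R, hR⟩ := exists_linearIsometryEquiv_map_eq (v := ‖ξ‖ • e) (w := ξ)
    (by simp [norm_smul, he])
  rw [← hR, sinSymbol_map, sinSymbol_zero_smul ht, R.norm_map, R.norm_map, norm_smul, norm_smul, he,
    norm_norm, mul_one, Real.norm_of_nonneg (by positivity), mul_comm]

/-! ### Polar coordinates and the sphere constant -/

section Sphere

variable {n : ℕ} {s ε : ℝ}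

/-- The surface measure of the unit sphere. -/
noncomputable abbrev sphereMeasure (n : ℕ) : Measure (Metric.sphere (0 : E n) 1) :=
  (volume : Measure (E n)).toSphere

theorem integral_eq_integral_sphere {F : Type*} [NormedAddCommGroup F] [NormedSpace ℝ F]
    (hn : 1 ≤ n) {f : E n → F} (hf : Integrable f) :
    ∫ x, f x = ∫ θ : Metric.sphere (0 : E n) 1,
      (∫ r in Set.Ioi (0 : ℝ), r ^ (n - 1) • f (r • (θ : E n))) ∂sphereMeasure n := by
  -- In an incomplete space the Bochner integral is 0 by definition, on both sides.
  by_cases hF : CompleteSpace F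
  swap
  · simp [integral, hF]
  have : Nontrivial (E n) := Module.finrank_pos_iff (R := ℝ).1 (by simp; omega)
  have hmp := (volume : Measure (E n)).measurePreserving_homeomorphUnitSphereProd
  have hemb := (homeomorphUnitSphereProd (E n)).measurableEmbedding
  let g : Metric.sphere (0 : E n) 1 × Set.Ioi (0 : ℝ) → F := fun p => f ((p.2 : ℝ) • (p.1 : E n))
  have hg : ∀ x : ({(0 : E n)}ᶜ : Set (E n)), g (homeomorphUnitSphereProd (E n) x) = f x := by
    intro x
    have hx : ‖(x : E n)‖ ≠ 0 := norm_ne_zero_iff.2 x.2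
    simp [g, smul_smul, hx]
  have hgint : Integrable g ((sphereMeasure n).prod (.volumeIoiPow (Module.finrank ℝ (E n) - 1))) := by
    rw [← hmp.integrable_comp_emb hemb]
    have : g ∘ homeomorphUnitSphereProd (E n) = f ∘ Subtype.val := funext hg
    rw [this, ← integrableOn_iff_comap_subtypeVal (measurableSet_singleton _).compl]
    exact hf.integrableOn
  calc ∫ x, f x = ∫ x : ({(0 : E n)}ᶜ : Set (E n)), f x ∂(Measure.comap Subtype.val volume) := by
        rw [integral_subtype_comap (measurableSet_singleton _).compl f, restrict_compl_singleton]
    _ = ∫ p, g p ∂((sphereMeasure n).prod (.volumeIoiPow (Module.finrank ℝ (E n) - 1))) := by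
        rw [← hmp.integral_comp hemb]
        exact integral_congr_ae (.of_forall fun x => (hg x).symm)
    _ = _ := by
        rw [integral_prod _ hgint]
        refine integral_congr_ae (.of_forall fun θ => ?_)
        simp only [Measure.volumeIoiPow, ENNReal.ofReal, g]
        rw [integral_withDensity_eq_integral_smul,
          integral_subtype_comap measurableSet_Ioi fun a =>
            Real.toNNReal (a ^ (Module.finrank ℝ (E n) - 1)) • f (a • (θ : E n)),
          setIntegral_congr_fun measurableSet_Ioi fun x hx => ?_]
        · simp only [finrank_euclideanSpace_fin]
          rw [NNReal.smul_def, Real.coe_toNNReal _ (pow_nonneg (le_of_lt hx) _)]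
        · exact (measurable_subtype_coe.pow_const _).real_toNNReal

/-- The odd part of the power of order `s`. -/
noncomputable def signPow (s t : ℝ) : ℝ := Real.sign t * |t| ^ s

theorem integral_rpow_mul_sin_mul (hs0 : 0 < s) (hs1 : s < 1) (a : ℝ) :
    ∫ r in Set.Ioi (0 : ℝ), r ^ (-1 - s) * Real.sin (a * r)
      = Real.Gamma (1 - s) / s * Real.sin (Real.pi * s / 2) * signPow s a := by
  have pos : ∀ a : ℝ, 0 < a → ∫ r in Set.Ioi (0 : ℝ), r ^ (-1 - s) * Real.sin (a * r)
      = Real.Gamma (1 - s) / s * Real.sin (Real.pi * s / 2) * a ^ s := by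
    intro a ha
    have h := integral_comp_mul_left_Ioi (fun t : ℝ => t ^ (-1 - s) * Real.sin t) 0 ha
    rw [mul_zero, integral_rpow_mul_sin hs0 hs1] at h
    have h2 : ∫ r in Set.Ioi (0 : ℝ), (a * r) ^ (-1 - s) * Real.sin (a * r)
        = a ^ (-1 - s) * ∫ r in Set.Ioi (0 : ℝ), r ^ (-1 - s) * Real.sin (a * r) := by
      rw [← integral_const_mul]
      refine setIntegral_congr_fun measurableSet_Ioi fun r hr => ?_
      rw [Real.mul_rpow ha.le (le_of_lt hr)]; ring
    rw [h2, smul_eq_mul, sub_eq_add_neg, Real.rpow_add ha, Real.rpow_neg_one, mul_assoc] at h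
    have h3 := mul_left_cancel₀ (inv_ne_zero ha.ne') h
    rw [← sub_eq_add_neg] at h3
    rw [← h3, Real.rpow_neg ha.le, mul_right_comm, inv_mul_cancel₀ (by positivity), one_mul]
  rcases lt_trichotomy a 0 with h | rfl | h
  · have := pos (-a) (by linarith)
    simp only [neg_mul, Real.sin_neg, mul_neg, integral_neg] at this
    rw [signPow, Real.sign_of_neg h, abs_of_neg h]
    linarith
  · simp [signPow]
  · rw [pos a h, signPow, Real.sign_of_pos h, abs_of_pos h, one_mul]

/-- The vector `∫ sign (θ · ξ) |θ · ξ|^s θ dθ` over the unit sphere. -/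
noncomputable def sphereVec (n : ℕ) (s : ℝ) (ξ : E n) : E n :=
  ∫ θ : Metric.sphere (0 : E n) 1, signPow s (inner ℝ (θ : E n) ξ) • (θ : E n) ∂sphereMeasure n

theorem abs_signPow_le (t : ℝ) : |signPow s t| ≤ |t| ^ s := by
  rw [signPow, abs_mul, abs_of_nonneg (Real.rpow_nonneg (abs_nonneg t) s)]
  refine mul_le_of_le_one_left (by positivity) ?_
  rcases Real.sign_apply_eq t with h | h | h <;> simp [h]

theorem signPow_mul {c : ℝ} (hc : 0 < c) (t : ℝ) : signPow s (c * t) = c ^ s * signPow s t := by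
  have h : |c * t| ^ s = c ^ s * |t| ^ s := by
    rw [abs_mul, abs_of_pos hc, Real.mul_rpow hc.le (abs_nonneg _)]
  rw [signPow, signPow, h]
  rcases lt_trichotomy t 0 with h | rfl | h
  · rw [Real.sign_of_neg h, Real.sign_of_neg (mul_neg_of_pos_of_neg hc h)]; ring
  · simp
  · rw [Real.sign_of_pos h, Real.sign_of_pos (mul_pos hc h)]; ring

theorem signPow_mul_self (hs0 : 0 < s) (t : ℝ) : signPow s t * t = |t| ^ (1 + s) := by
  rcases lt_trichotomy t 0 with h | rfl | h
  · rw [signPow, Real.sign_of_neg h, abs_of_neg h,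
      Real.rpow_one_add' (by linarith) (by linarith)]
    ring
  · rw [mul_zero, abs_zero, Real.zero_rpow (by linarith)]
  · rw [signPow, Real.sign_of_pos h, abs_of_pos h,
      Real.rpow_one_add' (by linarith) (by linarith)]
    ring

theorem measurable_signPow : Measurable (signPow s) := by
  have h : Measurable Real.sign := by
    unfold Real.sign
    exact Measurable.ite measurableSet_Iio measurable_const
      (Measurable.ite measurableSet_Ioi measurable_const measurable_const)
  exact h.mul (measurable_norm.pow_const s)

/-- The kernel separates in polar coordinates: r^{n-1} r^{-(n+s)} = r^{-1-s}, and the radial factor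
is the sine integral at frequency 2π θ·ξ. -/
theorem sinSymbol_zero_eq_sphereVec (hn : 1 ≤ n) (hs0 : 0 < s) (hs1 : s < 1) (ξ : E n) :
    sinSymbol n s 0 ξ = (Real.Gamma (1 - s) / s * Real.sin (Real.pi * s / 2)
      * (2 * Real.pi) ^ s) • sphereVec n s ξ := by
  rw [sinSymbol, integral_eq_integral_sphere hn (integrable_sin_smul_truncKernel hn hs0 hs1 ξ),
    sphereVec, ← integral_smul]
  refine integral_congr_ae (.of_forall fun θ => ?_)
  have hθ : ‖(θ : E n)‖ = 1 := norm_eq_of_mem_sphere θ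
  have hk : vecKernel n s (θ : E n) = θ := by simp [vecKernel, hθ]
  have h : ∀ r ∈ Set.Ioi (0 : ℝ), r ^ (n - 1) • (Real.sin (2 * Real.pi * inner ℝ (r • (θ : E n)) ξ)
      • truncKernel n s 0 (r • (θ : E n)))
      = (r ^ (-1 - s) * Real.sin (2 * Real.pi * inner ℝ (θ : E n) ξ * r)) • (θ : E n) := by
    intro r hr
    have hr : 0 < r := hr
    rw [truncKernel_zero, vecKernel_smul hr, hk, smul_smul, smul_smul, real_inner_smul_left,
      ← Real.rpow_natCast, mul_right_comm, ← Real.rpow_add hr]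
    congr 3
    · rw [Nat.cast_sub hn]; push_cast; ring
    · ring
  simp only
  rw [setIntegral_congr_fun measurableSet_Ioi h, integral_smul_const,
    integral_rpow_mul_sin_mul hs0 hs1, smul_smul, signPow_mul Real.two_pi_pos, mul_assoc _ (_ ^ s)]

/-- The surface measure of a set is a multiple of the volume of the cone over it, and the cone over
the antipodal set is the reflected cone. -/
theorem measurePreserving_neg_sphere :
    MeasurePreserving (fun θ : Metric.sphere (0 : E n) 1 => -θ) (sphereMeasure n)
      (sphereMeasure n) := by
  have hm : Measurable (fun θ : Metric.sphere (0 : E n) 1 => -θ) := continuous_neg.measurable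
  refine ⟨hm, ?_⟩
  ext t ht
  rw [Measure.map_apply hm ht, Measure.toSphere_apply' _ ht, Measure.toSphere_apply' _ (hm ht)]
  congr 1
  rw [← Measure.measure_neg]
  congr 1
  ext x
  simp only [Set.mem_neg, Set.mem_smul, Set.mem_image, Set.mem_preimage]
  constructor
  · rintro ⟨r, hr, _, ⟨θ, hθ, rfl⟩, h⟩
    exact ⟨r, hr, _, ⟨-θ, hθ, rfl⟩, by simp [h]⟩
  · rintro ⟨r, hr, _, ⟨θ, hθ, rfl⟩, h⟩
    exact ⟨r, hr, _, ⟨-θ, by simpa using hθ, rfl⟩, by simp [h]⟩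

theorem integral_sphere_eq_zero_of_odd {f : Metric.sphere (0 : E n) 1 → ℝ}
    (hf : ∀ θ, f (-θ) = -f θ) : ∫ θ, f θ ∂sphereMeasure n = 0 := by
  have h := measurePreserving_neg_sphere.integral_comp
    (Homeomorph.neg (Metric.sphere (0 : E n) 1)).measurableEmbedding f
  simp_rw [hf, integral_neg] at h
  linarith

/-- On the principal branch (it)^s = |t|^s e^{± iπs/2}, the sign being that of t. This separates the
power into an even cosine part and an odd sine part. -/
theorem I_mul_ofReal_cpow (hs0 : 0 < s) (t : ℝ) :
    (Complex.I * (t : ℂ)) ^ (s : ℂ) = ((Real.cos (Real.pi * s / 2) * |t| ^ s : ℝ) : ℂ)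
      + Complex.I * ((Real.sin (Real.pi * s / 2) * signPow s t : ℝ) : ℂ) := by
  -- Both signs of t at once: a = |t|, and z = ± i has argument c = ± π/2.
  have key : ∀ (c a : ℝ) (z : ℂ), 0 < a → z ≠ 0 → Complex.log z = (c : ℂ) * Complex.I →
      ((a : ℂ) * z) ^ (s : ℂ) = (((a ^ s : ℝ)) : ℂ) *
        (((Real.cos (s * c) : ℝ) : ℂ) + ((Real.sin (s * c) : ℝ) : ℂ) * Complex.I) := by
    intro c a z ha hz hlog
    have ha' : (a : ℂ) ≠ 0 := by exact_mod_cast ha.ne'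
    rw [Complex.cpow_def_of_ne_zero (mul_ne_zero ha' hz), Complex.log_ofReal_mul ha hz, hlog,
      add_mul, Complex.exp_add, Real.rpow_def_of_pos ha, Complex.ofReal_exp,
      show (c : ℂ) * Complex.I * (s : ℂ) = ((s * c : ℝ) : ℂ) * Complex.I by push_cast; ring,
      Complex.exp_mul_I, ← Complex.ofReal_cos, ← Complex.ofReal_sin]
    push_cast; ring
  rcases lt_trichotomy t 0 with h | rfl | h
  · have := key (-(Real.pi / 2)) (-t) (-Complex.I) (by linarith) (by simp)
      (by rw [Complex.log_neg_I]; push_cast; ring)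
    rw [show ((-t : ℝ) : ℂ) * -Complex.I = Complex.I * t by push_cast; ring] at this
    rw [this, signPow, Real.sign_of_neg h, abs_of_neg h, show s * -(Real.pi / 2) = -(Real.pi * s / 2) by ring,
      Real.cos_neg, Real.sin_neg]
    push_cast; ring
  · simp [signPow, Real.zero_rpow hs0.ne', Complex.zero_cpow, hs0.ne']
  · have := key (Real.pi / 2) t Complex.I h Complex.I_ne_zero
      (by rw [Complex.log_I]; push_cast; ring)
    rw [mul_comm (t : ℂ)] at this
    rw [this, signPow, Real.sign_of_pos h, abs_of_pos h, show s * (Real.pi / 2) = Real.pi * s / 2 by ring]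
    push_cast; ring

theorem abs_inner_sphere_le (θ : Metric.sphere (0 : E n) 1) (ξ : E n) :
    |inner ℝ (θ : E n) ξ| ≤ ‖ξ‖ := by
  simpa [norm_eq_of_mem_sphere θ] using abs_real_inner_le_norm (θ : E n) ξ

theorem integrable_signPow_smul (hs0 : 0 < s) (ξ : E n) :
    Integrable (fun θ : Metric.sphere (0 : E n) 1 =>
      signPow s (inner ℝ (θ : E n) ξ) • (θ : E n)) (sphereMeasure n) := by
  refine Integrable.of_bound (C := ‖ξ‖ ^ s) ?_ (.of_forall fun θ => ?_)
  · have h : Measurable fun θ : Metric.sphere (0 : E n) 1 => inner ℝ (θ : E n) ξ := by fun_prop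
    exact ((measurable_signPow.comp h).smul measurable_subtype_coe).aestronglyMeasurable
  · rw [norm_smul, norm_eq_of_mem_sphere, mul_one]
    exact (abs_signPow_le _).trans
      (Real.rpow_le_rpow (abs_nonneg _) (abs_inner_sphere_le θ ξ) hs0.le)

/-- Against the odd factor v·θ the even part of the power integrates to zero, and only the imaginary
sine part is left. -/
theorem integral_sphere_inner_mul_cpow (hs0 : 0 < s) (ξ v : E n) :
    ∫ θ : Metric.sphere (0 : E n) 1, ((inner ℝ v (θ : E n) : ℝ) : ℂ)
        * (Complex.I * ((inner ℝ (θ : E n) ξ : ℝ) : ℂ)) ^ (s : ℂ) ∂sphereMeasure n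
      = Complex.I * ((Real.sin (Real.pi * s / 2) * inner ℝ v (sphereVec n s ξ) : ℝ) : ℂ) := by
  have h1 : ∀ θ : Metric.sphere (0 : E n) 1, ((inner ℝ v (θ : E n) : ℝ) : ℂ)
        * (Complex.I * ((inner ℝ (θ : E n) ξ : ℝ) : ℂ)) ^ (s : ℂ)
      = ((Real.cos (Real.pi * s / 2) *
          (inner ℝ v (θ : E n) * |inner ℝ (θ : E n) ξ| ^ s) : ℝ) : ℂ)
        + Complex.I * ((Real.sin (Real.pi * s / 2) *
          inner ℝ v (signPow s (inner ℝ (θ : E n) ξ) • (θ : E n)) : ℝ) : ℂ) := by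
    intro θ
    rw [I_mul_ofReal_cpow hs0, real_inner_smul_right]; push_cast; ring
  simp_rw [h1]
  have i1 : Integrable (fun θ : Metric.sphere (0 : E n) 1 => (inner ℝ v (θ : E n)
      * |inner ℝ (θ : E n) ξ| ^ s)) (sphereMeasure n) := by
    refine Integrable.of_bound (C := ‖v‖ * ‖ξ‖ ^ s) ?_ (.of_forall fun θ => ?_)
    · have h : Measurable fun θ : Metric.sphere (0 : E n) 1 => |inner ℝ (θ : E n) ξ| := by fun_prop
      exact ((by fun_prop : Measurable fun θ : Metric.sphere (0 : E n) 1 =>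
        inner ℝ v (θ : E n)).mul (h.pow_const s)).aestronglyMeasurable
    · rw [norm_mul, Real.norm_of_nonneg (by positivity : (0 : ℝ) ≤ |inner ℝ (θ : E n) ξ| ^ s)]
      refine mul_le_mul ?_ (Real.rpow_le_rpow (abs_nonneg _) (abs_inner_sphere_le θ ξ) hs0.le)
        (by positivity) (by positivity)
      rw [real_inner_comm]; exact abs_inner_sphere_le θ v
  have i2 := (integrable_signPow_smul hs0 ξ).const_inner (𝕜 := ℝ) v
  rw [integral_add (i1.const_mul _).ofReal ((i2.const_mul _).ofReal.const_mul _),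
    integral_const_mul, integral_complex_ofReal, integral_complex_ofReal, integral_const_mul, integral_const_mul,
    integral_inner (𝕜 := ℝ) (integrable_signPow_smul hs0 ξ), integral_sphere_eq_zero_of_odd, sphereVec]
  · simp
  · intro θ; simp

/-- The inner and the outer integral each yield a factor i sin(πs/2); the product i² = -1 is the
reason why D is negative. -/
theorem integral_sphere_sphere (hs0 : 0 < s) (ξ : E n) :
    ∫ θ : Metric.sphere (0 : E n) 1, ∫ θ' : Metric.sphere (0 : E n) 1,
        ((inner ℝ (θ : E n) (θ' : E n) : ℝ) : ℂ)
          * (Complex.I * ((inner ℝ (θ : E n) ξ : ℝ) : ℂ)) ^ (s : ℂ)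
          * (Complex.I * ((inner ℝ (θ' : E n) ξ : ℝ) : ℂ)) ^ (s : ℂ)
        ∂(volume : Measure (E n)).toSphere ∂(volume : Measure (E n)).toSphere
      = ((-(Real.sin (Real.pi * s / 2) * ‖sphereVec n s ξ‖) ^ 2 : ℝ) : ℂ) := by
  have h0 : ∀ θ : Metric.sphere (0 : E n) 1, ∫ θ' : Metric.sphere (0 : E n) 1,
        ((inner ℝ (θ : E n) (θ' : E n) : ℝ) : ℂ)
          * (Complex.I * ((inner ℝ (θ : E n) ξ : ℝ) : ℂ)) ^ (s : ℂ)
          * (Complex.I * ((inner ℝ (θ' : E n) ξ : ℝ) : ℂ)) ^ (s : ℂ) ∂sphereMeasure n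
      = Complex.I * ((Real.sin (Real.pi * s / 2) * inner ℝ (θ : E n) (sphereVec n s ξ) : ℝ) : ℂ)
        * (Complex.I * ((inner ℝ (θ : E n) ξ : ℝ) : ℂ)) ^ (s : ℂ) := by
    intro θ
    rw [← integral_sphere_inner_mul_cpow hs0, ← integral_mul_const]
    exact integral_congr_ae (.of_forall fun θ' => mul_right_comm _ _ _)
  simp_rw [h0]
  have : ∀ θ : Metric.sphere (0 : E n) 1,
      Complex.I * ((Real.sin (Real.pi * s / 2) * inner ℝ (θ : E n) (sphereVec n s ξ) : ℝ) : ℂ)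
        * (Complex.I * ((inner ℝ (θ : E n) ξ : ℝ) : ℂ)) ^ (s : ℂ)
      = (Complex.I * ((Real.sin (Real.pi * s / 2) : ℝ) : ℂ)) *
        (((inner ℝ (sphereVec n s ξ) (θ : E n) : ℝ) : ℂ)
        * (Complex.I * ((inner ℝ (θ : E n) ξ : ℝ) : ℂ)) ^ (s : ℂ)) := by
    intro θ
    rw [real_inner_comm]; push_cast; ring
  simp_rw [this]
  rw [integral_const_mul, integral_sphere_inner_mul_cpow hs0, real_inner_self_eq_norm_sq]
  push_cast
  linear_combination (Complex.sin (Real.pi * s / 2) ^ 2 * ‖sphereVec n s ξ‖ ^ 2) * Complex.I_sq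

/-- The scalar product with e is the integral of |θ·e|^{1+s}. If it vanished, this continuous
nonnegative function would vanish identically, yet it equals 1 at θ = e. -/
theorem sphereVec_ne_zero (hs0 : 0 < s) {e : E n} (he : ‖e‖ = 1) : sphereVec n s e ≠ 0 := by
  intro h
  have h1 : ∫ θ : Metric.sphere (0 : E n) 1, |inner ℝ (θ : E n) e| ^ (1 + s) ∂sphereMeasure n = 0 := by
    have h2 := integral_inner (𝕜 := ℝ) (integrable_signPow_smul hs0 e) e
    rw [← sphereVec, h, inner_zero_right] at h2
    rw [← h2]
    refine integral_congr_ae (.of_forall fun θ => ?_)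
    simp only [real_inner_smul_right]
    rw [real_inner_comm, signPow_mul_self hs0]
  have hc : Continuous fun θ : Metric.sphere (0 : E n) 1 => |inner ℝ (θ : E n) e| ^ (1 + s) :=
    Continuous.rpow_const (by fun_prop) fun _ => Or.inr (by linarith)
  have hi : Integrable (fun θ : Metric.sphere (0 : E n) 1 => |inner ℝ (θ : E n) e| ^ (1 + s))
      (sphereMeasure n) := by
    refine Integrable.of_bound (C := ‖e‖ ^ (1 + s)) hc.aestronglyMeasurable (.of_forall fun θ => ?_)
    rw [Real.norm_of_nonneg (by positivity)]
    exact Real.rpow_le_rpow (abs_nonneg _) (abs_inner_sphere_le θ e) (by linarith)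
  have h3 : _ =ᵐ[sphereMeasure n] fun _ => (0 : ℝ) := (integral_eq_zero_iff_of_nonneg (fun θ => by positivity) hi).1 h1
  have h4 := congrFun ((hc.ae_eq_iff_eq (sphereMeasure n) continuous_const).1 h3)
    ⟨e, by simp [he]⟩
  simp [he] at h4

theorem dirConst_pos (hs0 : 0 < s) (hs1 : s < 1) : 0 < dirConst s :=
  div_pos hs0 (Real.Gamma_pos_of_pos (by linarith))

/-- The sphere constant, in terms of the Fourier symbol of the weighted gradient. -/
theorem isSphereConst_neg_sq (hn : 1 ≤ n) (hs0 : 0 < s) (hs1 : s < 1) {e : E n} (he : ‖e‖ = 1) :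
    IsSphereConst n s (-(‖sinSymbol n s 0 e‖ * dirConst s / (2 * Real.pi) ^ s) ^ 2) := by
  have hG := dirConst_pos hs0 hs1
  have hsin : 0 < Real.sin (Real.pi * s / 2) :=
    Real.sin_pos_of_pos_of_lt_pi (by positivity) (by nlinarith [Real.pi_pos])
  have hπ : 0 < (2 * Real.pi) ^ s := by positivity
  have hV : ∀ ξ : E n, ‖sinSymbol n s 0 ξ‖
      = Real.sin (Real.pi * s / 2) / dirConst s * (2 * Real.pi) ^ s * ‖sphereVec n s ξ‖ := by
    intro ξ
    rw [sinSymbol_zero_eq_sphereVec hn hs0 hs1, norm_smul, Real.norm_of_nonneg, dirConst]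
    · field_simp
    · have := Real.Gamma_pos_of_pos (by linarith : 0 < 1 - s)
      positivity
  refine ⟨?_, fun ξ => ?_⟩
  · rw [hV]
    have := norm_pos_iff.2 (sphereVec_ne_zero hs0 he)
    have : 0 < Real.sin (Real.pi * s / 2) / dirConst s * (2 * Real.pi) ^ s * ‖sphereVec n s e‖
      * dirConst s / (2 * Real.pi) ^ s := by positivity
    nlinarith
  · rw [integral_sphere_sphere hs0]
    congr 1
    have h1 : Real.sin (Real.pi * s / 2) * ‖sphereVec n s ξ‖
        = ‖sinSymbol n s 0 ξ‖ * dirConst s / (2 * Real.pi) ^ s := by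
      rw [hV]; field_simp
    rw [h1, norm_sinSymbol_zero hs0 he, mul_comm 2 s, Real.rpow_mul (norm_nonneg _), Real.rpow_two]
    ring

end Sphere

/-! ### The self-convolution of the truncated kernel -/

section AutoConv

variable {n : ℕ} {s ε : ℝ}

/-- The self-convolution of the truncated vector kernel. -/
noncomputable def autoConv (n : ℕ) (s ε : ℝ) (p : E n) : ℝ :=
  ∫ z, inner ℝ (truncKernel n s ε z) (truncKernel n s ε (p - z))

theorem autoConv_map (R : E n ≃ₗᵢ[ℝ] E n) (p : E n) : autoConv n s ε (R p) = autoConv n s ε p := by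
  rw [autoConv, ← R.measurePreserving.integral_comp R.toHomeomorph.measurableEmbedding, autoConv]
  simp_rw [← map_sub, truncKernel_map, R.inner_map_map]

/-- The truncation radius scales along with p, so exact homogeneity appears only in the limit ε → 0.
The rule also trades a large ε for radius 1 at another point. -/
theorem autoConv_smul {t : ℝ} (ht : 0 < t) (p : E n) :
    autoConv n s (t * ε) (t • p) = t ^ (-((n : ℝ) + 2 * s)) * autoConv n s ε p := by
  have h := integral_comp_pos_smul (fun z : E n =>
    inner ℝ (truncKernel n s (t * ε) z) (truncKernel n s (t * ε) (t • p - z))) ht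
  simp_rw [← smul_sub, truncKernel_smul ht, real_inner_smul_left, real_inner_smul_right,
    integral_const_mul, smul_eq_mul] at h
  rw [← mul_assoc, ← Real.rpow_add ht] at h
  have h2 : t ^ (-((n : ℝ) + s) + -((n : ℝ) + s)) = t ^ (-(n : ℝ)) * t ^ (-((n : ℝ) + 2 * s)) := by
    rw [← Real.rpow_add ht]; ring_nf
  rw [h2, mul_assoc] at h
  exact (mul_left_cancel₀ (by positivity) h).symm

theorem measurable_inner_truncKernel_sub (p : E n) :
    Measurable fun z : E n => inner ℝ (truncKernel n s ε z) (truncKernel n s ε (p - z)) :=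
  measurable_truncKernel.inner (measurable_truncKernel.comp (measurable_const.sub measurable_id))

theorem integrable_inner_truncKernel_sub (hn : 1 ≤ n) (hs0 : 0 < s) (hε : 0 < ε) (p : E n) :
    Integrable fun z : E n => inner ℝ (truncKernel n s ε z) (truncKernel n s ε (p - z)) := by
  refine ((integrable_truncKernel hn hs0 hε).norm.mul_const (ε ^ (-((n : ℝ) + s)))).mono'
    (measurable_inner_truncKernel_sub p).aestronglyMeasurable (.of_forall fun z => ?_)
  exact (abs_real_inner_le_norm _ _).trans
    (mul_le_mul_of_nonneg_left (norm_truncKernel_le hs0 hε _) (norm_nonneg _))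

theorem abs_autoConv_le (hn : 1 ≤ n) (hs0 : 0 < s) (hε : 0 < ε) (p : E n) :
    |autoConv n s ε p| ≤ (∫ z, ‖truncKernel n s ε z‖) * ε ^ (-((n : ℝ) + s)) := by
  rw [← Real.norm_eq_abs, autoConv]
  refine (norm_integral_le_integral_norm _).trans ?_
  rw [← integral_mul_const]
  refine integral_mono (integrable_inner_truncKernel_sub hn hs0 hε p).norm
    ((integrable_truncKernel hn hs0 hε).norm.mul_const _) fun z => ?_
  exact (abs_real_inner_le_norm _ _).trans
    (mul_le_mul_of_nonneg_left (norm_truncKernel_le hs0 hε _) (norm_nonneg _))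

/-- The kernel is C¹ away from the origin. The condition 2r ≤ |p| separates the balls of radius r
about the two singularities 0 and p. -/
theorem exists_lipschitz_vecKernel {p : E n} (hp : p ≠ 0) :
    ∃ r K : ℝ, 0 < r ∧ 2 * r ≤ ‖p‖ ∧ 0 ≤ K ∧
      ∀ z : E n, ‖z‖ < r → ‖vecKernel n s (p - z) - vecKernel n s p‖ ≤ K * ‖z‖ := by
  have hc1 : ContDiffAt ℝ 1 (fun w : E n => ‖w‖ ^ (-((n : ℝ) + s + 1))) p :=
    (contDiffAt_norm ℝ hp).rpow_const_of_ne (norm_ne_zero_iff.2 hp)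
  have hc : ContDiffAt ℝ 1 (vecKernel n s) p := hc1.smul contDiffAt_id
  obtain ⟨K, t, ht, hK⟩ := hc.exists_lipschitzOnWith
  obtain ⟨r, hr, hrt⟩ := Metric.mem_nhds_iff.1 ht
  have hp0 : 0 < ‖p‖ := norm_pos_iff.2 hp
  refine ⟨min r (‖p‖ / 2), K, lt_min hr (by positivity), ?_, K.2, fun z hz => ?_⟩
  · linarith [min_le_right r (‖p‖ / 2)]
  · have h1 : p - z ∈ t := hrt (by
      rw [mem_ball_iff_norm, sub_sub_cancel_left, norm_neg]
      exact hz.trans_le (min_le_left _ _))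
    have h2 := hK.norm_sub_le h1 (hrt (Metric.mem_ball_self hr))
    rwa [sub_sub_cancel_left, norm_neg] at h2

/-- The kernel, restricted to `ε < |w| < r`. -/
noncomputable def annulusKernel (n : ℕ) (s r ε : ℝ) : E n → E n :=
  {w | ‖w‖ < r}.indicator (truncKernel n s ε)

theorem annulusKernel_neg {r : ℝ} (w : E n) :
    annulusKernel n s r ε (-w) = -annulusKernel n s r ε w := by
  by_cases h : ‖w‖ < r <;> simp [annulusKernel, h, truncKernel_neg]

theorem measurable_annulusKernel {r : ℝ} : Measurable (annulusKernel n s r ε) :=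
  measurable_truncKernel.indicator (measurableSet_lt measurable_norm measurable_const)

theorem integrable_annulusKernel {r : ℝ} (hn : 1 ≤ n) (hs0 : 0 < s) (hε : 0 < ε) :
    Integrable (annulusKernel n s r ε) :=
  (integrable_truncKernel hn hs0 hε).indicator (measurableSet_lt measurable_norm measurable_const)

/-- The regularized integrand of the self-convolution. -/
noncomputable def autoConvReg (n : ℕ) (s r ε : ℝ) (p z : E n) : ℝ :=
  inner ℝ (truncKernel n s ε z) (truncKernel n s ε (p - z))
    - inner ℝ (vecKernel n s p) (annulusKernel n s r ε z)
    - inner ℝ (vecKernel n s p) (annulusKernel n s r ε (p - z))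

theorem measurable_autoConvReg {r : ℝ} (p : E n) : Measurable (autoConvReg n s r ε p) :=
  ((measurable_inner_truncKernel_sub p).sub (measurable_const.inner measurable_annulusKernel)).sub
    (measurable_const.inner (measurable_annulusKernel.comp (measurable_const.sub measurable_id)))

theorem autoConvReg_sub {r : ℝ} (p z : E n) :
    autoConvReg n s r ε p (p - z) = autoConvReg n s r ε p z := by
  rw [autoConvReg, autoConvReg, sub_sub_cancel, real_inner_comm]; ring

/-- The subtracted terms pair a constant vector with an odd kernel, up to the change z ↦ p - z, and
so have integral zero. They replace the regular factor near each singularity by its increment, which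
gains a power of the distance; since s < 1 this is enough for a majorant independent of ε. -/
theorem autoConv_eq_integral_reg {r : ℝ} (hn : 1 ≤ n) (hs0 : 0 < s) (hε : 0 < ε) (p : E n) :
    autoConv n s ε p = ∫ z, autoConvReg n s r ε p z := by
  have i1 := integrable_inner_truncKernel_sub hn hs0 hε p
  have ia := integrable_annulusKernel (r := r) hn hs0 hε
  have i2 := ia.const_inner (𝕜 := ℝ) (vecKernel n s p)
  have h0 : ∫ z, inner ℝ (vecKernel n s p) (annulusKernel n s r ε z) = 0 := by
    rw [integral_inner (𝕜 := ℝ) ia, integral_eq_zero_of_odd annulusKernel_neg, inner_zero_right]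
  have h1 := integral_sub_left_eq_self
    (fun z => inner ℝ (vecKernel n s p) (annulusKernel n s r ε z)) volume p
  have i12 : Integrable fun z => inner ℝ (truncKernel n s ε z) (truncKernel n s ε (p - z))
    - inner ℝ (vecKernel n s p) (annulusKernel n s r ε z) := i1.sub i2
  simp only [autoConvReg]
  rw [integral_sub i12 (i2.comp_sub_left p), integral_sub i1 i2, h1, h0, autoConv]
  ring

theorem autoConvReg_eq_of_norm_lt {r : ℝ} {p z : E n} (hr : 2 * r ≤ ‖p‖) (hεr : ε < r)
    (hz : ‖z‖ < r) : autoConvReg n s r ε p z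
      = inner ℝ (truncKernel n s ε z) (vecKernel n s (p - z) - vecKernel n s p) := by
  have h1 : r < ‖p - z‖ := by linarith [norm_sub_norm_le p z]
  rw [autoConvReg, annulusKernel, Set.indicator_of_mem (by exact hz),
    Set.indicator_of_notMem (by simpa using h1.le), truncKernel_of_lt (hεr.trans h1),
    inner_zero_right, sub_zero, inner_sub_right, real_inner_comm (vecKernel n s p)]

theorem autoConvReg_eq_of_le {r : ℝ} {p z : E n} (hz : r ≤ ‖z‖) (hz' : r ≤ ‖p - z‖) :
    autoConvReg n s r ε p z = inner ℝ (truncKernel n s ε z) (truncKernel n s ε (p - z)) := by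
  rw [autoConvReg, annulusKernel, Set.indicator_of_notMem (by simpa using hz),
    Set.indicator_of_notMem (by simpa using hz')]
  simp

theorem abs_autoConvReg_le {r K : ℝ} {p : E n} (hs0 : 0 < s) (hr0 : 0 < r) (hr : 2 * r ≤ ‖p‖)
    (hK0 : 0 ≤ K) (hεr : ε < r)
    (hK : ∀ z : E n, ‖z‖ < r → ‖vecKernel n s (p - z) - vecKernel n s p‖ ≤ K * ‖z‖) (z : E n) :
    |autoConvReg n s r ε p z| ≤
      K * r * (min 1 (r⁻¹ * ‖z‖) * ‖z‖ ^ (-((n : ℝ) + s)))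
      + K * r * (min 1 (r⁻¹ * ‖p - z‖) * ‖p - z‖ ^ (-((n : ℝ) + s)))
      + ‖truncKernel n s (r / 2) z‖ * (r / 2) ^ (-((n : ℝ) + s)) := by
  have key : ∀ z : E n, ‖z‖ < r → |autoConvReg n s r ε p z| ≤
      K * r * (min 1 (r⁻¹ * ‖z‖) * ‖z‖ ^ (-((n : ℝ) + s))) := by
    intro z hz
    rw [autoConvReg_eq_of_norm_lt hr hεr hz]
    -- The minimum keeps the majorant integrable at infinity; inside the ball it is |z|/r, and the
    -- prefactor K r restores the Lipschitz bound K |z|.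
    have h1 : min 1 (r⁻¹ * ‖z‖) = r⁻¹ * ‖z‖ := min_eq_right (by
      rw [← div_eq_inv_mul]; exact (div_le_one hr0).2 hz.le)
    rw [h1]
    calc _ ≤ ‖truncKernel n s ε z‖ * ‖vecKernel n s (p - z) - vecKernel n s p‖ :=
          abs_real_inner_le_norm _ _
      _ ≤ ‖z‖ ^ (-((n : ℝ) + s)) * (K * ‖z‖) :=
          mul_le_mul ((norm_truncKernel_le_vecKernel z).trans (norm_vecKernel_le z)) (hK z hz)
            (norm_nonneg _) (by positivity)
      _ = _ := by field_simp
  have n1 : ∀ z : E n, 0 ≤ K * r * (min 1 (r⁻¹ * ‖z‖) * ‖z‖ ^ (-((n : ℝ) + s))) := fun z =>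
    mul_nonneg (by positivity) (mul_nonneg (le_min zero_le_one (by positivity)) (by positivity))
  have n2 : 0 ≤ ‖truncKernel n s (r / 2) z‖ * (r / 2) ^ (-((n : ℝ) + s)) := by positivity
  by_cases hz : ‖z‖ < r
  · linarith [key z hz, n1 (p - z)]
  by_cases hz' : ‖p - z‖ < r
  · have := key (p - z) hz'
    rw [autoConvReg_sub] at this
    linarith [n1 z]
  · push Not at hz hz'
    rw [autoConvReg_eq_of_le hz hz']
    -- The radius r/2 instead of r, because truncation asks for a strict inequality and only r ≤ |z|
    -- is known.
    have h1 : ‖truncKernel n s ε z‖ ≤ ‖truncKernel n s (r / 2) z‖ := by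
      rw [truncKernel_of_lt (ε := r / 2) (by linarith)]; exact norm_truncKernel_le_vecKernel z
    have h2 : ‖truncKernel n s ε (p - z)‖ ≤ (r / 2) ^ (-((n : ℝ) + s)) := by
      refine le_trans ?_ (norm_truncKernel_le hs0 (half_pos hr0) (p - z))
      rw [truncKernel_of_lt (ε := r / 2) (by linarith)]; exact norm_truncKernel_le_vecKernel _
    have := (abs_real_inner_le_norm (truncKernel n s ε z) (truncKernel n s ε (p - z))).trans
      (mul_le_mul h1 h2 (norm_nonneg _) (norm_nonneg _))
    linarith [n1 z, n1 (p - z)]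

/-- Dominated convergence for the regularized integrand gives existence of the limit; its value is
identified later by Fourier analysis. -/
theorem exists_tendsto_autoConv (hn : 1 ≤ n) (hs0 : 0 < s) (hs1 : s < 1) {p : E n} (hp : p ≠ 0) :
    ∃ J : ℝ, Tendsto (fun ε => autoConv n s ε p) (𝓝[>] 0) (𝓝 J) := by
  obtain ⟨r, K, hr0, hr, hK0, hK⟩ := exists_lipschitz_vecKernel (s := s) hp
  refine ⟨∫ z, autoConvReg n s r 0 p z, ?_⟩
  have hmem : ∀ᶠ ε in 𝓝[>] (0 : ℝ), ε ∈ Set.Ioo 0 r := Ioo_mem_nhdsGT hr0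
  refine Tendsto.congr' (hmem.mono fun ε hε => (autoConv_eq_integral_reg (r := r) hn hs0 hε.1 p).symm) ?_
  have hQ := (integrable_min_one_mul (n := n) hn hs0 hs1 (A := r⁻¹) (by positivity)).const_mul (K * r)
  refine tendsto_integral_filter_of_dominated_convergence _
    (.of_forall fun ε => (measurable_autoConvReg p).aestronglyMeasurable)
    (hmem.mono fun ε hε => .of_forall fun z => abs_autoConvReg_le hs0 hr0 hr hK0 hε.2 hK z)
    ((hQ.add (hQ.comp_sub_left p)).add
      ((integrable_truncKernel hn hs0 (half_pos hr0)).norm.mul_const _)) ?_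
  have h0 : ∀ᵐ z : E n, z ≠ 0 ∧ z ≠ p := by
    have : Nontrivial (E n) := ⟨p, 0, hp⟩
    have h1 : ∀ a : E n, ∀ᵐ z : E n, z ≠ a := fun a => by simp [ae_iff]
    filter_upwards [h1 0, h1 p] with z h1 h2 using ⟨h1, h2⟩
  filter_upwards [h0] with z hz
  have hk : ∀ w : E n, w ≠ 0 → ∀ᶠ ε in 𝓝[>] (0 : ℝ),
      truncKernel n s ε w = truncKernel n s 0 w ∧
      annulusKernel n s r ε w = annulusKernel n s r 0 w := fun w hw => by
    have h : 0 < ‖w‖ := norm_pos_iff.2 hw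
    filter_upwards [Ioo_mem_nhdsGT h] with ε hε
    have := (truncKernel_of_lt (n := n) (s := s) hε.2).trans (truncKernel_of_lt h).symm
    refine ⟨this, ?_⟩
    simp only [annulusKernel, Set.indicator, this]
  refine Tendsto.congr' ?_ tendsto_const_nhds
  filter_upwards [hk z hz.1, hk (p - z) (sub_ne_zero.2 hz.2.symm)] with ε h1 h2
  simp only [autoConvReg, h1.1, h1.2, h2.1, h2.2]

theorem integrable_truncKernel_prod (hn : 1 ≤ n) (hs0 : 0 < s) (hε : 0 < ε) :
    Integrable (fun z : E n × E n =>
      inner ℝ (truncKernel n s ε z.2) (truncKernel n s ε (z.1 - z.2))) (volume.prod volume) :=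
  (integrable_truncKernel hn hs0 hε).convolution_integrand (innerSL ℝ)
    (integrable_truncKernel hn hs0 hε)

theorem measurable_autoConv : Measurable (autoConv n s ε) := by
  refine (StronglyMeasurable.integral_prod_right (f := fun p z : E n =>
    inner ℝ (truncKernel n s ε z) (truncKernel n s ε (p - z))) ?_).measurable
  exact ((measurable_truncKernel.comp measurable_snd).inner
    (measurable_truncKernel.comp (measurable_fst.sub measurable_snd))).stronglyMeasurable

/-- The convolution theorem: the Fourier transform of an odd kernel is purely imaginary and vanishes
at frequency 0, so the term with 1 is zero and the cosine term is -(iV_ε)² = |V_ε|². -/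
theorem integral_autoConv_mul (hn : 1 ≤ n) (hs0 : 0 < s) (hs1 : s < 1) (hε : 0 < ε) (ξ : E n) :
    ∫ p, (1 - Real.cos (2 * Real.pi * inner ℝ p ξ)) * autoConv n s ε p
      = ‖sinSymbol n s ε ξ‖ ^ 2 := by
  have hk := integrable_truncKernel hn hs0 hε
  have hprod : Integrable (Function.uncurry fun p z : E n =>
      (1 - Real.cos (2 * Real.pi * inner ℝ p ξ))
        * inner ℝ (truncKernel n s ε z) (truncKernel n s ε (p - z))) (volume.prod volume) := by
    refine (integrable_truncKernel_prod hn hs0 hε).bdd_mul (c := 2)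
      (f := fun z : E n × E n => 1 - Real.cos (2 * Real.pi * inner ℝ z.1 ξ))
      (by fun_prop) (.of_forall fun z => ?_)
    rw [Real.norm_of_nonneg (by linarith [Real.cos_le_one (2 * Real.pi * inner ℝ z.1 ξ)])]
    linarith [Real.neg_one_le_cos (2 * Real.pi * inner ℝ z.1 ξ)]
  have hcosi : Integrable fun w : E n =>
      Real.cos (2 * Real.pi * inner ℝ w ξ) • truncKernel n s ε w :=
    Integrable.bdd_smul (φ := fun w : E n => Real.cos (2 * Real.pi * inner ℝ w ξ)) hk 1
      (by fun_prop) (.of_forall fun w => Real.abs_cos_le_one _)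
  have hsini := integrable_sin_smul_truncKernel (ε := ε) hn hs0 hs1 ξ
  have hcos0 : ∫ w : E n, Real.cos (2 * Real.pi * inner ℝ w ξ) • truncKernel n s ε w = 0 :=
    integral_eq_zero_of_odd fun w => by
      rw [truncKernel_neg, inner_neg_left, mul_neg, Real.cos_neg, smul_neg]
  simp only [autoConv, ← integral_const_mul]
  rw [integral_integral_swap hprod]
  have hin : ∀ z : E n, ∫ p, (1 - Real.cos (2 * Real.pi * inner ℝ p ξ))
        * inner ℝ (truncKernel n s ε z) (truncKernel n s ε (p - z))
      = inner ℝ (sinSymbol n s ε ξ)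
        (Real.sin (2 * Real.pi * inner ℝ z ξ) • truncKernel n s ε z) := by
    intro z
    rw [← integral_add_right_eq_self _ z]
    have h1 : ∀ q : E n, (1 - Real.cos (2 * Real.pi * inner ℝ (q + z) ξ))
        * inner ℝ (truncKernel n s ε z) (truncKernel n s ε (q + z - z))
        = inner ℝ (truncKernel n s ε z) (truncKernel n s ε q
          - Real.cos (2 * Real.pi * inner ℝ z ξ) •
            (Real.cos (2 * Real.pi * inner ℝ q ξ) • truncKernel n s ε q)
          + Real.sin (2 * Real.pi * inner ℝ z ξ) •
            (Real.sin (2 * Real.pi * inner ℝ q ξ) • truncKernel n s ε q)) := by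
      intro q
      rw [add_sub_cancel_right, inner_add_left, mul_add, Real.cos_add, inner_add_right,
        inner_sub_right]
      simp only [real_inner_smul_right]
      ring
    simp_rw [h1]
    have i1 : Integrable fun q : E n => truncKernel n s ε q
          - Real.cos (2 * Real.pi * inner ℝ z ξ) •
            (Real.cos (2 * Real.pi * inner ℝ q ξ) • truncKernel n s ε q) :=
      hk.sub (hcosi.smul (Real.cos (2 * Real.pi * inner ℝ z ξ)))
    have i0 : Integrable fun q : E n => Real.cos (2 * Real.pi * inner ℝ z ξ) •
        (Real.cos (2 * Real.pi * inner ℝ q ξ) • truncKernel n s ε q) :=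
      hcosi.smul (Real.cos (2 * Real.pi * inner ℝ z ξ))
    have i2 : Integrable fun q : E n => Real.sin (2 * Real.pi * inner ℝ z ξ) •
        (Real.sin (2 * Real.pi * inner ℝ q ξ) • truncKernel n s ε q) :=
      hsini.smul (Real.sin (2 * Real.pi * inner ℝ z ξ))
    have i3 : Integrable fun q : E n => truncKernel n s ε q
          - Real.cos (2 * Real.pi * inner ℝ z ξ) •
            (Real.cos (2 * Real.pi * inner ℝ q ξ) • truncKernel n s ε q)
          + Real.sin (2 * Real.pi * inner ℝ z ξ) •
        (Real.sin (2 * Real.pi * inner ℝ q ξ) • truncKernel n s ε q) := i1.add i2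
    rw [integral_inner (𝕜 := ℝ) i3, integral_add i1 i2, integral_sub hk i0,
      integral_smul, integral_smul, hcos0, integral_truncKernel, smul_zero, sub_zero, zero_add,
      real_inner_smul_right, real_inner_smul_right, ← sinSymbol,
      real_inner_comm (sinSymbol n s ε ξ)]
  simp_rw [hin]
  rw [integral_inner (𝕜 := ℝ) hsini, ← sinSymbol, real_inner_self_eq_norm_sq]

/-- The limit of the self-convolution of the truncated kernel. -/
theorem tendsto_autoConv (hn : 1 ≤ n) (hs0 : 0 < s) (hs1 : s < 1) {e : E n} (he : ‖e‖ = 1)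
    {p : E n} (hp : p ≠ 0) :
    Tendsto (fun ε => autoConv n s ε p) (𝓝[>] 0)
      (𝓝 (fracLapConst n s * (‖sinSymbol n s 0 e‖ / (2 * Real.pi) ^ s) ^ 2
        * ‖p‖ ^ (-((n : ℝ) + 2 * s)))) := by
  have he0 : e ≠ 0 := by rintro rfl; simp at he
  obtain ⟨c, hc⟩ := exists_tendsto_autoConv hn hs0 hs1 he0
  -- Rotation and scaling reduce every point q to the unit vector e, with truncation radius ε/|q|.
  have hform : ∀ q : E n, q ≠ 0 → ∀ ε, autoConv n s ε q
      = ‖q‖ ^ (-((n : ℝ) + 2 * s)) * autoConv n s (‖q‖⁻¹ * ε) e := by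
    intro q hq ε
    have hq0 : 0 < ‖q‖ := norm_pos_iff.2 hq
    obtain ⟨R, hR⟩ := exists_linearIsometryEquiv_map_eq (v := ‖q‖ • e) (w := q)
      (by simp [norm_smul, he])
    rw [← autoConv_smul hq0, mul_inv_cancel_left₀ hq0.ne', ← autoConv_map R (‖q‖ • e), hR]
  have hlim : ∀ q : E n, q ≠ 0 → Tendsto (fun ε => autoConv n s ε q) (𝓝[>] 0)
      (𝓝 (‖q‖ ^ (-((n : ℝ) + 2 * s)) * c)) := by
    intro q hq
    have hq0 : 0 < ‖q‖ := norm_pos_iff.2 hq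
    simp_rw [hform q hq]
    refine (hc.comp ?_).const_mul _
    refine tendsto_nhdsWithin_iff.2 ⟨?_, ?_⟩
    · have : Tendsto (fun ε : ℝ => ‖q‖⁻¹ * ε) (𝓝 0) (𝓝 (‖q‖⁻¹ * 0)) := tendsto_id.const_mul _
      rw [mul_zero] at this
      exact this.mono_left nhdsWithin_le_nhds
    · filter_upwards [self_mem_nhdsWithin] with ε hε
      exact mul_pos (inv_pos.2 hq0) hε
  -- A bound for all ε > 0 is needed, since ε/|q| is arbitrary as q varies. For small ε it comes
  -- from convergence, for ε ≥ δ from rescaling to truncation radius 1.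
  obtain ⟨M, hM⟩ : ∃ M : ℝ, ∀ ε, 0 < ε → |autoConv n s ε e| ≤ M := by
    obtain ⟨δ, hδ0, hδ⟩ := mem_nhdsGT_iff_exists_Ioo_subset.1
      (hc.abs.eventually (ge_mem_nhds (lt_add_one |c|)))
    have hδ0 : 0 < δ := hδ0
    set B := (∫ z, ‖truncKernel n s 1 z‖) * (1 : ℝ) ^ (-((n : ℝ) + s)) with hB
    refine ⟨max (|c| + 1) (δ ^ (-((n : ℝ) + 2 * s)) * B), fun ε hε => ?_⟩
    by_cases h : ε < δ
    · exact le_max_of_le_left (hδ ⟨hε, h⟩)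
    · refine le_max_of_le_right ?_
      have h1 := autoConv_smul (n := n) (s := s) (ε := 1) hε (ε⁻¹ • e)
      rw [smul_smul, mul_inv_cancel₀ hε.ne', one_smul, mul_one] at h1
      rw [h1, abs_mul, abs_of_pos (by positivity)]
      refine mul_le_mul ?_ (abs_autoConv_le hn hs0 one_pos _) (abs_nonneg _) (by positivity)
      exact Real.rpow_le_rpow_of_nonpos hδ0 (not_lt.1 h)
        (by linarith [Nat.cast_nonneg (α := ℝ) n])
  have hnt : Nontrivial (E n) := ⟨e, 0, he0⟩
  have hae : ∀ᵐ q : E n, q ≠ 0 := by simp [ae_iff]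
  have hI := integrable_one_sub_cos_mul (V := E n) (by simp; omega) hs0 hs1 e
  have hval := fracLapConst_mul_integral_one_sub_cos (V := E n) (by simp; omega) hs0 hs1 e
  simp only [finrank_euclideanSpace_fin] at hI hval
  have hDCT : Tendsto (fun ε => ∫ q, (1 - Real.cos (2 * Real.pi * inner ℝ q e)) * autoConv n s ε q)
      (𝓝[>] 0) (𝓝 (∫ q : E n, (1 - Real.cos (2 * Real.pi * inner ℝ q e))
        * (‖q‖ ^ (-((n : ℝ) + 2 * s)) * c))) := by
    refine tendsto_integral_filter_of_dominated_convergence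
      (fun q => (1 - Real.cos (2 * Real.pi * inner ℝ q e)) * ‖q‖ ^ (-((n : ℝ) + 2 * s)) * M)
      (.of_forall fun ε => ?_) ?_ (hI.mul_const M) ?_
    · exact ((by fun_prop : Measurable fun w : E n =>
        1 - Real.cos (2 * Real.pi * inner ℝ w e)).mul measurable_autoConv).aestronglyMeasurable
    · filter_upwards [self_mem_nhdsWithin] with ε hε
      filter_upwards [hae] with q hq
      have hq0 : 0 < ‖q‖ := norm_pos_iff.2 hq
      have h0 : 0 ≤ 1 - Real.cos (2 * Real.pi * inner ℝ q e) := by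
        linarith [Real.cos_le_one (2 * Real.pi * inner ℝ q e)]
      rw [norm_mul, Real.norm_of_nonneg h0, hform q hq, norm_mul,
        Real.norm_of_nonneg (by positivity : 0 ≤ ‖q‖ ^ (-((n : ℝ) + 2 * s)))]
      rw [mul_assoc (1 - _)]
      refine mul_le_mul_of_nonneg_left (mul_le_mul_of_nonneg_left ?_ (by positivity)) h0
      exact hM _ (mul_pos (inv_pos.2 hq0) hε)
    · filter_upwards [hae] with q hq using (hlim q hq).const_mul _
  have hsq : Tendsto (fun ε => ∫ q, (1 - Real.cos (2 * Real.pi * inner ℝ q e)) * autoConv n s ε q)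
      (𝓝[>] 0) (𝓝 (‖sinSymbol n s 0 e‖ ^ 2)) := by
    refine Tendsto.congr' ?_ ((tendsto_sinSymbol hn hs0 hs1 e).norm.pow 2)
    filter_upwards [self_mem_nhdsWithin] with ε hε
    exact (integral_autoConv_mul hn hs0 hs1 hε e).symm
  -- Two limits of the same integrals: c times the integral defining the symbol of the fractional
  -- Laplacian at e, and |V_0(e)|². This determines c.
  have heq := tendsto_nhds_unique hDCT hsq
  simp_rw [← mul_assoc] at heq
  rw [integral_mul_const] at heq
  have hc' : c = fracLapConst n s * (‖sinSymbol n s 0 e‖ / (2 * Real.pi) ^ s) ^ 2 := by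
    have hπ : 0 < (2 * Real.pi) ^ s := by positivity
    have h2 : (2 * Real.pi * ‖e‖) ^ (2 * s) = ((2 * Real.pi) ^ s) ^ 2 := by
      rw [he, mul_one, mul_comm 2 s, Real.rpow_mul (by positivity), Real.rpow_two]
    rw [h2] at hval
    rw [div_pow, ← heq, ← hval]
    have hC := (fracLapConst_pos (n := n) hs0 hs1).ne'
    have hI0 : (∫ w : E n, (1 - Real.cos (2 * Real.pi * inner ℝ w e))
        * ‖w‖ ^ (-((n : ℝ) + 2 * s))) ≠ 0 := by
      intro h0
      rw [h0, mul_zero] at hval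
      exact (by positivity : ((2 * Real.pi) ^ s) ^ 2 ≠ 0) hval.symm
    field_simp
  rw [← hc', mul_comm]
  exact hlim p hp

end AutoConv

/-! ### The equivalence kernel -/

section EquivKernel

variable {n : ℕ} {s ε : ℝ}

theorem fracWeight_smul_fracKernel (x y : E n) :
    fracWeight n s x y • fracKernel n x y = vecKernel n s (y - x) := by
  rw [fracWeight, fracKernel, interactionKernel, if_pos le_top, unitKernel, vecKernel, smul_smul]
  by_cases h : y - x = 0
  · simp [h]
  · have : ‖y - x‖ ≠ 0 := norm_ne_zero_iff.2 h
    congr 1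
    rw [show -((n : ℝ) + 1 + s) = -((n : ℝ) + s + 1) by ring]
    field_simp

/-- The truncated kernel, restricted to `ε < |p - w|`. -/
noncomputable def awayKernel (n : ℕ) (s ε : ℝ) (p : E n) : E n → E n :=
  {w | ε < ‖p - w‖}.indicator (truncKernel n s ε)

theorem measurableSet_lt_norm_sub (ε : ℝ) (p : E n) : MeasurableSet {w : E n | ε < ‖p - w‖} :=
  measurableSet_lt measurable_const (measurable_const.sub measurable_id).norm

theorem integrable_awayKernel (hn : 1 ≤ n) (hs0 : 0 < s) (hε : 0 < ε) (p : E n) :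
    Integrable (awayKernel n s ε p) :=
  (integrable_truncKernel hn hs0 hε).indicator (measurableSet_lt_norm_sub ε p)

/-- The whole truncated kernel integrates to zero, so this integral is minus the one over the ball
of radius ε about p. There the kernel stays bounded, as p ≠ 0, and the ball shrinks to a point.
Hence the first two terms of the equivalence kernel vanish in the limit. -/
theorem tendsto_integral_awayKernel (hn : 1 ≤ n) (hs0 : 0 < s) {p : E n} (hp : p ≠ 0) :
    Tendsto (fun ε => ∫ w, awayKernel n s ε p w) (𝓝[>] 0) (𝓝 0) := by
  have hp0 : 0 < ‖p‖ := norm_pos_iff.2 hp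
  have hr : 0 < ‖p‖ / 2 := half_pos hp0
  have hmem : ∀ᶠ ε in 𝓝[>] (0 : ℝ), ε ∈ Set.Ioo 0 (‖p‖ / 2) := Ioo_mem_nhdsGT hr
  have h1 : Tendsto (fun ε => ∫ w, {w : E n | ε < ‖p - w‖}ᶜ.indicator (truncKernel n s ε) w)
      (𝓝[>] 0) (𝓝 (∫ _ : E n, (0 : E n))) := by
    refine tendsto_integral_filter_of_dominated_convergence
      (fun w => ‖truncKernel n s (‖p‖ / 4) w‖) (.of_forall fun ε =>
        (measurable_truncKernel.indicator (measurableSet_lt_norm_sub ε p).compl).aestronglyMeasurable)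
      (hmem.mono fun ε hε => .of_forall fun w => ?_)
      (integrable_truncKernel hn hs0 (by positivity)).norm ?_
    · by_cases h : ε < ‖p - w‖
      · rw [Set.indicator_of_notMem (by simpa using h), norm_zero]; positivity
      · rw [Set.indicator_of_mem (by simpa using h)]
        have h2 : ‖p‖ / 4 < ‖w‖ := by
          have := norm_sub_norm_le p w
          have := hε.2
          linarith
        rw [truncKernel_of_lt h2]
        exact norm_truncKernel_le_vecKernel w
    · have : Nontrivial (E n) := ⟨p, 0, hp⟩
      have hae : ∀ᵐ w : E n, w ≠ p := by simp [ae_iff]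
      filter_upwards [hae] with w hw
      refine Tendsto.congr' ?_ tendsto_const_nhds
      filter_upwards [Ioo_mem_nhdsGT (norm_pos_iff.2 (sub_ne_zero.2 hw.symm))] with ε hε
      rw [Set.indicator_of_notMem (by simpa using hε.2)]
  rw [integral_zero] at h1
  have h2 := h1.neg
  rw [neg_zero] at h2
  refine h2.congr' ?_
  filter_upwards [self_mem_nhdsWithin] with ε hε
  have hm := measurableSet_lt_norm_sub ε p
  have := integral_add_compl hm (integrable_truncKernel (n := n) hn hs0 hε)
  rw [integral_truncKernel] at this
  rw [awayKernel, integral_indicator hm.compl, integral_indicator hm]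
  exact (eq_neg_of_add_eq_zero_left this).symm

/-- The truncated integrand of the equivalence kernel, centered at the origin. -/
noncomputable def equivTrunc (n : ℕ) (s ε : ℝ) (p w : E n) : ℝ :=
  inner ℝ (vecKernel n s p) (awayKernel n s ε p w)
    + inner ℝ (vecKernel n s p) (awayKernel n s ε p (p - w))
    + inner ℝ (truncKernel n s ε w) (truncKernel n s ε (p - w))

theorem integrable_equivTrunc (hn : 1 ≤ n) (hs0 : 0 < s) (hε : 0 < ε) (p : E n) :
    Integrable (equivTrunc n s ε p) := by
  have h := (integrable_awayKernel hn hs0 hε p).const_inner (𝕜 := ℝ) (vecKernel n s p)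
  exact (h.add (h.comp_sub_left p)).add (integrable_inner_truncKernel_sub hn hs0 hε p)

theorem integral_equivTrunc (hn : 1 ≤ n) (hs0 : 0 < s) (hε : 0 < ε) (p : E n) :
    ∫ w, equivTrunc n s ε p w
      = 2 * inner ℝ (vecKernel n s p) (∫ w, awayKernel n s ε p w) + autoConv n s ε p := by
  have ha := integrable_awayKernel hn hs0 hε p
  have h := ha.const_inner (𝕜 := ℝ) (vecKernel n s p)
  have h' : Integrable fun w => inner ℝ (vecKernel n s p) (awayKernel n s ε p w)
    + inner ℝ (vecKernel n s p) (awayKernel n s ε p (p - w)) := h.add (h.comp_sub_left p)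
  have h1 := integral_sub_left_eq_self
    (fun z => inner ℝ (vecKernel n s p) (awayKernel n s ε p z)) volume p
  simp only [equivTrunc]
  rw [integral_add h' (integrable_inner_truncKernel_sub hn hs0 hε p),
    integral_add h (h.comp_sub_left p), h1, integral_inner (𝕜 := ℝ) ha, autoConv]
  ring

theorem measurableSet_awayFrom (ε : ℝ) (x y : E n) : MeasurableSet (awayFrom ε x y) :=
  (measurableSet_lt measurable_const (measurable_id.sub measurable_const).norm).inter
    (measurableSet_lt measurable_const (measurable_id.sub measurable_const).norm)

theorem indicator_equivIntegrand (x y : E n) :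
    (awayFrom ε x y).indicator (equivIntegrand (fracWeight n s) (fracKernel n) x y)
      = fun z => equivTrunc n s ε (y - x) (z - x) := by
  ext z
  have e1 : y - x - (z - x) = y - z := by abel
  have e2 : y - x - (y - z) = z - x := by abel
  rw [equivTrunc, e1]
  by_cases h1 : ε < ‖z - x‖
  · by_cases h2 : ε < ‖y - z‖
    · rw [Set.indicator_of_mem (by exact ⟨h1, by rwa [norm_sub_rev]⟩), equivIntegrand]
      simp only [fracWeight_smul_fracKernel]
      rw [truncKernel_of_lt h1, truncKernel_of_lt h2, awayKernel,
        Set.indicator_of_mem (by change ε < _; rwa [e1]),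
        Set.indicator_of_mem (by change ε < _; rwa [e2]), truncKernel_of_lt h1,
        truncKernel_of_lt h2, real_inner_comm (vecKernel n s (y - x)),
        real_inner_comm (vecKernel n s (z - x)) (vecKernel n s (y - z))]
    · rw [Set.indicator_of_notMem (fun h => h2 (by rw [norm_sub_rev]; exact h.2)),
        truncKernel_of_not_lt h2, awayKernel,
        Set.indicator_of_notMem (by change ¬ ε < _; rwa [e1])]
      simp [Set.indicator, truncKernel_of_not_lt h2]
  · rw [Set.indicator_of_notMem (fun h => h1 h.1), truncKernel_of_not_lt h1, awayKernel,
      Set.indicator_of_notMem (a := y - z) (by change ¬ ε < _; rwa [e2])]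
    simp [Set.indicator, truncKernel_of_not_lt h1]

theorem integrableOn_equivIntegrand (hn : 1 ≤ n) (hs0 : 0 < s) (hε : 0 < ε) (x y : E n) :
    IntegrableOn (equivIntegrand (fracWeight n s) (fracKernel n) x y) (awayFrom ε x y) := by
  rw [← integrable_indicator_iff (measurableSet_awayFrom ε x y), indicator_equivIntegrand]
  exact (integrable_equivTrunc hn hs0 hε _).comp_sub_right x

theorem tendsto_integral_equivIntegrand (hn : 1 ≤ n) (hs0 : 0 < s) (hs1 : s < 1) {e : E n}
    (he : ‖e‖ = 1) {x y : E n} (hxy : x ≠ y) :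
    Tendsto (fun ε : ℝ => ∫ z in awayFrom ε x y,
        equivIntegrand (fracWeight n s) (fracKernel n) x y z) (𝓝[>] 0)
      (𝓝 (fracLapConst n s * (‖sinSymbol n s 0 e‖ / (2 * Real.pi) ^ s) ^ 2
        * ‖y - x‖ ^ (-((n : ℝ) + 2 * s)))) := by
  have hp : y - x ≠ 0 := sub_ne_zero.2 hxy.symm
  have h1 : Tendsto (fun ε => 2 * inner ℝ (vecKernel n s (y - x))
      (∫ w, awayKernel n s ε (y - x) w)) (𝓝[>] 0) (𝓝 0) := by
    have := ((tendsto_const_nhds (x := vecKernel n s (y - x))).inner (𝕜 := ℝ)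
      (tendsto_integral_awayKernel hn hs0 hp)).const_mul 2
    simpa using this
  have h2 := h1.add (tendsto_autoConv hn hs0 hs1 he hp)
  rw [zero_add] at h2
  refine h2.congr' ?_
  filter_upwards [self_mem_nhdsWithin] with ε hε
  rw [← integral_indicator (measurableSet_awayFrom ε x y), indicator_equivIntegrand,
    integral_sub_right_eq_self (equivTrunc n s ε (y - x)) x, integral_equivTrunc hn hs0 hε]

theorem two_mul_equivKernel (hn : 1 ≤ n) (hs0 : 0 < s) (hs1 : s < 1) {e : E n}
    (he : ‖e‖ = 1) {x y : E n} (hxy : x ≠ y) :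
    2 * equivKernel (fracWeight n s) (fracKernel n) x y
      = fracLapConst n s * (‖sinSymbol n s 0 e‖ / (2 * Real.pi) ^ s) ^ 2
        * ‖y - x‖ ^ (-((n : ℝ) + 2 * s)) := by
  rw [equivKernel, (tendsto_integral_equivIntegrand hn hs0 hs1 he hxy).limUnder_eq]
  ring

end EquivKernel

/-! ### The Fourier transform on `L²` -/

section L2Fourier

open scoped FourierTransform ContDiff

variable {n : ℕ}

/-- The function `f` is in `L²`, and `fhat` represents its Fourier transform. -/
def HasL2Fourier (f fhat : E n → ℂ) : Prop :=
  ∃ hf : MemLp f 2 (volume : Measure (E n)),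
    ((𝓕 (hf.toLp f) : Lp ℂ 2 (volume : Measure (E n))) : E n → ℂ) =ᵐ[volume] fhat

theorem HasL2Fourier.memLp {f fhat : E n → ℂ} (h : HasL2Fourier f fhat) : MemLp f 2 volume := h.1

theorem HasL2Fourier.memLp_hat {f fhat : E n → ℂ} (h : HasL2Fourier f fhat) :
    MemLp fhat 2 volume := by
  obtain ⟨hf, h⟩ := h
  exact (Lp.memLp _).ae_eq h

theorem HasL2Fourier.fourier_toLp {f fhat : E n → ℂ} (h : HasL2Fourier f fhat) :
    𝓕 (h.memLp.toLp f) = h.memLp_hat.toLp fhat :=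
  Lp.ext (h.2.trans h.memLp_hat.coeFn_toLp.symm)

theorem HasL2Fourier.congr_left {f g fhat : E n → ℂ} (h : HasL2Fourier f fhat)
    (hfg : f =ᵐ[volume] g) : HasL2Fourier g fhat := by
  obtain ⟨hf, h⟩ := h
  refine ⟨hf.ae_eq hfg, ?_⟩
  rwa [← MemLp.toLp_congr hf (hf.ae_eq hfg) hfg]

theorem HasL2Fourier.congr_right {f fhat ghat : E n → ℂ} (h : HasL2Fourier f fhat)
    (hfg : fhat =ᵐ[volume] ghat) : HasL2Fourier f ghat :=
  ⟨h.1, h.2.trans hfg⟩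

theorem exists_hasL2Fourier {f : E n → ℂ} (hf : MemLp f 2 (volume : Measure (E n))) :
    ∃ fhat, HasL2Fourier f fhat :=
  ⟨_, hf, EventuallyEq.rfl⟩

theorem exists_hasL2Fourier_of_hat {fhat : E n → ℂ}
    (hf : MemLp fhat 2 (volume : Measure (E n))) : ∃ f, HasL2Fourier f fhat := by
  refine ⟨((𝓕⁻ (hf.toLp fhat) : Lp ℂ 2 (volume : Measure (E n))) : E n → ℂ), Lp.memLp _, ?_⟩
  rw [Lp.toLp_coeFn, FourierTransform.fourier_fourierInv_eq]
  exact hf.coeFn_toLp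

theorem HasL2Fourier.add {f g fhat ghat : E n → ℂ} (hf : HasL2Fourier f fhat)
    (hg : HasL2Fourier g ghat) :
    HasL2Fourier (fun x => f x + g x) (fun ξ => fhat ξ + ghat ξ) := by
  refine ⟨hf.memLp.add hg.memLp, ?_⟩
  have h : (hf.memLp.add hg.memLp).toLp (fun x => f x + g x)
      = hf.memLp.toLp f + hg.memLp.toLp g := MemLp.toLp_add _ _
  rw [h, FourierTransform.fourier_add, hf.fourier_toLp, hg.fourier_toLp, ← MemLp.toLp_add]
  exact MemLp.coeFn_toLp _

theorem HasL2Fourier.const_mul {f fhat : E n → ℂ} (hf : HasL2Fourier f fhat) (c : ℂ) :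
    HasL2Fourier (fun x => c * f x) (fun ξ => c * fhat ξ) := by
  refine ⟨hf.memLp.const_smul c, ?_⟩
  have h : (hf.memLp.const_smul c).toLp (fun x => c * f x) = c • hf.memLp.toLp f :=
    MemLp.toLp_const_smul (f := f) c hf.memLp
  rw [h, FourierTransform.fourier_smul, hf.fourier_toLp, ← MemLp.toLp_const_smul]
  exact MemLp.coeFn_toLp _

theorem HasL2Fourier.sub {f g fhat ghat : E n → ℂ} (hf : HasL2Fourier f fhat)
    (hg : HasL2Fourier g ghat) :
    HasL2Fourier (fun x => f x - g x) (fun ξ => fhat ξ - ghat ξ) := by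
  simpa [sub_eq_add_neg] using hf.add (hg.const_mul (-1))

theorem hasL2Fourier_zero : HasL2Fourier (fun _ : E n => (0 : ℂ)) fun _ => 0 := by
  obtain ⟨g, hg⟩ := exists_hasL2Fourier (MemLp.zero' : MemLp (fun _ : E n => (0 : ℂ)) 2 volume)
  simpa using hg.const_mul 0

theorem HasL2Fourier.sum {ι : Type*} (t : Finset ι) {f fhat : ι → E n → ℂ}
    (h : ∀ i ∈ t, HasL2Fourier (f i) (fhat i)) :
    HasL2Fourier (fun x => ∑ i ∈ t, f i x) (fun ξ => ∑ i ∈ t, fhat i ξ) := by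
  classical
  induction t using Finset.induction_on with
  | empty => simpa using hasL2Fourier_zero
  | insert a t ha ih =>
    simp only [Finset.sum_insert ha]
    exact (h a (Finset.mem_insert_self _ _)).add
      (ih fun i hi => h i (Finset.mem_insert_of_mem hi))

theorem HasL2Fourier.eLpNorm_eq {f fhat : E n → ℂ} (h : HasL2Fourier f fhat) :
    eLpNorm f 2 volume = eLpNorm fhat 2 volume := by
  have h1 : ‖𝓕 (h.memLp.toLp f)‖ₑ = ‖h.memLp.toLp f‖ₑ := by
    rw [← ofReal_norm, ← ofReal_norm, Lp.norm_fourier_eq]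
  rw [h.fourier_toLp, Lp.enorm_def, Lp.enorm_def, eLpNorm_congr_ae h.memLp_hat.coeFn_toLp,
    eLpNorm_congr_ae h.memLp.coeFn_toLp] at h1
  exact h1.symm

/-- The `L²` Fourier transform is closed under `L²` limits. -/
theorem HasL2Fourier.of_tendsto {ι : Type*} {l : Filter ι} [l.NeBot] {f W : ι → E n → ℂ}
    {g W₀ : E n → ℂ} (h : ∀ᶠ i in l, HasL2Fourier (f i) (W i))
    (hg : MemLp g 2 (volume : Measure (E n))) (hW₀ : MemLp W₀ 2 (volume : Measure (E n)))
    (hW : Tendsto (fun i => eLpNorm (fun ξ => W i ξ - W₀ ξ) 2 volume) l (𝓝 0))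
    (hf : Tendsto (fun i => eLpNorm (fun x => f i x - g x) 2 volume) l (𝓝 0)) :
    HasL2Fourier g W₀ := by
  -- The function g' with transform W₀ is the only candidate; by Plancherel it is also the L² limit
  -- of f, hence equals g almost everywhere.
  obtain ⟨g', hg'⟩ := exists_hasL2Fourier_of_hat hW₀
  refine hg'.congr_left ?_
  have hle : ∀ᶠ i in l, eLpNorm (fun x => g' x - g x) 2 volume
      ≤ eLpNorm (fun ξ => W i ξ - W₀ ξ) 2 volume + eLpNorm (fun x => f i x - g x) 2 volume := by
    filter_upwards [h] with i hi
    rw [← (hi.sub hg').eLpNorm_eq]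
    have h1 : (fun x => g' x - g x) = (fun x => f i x - g x) - fun x => f i x - g' x := by
      ext x; simp
    rw [h1, add_comm]
    exact eLpNorm_sub_le (hi.memLp.sub hg).1 (hi.memLp.sub hg'.memLp).1 one_le_two
  have h0 : eLpNorm (fun x => g' x - g x) 2 volume ≤ 0 + 0 :=
    ge_of_tendsto (hW.add hf) hle
  have hm : AEStronglyMeasurable (fun x => g' x - g x) (volume : Measure (E n)) :=
    (hg'.memLp.sub hg).1
  rw [add_zero, nonpos_iff_eq_zero, eLpNorm_eq_zero_iff hm two_ne_zero] at h0
  filter_upwards [h0] with x hx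
  exact sub_eq_zero.1 hx

/-- Dominated convergence in `L²`. -/
theorem tendsto_eLpNorm_two_of_dominated {α F : Type*} [MeasurableSpace α] {μ : Measure α}
    [NormedAddCommGroup F] {ι : Type*} {l : Filter ι}
    [l.IsCountablyGenerated] {f : ι → α → F} {H : α → ℝ}
    (hm : ∀ᶠ i in l, AEStronglyMeasurable (f i) μ) (hH : MemLp H 2 μ)
    (hb : ∀ᶠ i in l, ∀ᵐ x ∂μ, ‖f i x‖ ≤ H x)
    (hlim : ∀ᵐ x ∂μ, Tendsto (fun i => f i x) l (𝓝 0)) :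
    Tendsto (fun i => eLpNorm (f i) 2 μ) l (𝓝 0) := by
  have h2 : ∀ g : α → F, eLpNorm g 2 μ = (∫⁻ x, ‖g x‖ₑ ^ (2 : ℝ) ∂μ) ^ (1 / 2 : ℝ) := fun g => by
    rw [eLpNorm_eq_lintegral_rpow_enorm_toReal two_ne_zero ENNReal.ofNat_ne_top]; simp
  simp_rw [h2]
  have h3 : Tendsto (fun i => ∫⁻ x, ‖f i x‖ₑ ^ (2 : ℝ) ∂μ) l (𝓝 (∫⁻ _, 0 ∂μ)) := by
    refine tendsto_lintegral_filter_of_dominated_convergence' (fun x => ‖H x‖ₑ ^ (2 : ℝ))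
      (hm.mono fun i hi => hi.enorm.pow_const _) (hb.mono fun i hi => hi.mono fun x hx => ?_) ?_ ?_
    · refine ENNReal.rpow_le_rpow ?_ zero_le_two
      exact enorm_le_iff_norm_le.2 (hx.trans (le_abs_self _))
    · have := lintegral_rpow_enorm_lt_top_of_eLpNorm_lt_top two_ne_zero ENNReal.ofNat_ne_top
        hH.eLpNorm_lt_top
      simpa using this.ne
    · filter_upwards [hlim] with x hx
      have h4 := (ENNReal.continuous_rpow_const (y := 2)).tendsto _ |>.comp hx.enorm
      simpa [Function.comp_def] using h4
  have h5 := (ENNReal.continuous_rpow_const (y := 1 / 2)).tendsto _ |>.comp h3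
  simpa [Function.comp_def] using h5

/-! ### Integrable functions -/

theorem integral_fourier_mul_eq_flip {f g : E n → ℂ} (hf : Integrable f) (hg : Integrable g) :
    ∫ ξ, 𝓕 f ξ * g ξ = ∫ x, f x * 𝓕 g x := by
  have h := VectorFourier.integral_fourierIntegral_smul_eq_flip (L := innerₗ (E n)) (μ := volume)
    (ν := volume) Real.continuous_fourierChar continuous_inner hf hg
  rw [flip_innerₗ] at h
  exact h

theorem integral_fourierInv_mul_eq_flip {f g : E n → ℂ} (hf : Integrable f) (hg : Integrable g) :
    ∫ ξ, 𝓕⁻ f ξ * g ξ = ∫ x, f x * 𝓕⁻ g x := by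
  have h := integral_fourier_mul_eq_flip hf.comp_neg hg
  simp_rw [Real.fourierInv_eq_fourier_comp_neg f]
  rw [h, ← integral_neg_eq_self]
  simp_rw [neg_neg, Real.fourierInv_eq_fourier_neg]

theorem norm_fourierInv_le {f : E n → ℂ} (ξ : E n) : ‖𝓕⁻ f ξ‖ ≤ ∫ x, ‖f x‖ := by
  rw [Real.fourierInv_eq]
  refine (norm_integral_le_integral_norm _).trans_eq ?_
  simp

theorem continuous_fourierInv {f : E n → ℂ} (hf : Integrable f) : Continuous (𝓕⁻ f) := by
  rw [Real.fourierInv_eq_fourier_comp_neg]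
  exact VectorFourier.fourierIntegral_continuous Real.continuous_fourierChar continuous_inner
    hf.comp_neg

/-- On `L¹ ∩ L²` the inverse Fourier transform of `L²` is given by the integral. -/
theorem fourierInv_toLp_ae_eq {f : E n → ℂ} (hf1 : Integrable f)
    (hf2 : MemLp f 2 (volume : Measure (E n))) :
    ((𝓕⁻ (hf2.toLp f) : Lp ℂ 2 (volume : Measure (E n))) : E n → ℂ) =ᵐ[volume] 𝓕⁻ f := by
  -- Both sides are tested against smooth compactly supported functions, which are Schwartz: duality
  -- of tempered distributions handles the left side, the multiplication formula the right one.
  refine ae_eq_of_integral_contDiff_smul_eq ((Lp.memLp _).locallyIntegrable one_le_two)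
    (continuous_fourierInv hf1).locallyIntegrable fun g hg hgc => ?_
  have hg₁ : HasCompactSupport (Complex.ofRealCLM ∘ g) := hgc.comp_left rfl
  have hg₂ : ContDiff ℝ ∞ (Complex.ofRealCLM ∘ g) := by fun_prop
  set φ : 𝓢(E n, ℂ) := hg₁.toSchwartzMap hg₂ with hφ
  have hφx : ∀ x, φ x = (g x : ℂ) := fun x => rfl
  have h1 := congrArg (fun T : 𝓢'(E n, ℂ) => T φ)
    (Lp.fourierInv_toTemperedDistribution_eq (hf2.toLp f))
  simp only [TemperedDistribution.fourierInv_apply, Lp.toTemperedDistribution_apply,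
    smul_eq_mul] at h1
  have h2 : ∫ x, (𝓕⁻ φ) x * (hf2.toLp f : E n → ℂ) x = ∫ x, (𝓕⁻ φ) x * f x := by
    refine integral_congr_ae ?_
    filter_upwards [hf2.coeFn_toLp] with x hx
    rw [hx]
  rw [h2] at h1
  simp only [SchwartzMap.fourierInv_coe] at h1
  rw [integral_fourierInv_mul_eq_flip φ.integrable hf1] at h1
  simp only [Complex.real_smul, ← hφx]
  exact h1.symm

theorem HasL2Fourier.of_integrable_hat {g : E n → ℂ} (hg1 : Integrable g)
    (hg2 : MemLp g 2 (volume : Measure (E n))) : HasL2Fourier (𝓕⁻ g) g := by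
  have h : HasL2Fourier ((𝓕⁻ (hg2.toLp g) : Lp ℂ 2 (volume : Measure (E n))) : E n → ℂ) g := by
    refine ⟨Lp.memLp _, ?_⟩
    rw [Lp.toLp_coeFn, FourierTransform.fourier_fourierInv_eq]
    exact hg2.coeFn_toLp
  exact h.congr_left (fourierInv_toLp_ae_eq hg1 hg2)

theorem memLp_fourierInv {f : E n → ℂ} (hf1 : Integrable f)
    (hf2 : MemLp f 2 (volume : Measure (E n))) : MemLp (𝓕⁻ f) 2 (volume : Measure (E n)) :=
  (HasL2Fourier.of_integrable_hat hf1 hf2).memLp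

/-! ### Convolution operators -/

theorem memLp_char_mul {f : E n → ℂ} (hf : MemLp f 2 (volume : Measure (E n))) (x : E n) :
    MemLp (fun ξ => (Real.fourierChar (inner ℝ ξ x) : ℂ) * f ξ) 2 (volume : Measure (E n)) := by
  refine hf.of_le ?_ (.of_forall fun ξ => by rw [norm_mul, Circle.norm_coe, one_mul])
  have h : Continuous fun ξ : E n => (Real.fourierChar (inner ℝ ξ x) : ℂ) := by fun_prop
  exact h.aestronglyMeasurable.mul hf.1

theorem integral_mul_schwartz_add {K : E n → ℂ} (hK : Integrable K) (φ : 𝓢(E n, ℂ)) (x : E n) :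
    ∫ w, K w * φ (x + w)
      = ∫ ξ, (Real.fourierChar (inner ℝ ξ x) : ℂ) * 𝓕⁻ K ξ * 𝓕 φ ξ := by
  have hh : Integrable fun ξ : E n => (Real.fourierChar (inner ℝ ξ x) : ℂ) * 𝓕 φ ξ :=
    (𝓕 φ).integrable.bdd_mul (c := 1)
      (by fun_prop : Continuous fun ξ : E n => (Real.fourierChar (inner ℝ ξ x) : ℂ)).aestronglyMeasurable
      (.of_forall fun ξ => (Circle.norm_coe _).le)
  have h1 : ∀ w, φ (x + w) = 𝓕⁻ (fun ξ : E n => (Real.fourierChar (inner ℝ ξ x) : ℂ) * 𝓕 φ ξ) w := by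
    intro w
    have h2 : φ = 𝓕⁻ (𝓕 φ) := (FourierTransform.fourierInv_fourier_eq φ).symm
    conv_lhs => rw [h2, SchwartzMap.fourierInv_coe]
    rw [Real.fourierInv_eq, Real.fourierInv_eq]
    refine integral_congr_ae (.of_forall fun ξ => ?_)
    simp only [inner_add_right, AddChar.map_add_eq_mul, Circle.smul_def, Circle.coe_mul,
      smul_eq_mul]
    ring
  simp_rw [h1]
  rw [← integral_fourierInv_mul_eq_flip hK hh]
  refine integral_congr_ae (.of_forall fun ξ => ?_)
  simp only; ring

/-- For fixed x each side is an L² scalar product of a fixed function with U or with its transform,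
hence continuous in U. Agreement on Schwartz functions therefore extends by density, and the
identity holds at every x. -/
theorem integral_mul_comp_add {K : E n → ℂ} (hK1 : Integrable K)
    (hK2 : MemLp K 2 (volume : Measure (E n))) (U : Lp ℂ 2 (volume : Measure (E n))) (x : E n) :
    ∫ w, K w * U (x + w)
      = ∫ ξ, (Real.fourierChar (inner ℝ ξ x) : ℂ) * 𝓕⁻ K ξ
          * (𝓕 U : Lp ℂ 2 (volume : Measure (E n))) ξ := by
  have ha : MemLp (fun y => (starRingEnd ℂ) (K (y - x))) 2 (volume : Measure (E n)) :=
    (hK2.comp_measurePreserving (measurePreserving_sub_right volume x)).star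
  have hb : MemLp (fun ξ => (starRingEnd ℂ) ((Real.fourierChar (inner ℝ ξ x) : ℂ) * 𝓕⁻ K ξ)) 2
      (volume : Measure (E n)) := (memLp_char_mul (memLp_fourierInv hK1 hK2) x).star
  have hL : ∀ U : Lp ℂ 2 (volume : Measure (E n)),
      ∫ w, K w * U (x + w) = inner ℂ (ha.toLp _) U := by
    intro U
    rw [L2.inner_def]
    refine Eq.trans ?_ (integral_add_left_eq_self (fun y => inner ℂ (ha.toLp _ y) (U y)) x)
    refine integral_congr_ae ?_
    have h := (measurePreserving_add_left (volume : Measure (E n)) x).quasiMeasurePreserving.ae_eq_comp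
      ha.coeFn_toLp
    filter_upwards [h] with w hw
    simp only [Function.comp_apply] at hw
    simp [hw, mul_comm]
  have hR : ∀ U : Lp ℂ 2 (volume : Measure (E n)),
      ∫ ξ, (Real.fourierChar (inner ℝ ξ x) : ℂ) * 𝓕⁻ K ξ * U ξ = inner ℂ (hb.toLp _) U := by
    intro U
    rw [L2.inner_def]
    refine integral_congr_ae ?_
    filter_upwards [hb.coeFn_toLp] with w hw
    rw [hw]
    simp [mul_comm]
  rw [hL, hR]
  refine DenseRange.induction_on (p := fun U : Lp ℂ 2 (volume : Measure (E n)) =>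
    inner ℂ (ha.toLp _) U = inner ℂ (hb.toLp _) (𝓕 U))
    (SchwartzMap.denseRange_toLpCLM (p := 2) (F := ℂ) ENNReal.ofNat_ne_top) U ?_ ?_
  · exact isClosed_eq (continuous_const.inner continuous_id)
      (continuous_const.inner (Lp.fourierTransformₗᵢ (E n) ℂ).continuous)
  · intro φ
    rw [SchwartzMap.toLpCLM_apply, SchwartzMap.toLp_fourier_eq, ← hL, ← hR]
    have h1 := (measurePreserving_add_left (volume : Measure (E n)) x).quasiMeasurePreserving.ae_eq_comp
      (φ.coeFn_toLp 2 volume)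
    have h2 := (𝓕 φ).coeFn_toLp 2 (volume : Measure (E n))
    have e1 : ∫ w, K w * (φ.toLp 2 volume) (x + w) = ∫ w, K w * φ (x + w) := by
      refine integral_congr_ae ?_
      filter_upwards [h1] with w hw
      simp only [Function.comp_apply] at hw
      rw [hw]
    have e2 : ∫ ξ, (Real.fourierChar (inner ℝ ξ x) : ℂ) * 𝓕⁻ K ξ * ((𝓕 φ).toLp 2 volume) ξ
        = ∫ ξ, (Real.fourierChar (inner ℝ ξ x) : ℂ) * 𝓕⁻ K ξ * 𝓕 φ ξ := by
      refine integral_congr_ae ?_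
      filter_upwards [h2] with w hw
      rw [hw]
    rw [e1, e2]
    exact integral_mul_schwartz_add hK1 φ x

/-- Correlation with a kernel in `L¹ ∩ L²` is a Fourier multiplier. -/
theorem HasL2Fourier.correlation {K u uhat : E n → ℂ} (hu : HasL2Fourier u uhat)
    (hK1 : Integrable K) (hK2 : MemLp K 2 (volume : Measure (E n))) :
    HasL2Fourier (fun x => ∫ w, K w * u (x + w)) (fun ξ => 𝓕⁻ K ξ * uhat ξ) := by
  have hKhat := memLp_fourierInv hK1 hK2
  -- K in L² makes the product integrable, so that its inverse transform is a genuine integral; K in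
  -- L¹ makes the multiplier bounded, so that the product is also in L².
  have g1 : Integrable fun ξ => 𝓕⁻ K ξ * uhat ξ :=
    memLp_one_iff_integrable.1 (hu.memLp_hat.mul' hKhat)
  have g2 : MemLp (fun ξ => 𝓕⁻ K ξ * uhat ξ) 2 (volume : Measure (E n)) := by
    refine hu.memLp_hat.mul' (p := ⊤) (q := 2) (memLp_top_of_bound
      (continuous_fourierInv hK1).aestronglyMeasurable _ (.of_forall norm_fourierInv_le))
  have h := HasL2Fourier.of_integrable_hat g1 g2
  refine h.congr_left (.of_forall fun x => ?_)
  have h1 := integral_mul_comp_add hK1 hK2 (hu.memLp.toLp u) x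
  have h2 := (measurePreserving_add_left (volume : Measure (E n)) x).quasiMeasurePreserving.ae_eq_comp
      hu.memLp.coeFn_toLp
  have e1 : ∫ w, K w * (hu.memLp.toLp u) (x + w) = ∫ w, K w * u (x + w) := by
    refine integral_congr_ae ?_
    filter_upwards [h2] with w hw
    simp only [Function.comp_apply] at hw
    rw [hw]
  beta_reduce
  rw [← e1, h1, Real.fourierInv_eq]
  refine integral_congr_ae ?_
  filter_upwards [hu.2] with ξ hξ
  rw [hξ, Circle.smul_def, smul_eq_mul]
  ring

end L2Fourier

/-! ### Sobolev spaces on the Fourier side -/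

section Sobolev

open scoped FourierTransform ContDiff
open TemperedDistribution

variable {n : ℕ}

/-- The weight `(1 + |ξ|²)^{r/2}`. -/
noncomputable def besselWeight (r : ℝ) (ξ : E n) : ℝ := (1 + ‖ξ‖ ^ 2) ^ (r / 2)

theorem besselWeight_pos (r : ℝ) (ξ : E n) : 0 < besselWeight r ξ :=
  Real.rpow_pos_of_pos (by positivity) _

theorem besselWeight_mul_besselWeight_neg (r : ℝ) (ξ : E n) :
    besselWeight r ξ * besselWeight (-r) ξ = 1 := by
  rw [besselWeight, besselWeight, ← Real.rpow_add (by positivity)]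
  ring_nf
  exact Real.rpow_zero _

theorem besselWeight_le_one {r : ℝ} (hr : r ≤ 0) (ξ : E n) : besselWeight r ξ ≤ 1 :=
  Real.rpow_le_one_of_one_le_of_nonpos (by nlinarith [sq_nonneg ‖ξ‖]) (by linarith)

theorem continuous_besselWeight (r : ℝ) : Continuous (besselWeight (n := n) r) :=
  (continuous_const.add (continuous_norm.pow 2)).rpow_const fun ξ => Or.inl
    (by positivity : 0 < 1 + ‖ξ‖ ^ 2).ne'

theorem besselWeight_neg_mul_rpow_le {s : ℝ} (hs : 0 ≤ s) (ξ : E n) :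
    besselWeight (-s) ξ * ‖ξ‖ ^ (2 * s) ≤ besselWeight s ξ := by
  have h1 : ‖ξ‖ ^ (2 * s) ≤ besselWeight s ξ * besselWeight s ξ := by
    rw [besselWeight, ← Real.rpow_add (by positivity), Real.rpow_mul (norm_nonneg _),
      add_halves, Real.rpow_two]
    exact Real.rpow_le_rpow (by positivity) (by linarith) hs
  calc besselWeight (-s) ξ * ‖ξ‖ ^ (2 * s)
      ≤ besselWeight (-s) ξ * (besselWeight s ξ * besselWeight s ξ) :=
        mul_le_mul_of_nonneg_left h1 (besselWeight_pos _ _).le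
    _ = besselWeight s ξ * besselWeight (-s) ξ * besselWeight s ξ := by ring
    _ = besselWeight s ξ := by rw [besselWeight_mul_besselWeight_neg, one_mul]

theorem memLp_besselWeight_mul {r : ℝ} (hr : r ≤ 0) {f : E n → ℂ}
    (hf : MemLp f 2 (volume : Measure (E n))) :
    MemLp (fun ξ => (besselWeight r ξ : ℂ) * f ξ) 2 (volume : Measure (E n)) := by
  refine hf.of_le (((Complex.continuous_ofReal.comp
    (continuous_besselWeight r)).aestronglyMeasurable).mul hf.1) (.of_forall fun ξ => ?_)
  rw [norm_mul, Complex.norm_real, Real.norm_of_nonneg (besselWeight_pos r ξ).le]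
  exact mul_le_of_le_one_left (norm_nonneg _) (besselWeight_le_one hr ξ)

theorem toTemperedDistribution_injective {f g : Lp ℂ 2 (volume : Measure (E n))}
    (h : (f : 𝓢'(E n, ℂ)) = (g : 𝓢'(E n, ℂ))) : f = g :=
  LinearMap.ker_eq_bot.1
    (Lp.ker_toTemperedDistributionCLM_eq_bot (F := ℂ) (μ := (volume : Measure (E n))) (p := 2)) h

theorem toTemperedDistribution_sub (f g : Lp ℂ 2 (volume : Measure (E n))) :
    ((f - g : Lp ℂ 2 (volume : Measure (E n))) : 𝓢'(E n, ℂ)) = (f : 𝓢'(E n, ℂ)) - g :=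
  map_sub (Lp.toTemperedDistributionCLM ℂ (volume : Measure (E n)) 2) f g

theorem toTemperedDistribution_smul (c : ℂ) (f : Lp ℂ 2 (volume : Measure (E n))) :
    ((c • f : Lp ℂ 2 (volume : Measure (E n))) : 𝓢'(E n, ℂ)) = c • (f : 𝓢'(E n, ℂ)) :=
  map_smul (Lp.toTemperedDistributionCLM ℂ (volume : Measure (E n)) 2) c f

theorem besselPotential_injective (r : ℝ) :
    Function.Injective (besselPotential (E n) ℂ r) := by
  intro F G h
  have := congrArg (besselPotential (E n) ℂ (-r)) h
  simpa using this

/-- The Fourier transform is injective on tempered distributions, and there the Bessel potential is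
multiplication by the weight. -/
theorem HasL2Fourier.besselPotential_toLp {r : ℝ} {f g fhat : E n → ℂ} (hf : HasL2Fourier f fhat)
    (hg : HasL2Fourier g fun ξ => (besselWeight r ξ : ℂ) * fhat ξ) :
    besselPotential (E n) ℂ r
        ((hf.memLp.toLp f : Lp ℂ 2 (volume : Measure (E n))) : 𝓢'(E n, ℂ))
      = ((hg.memLp.toLp g : Lp ℂ 2 (volume : Measure (E n))) : 𝓢'(E n, ℂ)) := by
  have hinj : Function.Injective (𝓕 : 𝓢'(E n, ℂ) → 𝓢'(E n, ℂ)) := fun F G h => by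
    have h' := congrArg (𝓕⁻ : 𝓢'(E n, ℂ) → 𝓢'(E n, ℂ)) h
    rwa [FourierTransform.fourierInv_fourier_eq, FourierTransform.fourierInv_fourier_eq] at h'
  apply hinj
  rw [fourier_besselPotential_eq_smulLeftCLM_fourier_apply, Lp.fourier_toTemperedDistribution_eq,
    Lp.fourier_toTemperedDistribution_eq, hf.fourier_toLp, hg.fourier_toLp]
  ext φ
  simp only [Lp.toTemperedDistribution_apply, smulLeftCLM_apply_apply]
  refine integral_congr_ae ?_
  filter_upwards [hf.memLp_hat.coeFn_toLp, hg.memLp_hat.coeFn_toLp] with ξ h1 h2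
  have h3 : (fun ξ : E n => (((1 + ‖ξ‖ ^ 2) ^ (r / 2) : ℝ) : ℂ)).HasTemperateGrowth := by fun_prop
  rw [h1, h2, SchwartzMap.smulLeftCLM_apply_apply h3]
  simp only [smul_eq_mul, besselWeight]
  ring

/-- Functions in `H^s` have a Fourier transform which is square integrable with weight. -/
theorem MemHs.exists_hasL2Fourier {s : ℝ} (hs : 0 ≤ s) {u : E n → ℝ} (hu : MemHs s u) :
    ∃ uhat : E n → ℂ, HasL2Fourier (fun x => (u x : ℂ)) uhat ∧
      MemLp (fun ξ => (besselWeight s ξ : ℂ) * uhat ξ) 2 (volume : Measure (E n)) := by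
  obtain ⟨hu2, f', hf'⟩ := hu
  obtain ⟨fhat, hfhat⟩ := NonlocalCalculus.exists_hasL2Fourier (Lp.memLp f')
  -- Here f' is the Bessel potential of order s of u. Dividing its transform by the weight, which is
  -- at least 1 as s ≥ 0, gives g in L²; injectivity of the Bessel potential identifies g with u.
  obtain ⟨g, hg⟩ := exists_hasL2Fourier_of_hat
    (memLp_besselWeight_mul (neg_nonpos.2 hs) hfhat.memLp_hat)
  have h1 := hfhat.besselPotential_toLp hg
  rw [Lp.toLp_coeFn, besselPotential_neg_apply_eq_iff] at h1
  have h2 := toTemperedDistribution_injective (besselPotential_injective s (h1.trans hf'.symm))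
  refine ⟨_, hg.congr_left ((MemLp.toLp_eq_toLp_iff _ _).1 h2), ?_⟩
  refine hfhat.memLp_hat.ae_eq (.of_forall fun ξ => ?_)
  simp only
  rw [← mul_assoc, ← Complex.ofReal_mul, besselWeight_mul_besselWeight_neg, Complex.ofReal_one,
    one_mul]

/-- The tempered distribution `F` is in `H^r`, and `W` represents its Fourier transform. -/
def HasSobolevFourier (r : ℝ) (F : 𝓢'(E n, ℂ)) (W : E n → ℂ) : Prop :=
  ∃ (g : E n → ℂ) (hg : HasL2Fourier g fun ξ => (besselWeight r ξ : ℂ) * W ξ),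
    besselPotential (E n) ℂ r F
      = ((hg.memLp.toLp g : Lp ℂ 2 (volume : Measure (E n))) : 𝓢'(E n, ℂ))

theorem exists_hasSobolevFourier {r : ℝ} {W : E n → ℂ}
    (hW : MemLp (fun ξ => (besselWeight r ξ : ℂ) * W ξ) 2 (volume : Measure (E n))) :
    ∃ F, HasSobolevFourier r F W := by
  obtain ⟨g, hg⟩ := exists_hasL2Fourier_of_hat hW
  exact ⟨besselPotential (E n) ℂ (-r) (hg.memLp.toLp g : Lp ℂ 2 (volume : Measure (E n))),
    g, hg, by simp⟩

theorem HasSobolevFourier.memSobolev {r : ℝ} {F : 𝓢'(E n, ℂ)} {W : E n → ℂ}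
    (h : HasSobolevFourier r F W) : MemSobolev r 2 F := by
  obtain ⟨g, hg, h⟩ := h
  exact ⟨_, h⟩

theorem HasSobolevFourier.smul {r : ℝ} {F : 𝓢'(E n, ℂ)} {W : E n → ℂ}
    (h : HasSobolevFourier r F W) (c : ℂ) : HasSobolevFourier r (c • F) fun ξ => c * W ξ := by
  obtain ⟨g, hg, h⟩ := h
  have hc : HasL2Fourier (fun x => c * g x) fun ξ => (besselWeight r ξ : ℂ) * (c * W ξ) :=
    (hg.const_mul c).congr_right (.of_forall fun ξ => by simp only; ring)
  refine ⟨_, hc, ?_⟩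
  rw [map_smul, h, ← toTemperedDistribution_smul]
  congr 1

/-- The difference of the two error terms does not depend on ε, being the Bessel potential of F - G;
it tends to zero, so it is zero. This makes the operators single-valued. -/
theorem TendstoSobolev.unique {r : ℝ} {f : ℝ → E n → ℝ} {F G : 𝓢'(E n, ℂ)}
    (hF : TendstoSobolev r f F) (hG : TendstoSobolev r f G) : F = G := by
  obtain ⟨hf, d, hd, hdlim⟩ := hF
  obtain ⟨hf', d', hd', hdlim'⟩ := hG
  have h1 : ∀ ε, 0 < ε → ((d' ε - d ε : Lp ℂ 2 (volume : Measure (E n))) : 𝓢'(E n, ℂ))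
      = besselPotential (E n) ℂ r (F - G) := by
    intro ε hε
    rw [toTemperedDistribution_sub, ← hd ε hε, ← hd' ε hε, ← map_sub]
    congr 1
    abel
  have h2 : ∀ ε, 0 < ε → d' ε - d ε = d' 1 - d 1 := fun ε hε =>
    toTemperedDistribution_injective ((h1 ε hε).trans (h1 1 one_pos).symm)
  have h3 : Tendsto (fun ε => d' ε - d ε) (𝓝[>] (0 : ℝ)) (𝓝 (d' 1 - d 1)) :=
    tendsto_const_nhds.congr' (eventually_mem_nhdsWithin.mono fun ε hε => (h2 ε hε).symm)
  have h4 := tendsto_nhds_unique h3 (hdlim'.sub hdlim)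
  have h5 := h1 1 one_pos
  rw [h4, sub_zero] at h5
  have h6 : besselPotential (E n) ℂ r (F - G) = besselPotential (E n) ℂ r 0 := by
    rw [← h5, map_zero]
    exact map_zero (Lp.toTemperedDistributionCLM ℂ (volume : Measure (E n)) 2)
  exact sub_eq_zero.1 (besselPotential_injective r h6)

/-- If the multipliers `m ε` are bounded by `M |ξ|^{2s}` and converge to `m₀` as `ε → 0+`, then
applying them to a function in `H^s` gives convergence in `H^{-s}`. -/
theorem HasSobolevFourier.tendstoSobolev {s : ℝ} (hs : 0 ≤ s) {uhat : E n → ℂ}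
    (huhat : MemLp (fun ξ => (besselWeight s ξ : ℂ) * uhat ξ) 2 (volume : Measure (E n)))
    {f : ℝ → E n → ℝ} {m : ℝ → E n → ℂ} {m₀ : E n → ℂ} {M : ℝ} (hM : 0 ≤ M)
    {F : 𝓢'(E n, ℂ)}
    (hf : ∀ ε, 0 < ε → HasL2Fourier (fun x => (f ε x : ℂ)) fun ξ => m ε ξ * uhat ξ)
    (hm : ∀ ε, 0 < ε → ∀ ξ, ‖m ε ξ‖ ≤ M * ‖ξ‖ ^ (2 * s))
    (hlim : ∀ ξ, Tendsto (fun ε => m ε ξ) (𝓝[>] 0) (𝓝 (m₀ ξ)))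
    (hF : HasSobolevFourier (-s) F fun ξ => m₀ ξ * uhat ξ) :
    TendstoSobolev (-s) f F := by
  obtain ⟨g, hg, hFg⟩ := hF
  have hm₀ : ∀ ξ, ‖m₀ ξ‖ ≤ M * ‖ξ‖ ^ (2 * s) := fun ξ =>
    le_of_tendsto (hlim ξ).norm (eventually_mem_nhdsWithin.mono fun ε hε => hm ε hε ξ)
  have hex : ∀ ε : ℝ, 0 < ε → ∃ h : E n → ℂ,
      HasL2Fourier h fun ξ => (besselWeight (-s) ξ : ℂ) * (m ε ξ * uhat ξ) := fun ε hε =>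
    exists_hasL2Fourier_of_hat (memLp_besselWeight_mul (neg_nonpos.2 hs) (hf ε hε).memLp_hat)
  choose! h hh using hex
  -- The value 0 for ε ≤ 0 is irrelevant, because the limit is taken from the right.
  refine ⟨fun ε hε => (hf ε hε).memLp, fun ε => if hε : 0 < ε then
    (hh ε hε).memLp.toLp (h ε) - hg.memLp.toLp g else 0, fun ε hε => ?_, ?_⟩
  · simp only [dif_pos hε]
    rw [map_sub, hFg, toTemperedDistribution_sub,
      (hf ε hε).besselPotential_toLp (hh ε hε)]
  have key : Tendsto (fun ε => eLpNorm (fun ξ =>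
      (besselWeight (-s) ξ : ℂ) * (m ε ξ * uhat ξ) - (besselWeight (-s) ξ : ℂ) * (m₀ ξ * uhat ξ))
      2 volume) (𝓝[>] 0) (𝓝 0) := by
    -- From (1+|ξ|²)^{-s/2} |ξ|^{2s} ≤ (1+|ξ|²)^{s/2}, each of the two terms is at most M times the
    -- weighted transform of u; hence the factor 2M.
    refine tendsto_eLpNorm_two_of_dominated
      (H := fun ξ => 2 * M * ‖(besselWeight s ξ : ℂ) * uhat ξ‖) ?_ (huhat.norm.const_mul _) ?_ ?_
    · filter_upwards [eventually_mem_nhdsWithin] with ε hε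
      exact ((hh ε hε).memLp_hat.sub hg.memLp_hat).1
    · filter_upwards [eventually_mem_nhdsWithin] with ε hε
      refine .of_forall fun ξ => ?_
      have hw := besselWeight_neg_mul_rpow_le hs ξ
      have hb : ∀ c : ℂ, ‖c‖ ≤ M * ‖ξ‖ ^ (2 * s) →
          ‖(besselWeight (-s) ξ : ℂ) * (c * uhat ξ)‖ ≤ M * ‖(besselWeight s ξ : ℂ) * uhat ξ‖ := by
        intro c hc
        rw [norm_mul, norm_mul, norm_mul, Complex.norm_real, Complex.norm_real,
          Real.norm_of_nonneg (besselWeight_pos _ ξ).le, Real.norm_of_nonneg (besselWeight_pos _ ξ).le]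
        calc besselWeight (-s) ξ * (‖c‖ * ‖uhat ξ‖)
            ≤ besselWeight (-s) ξ * (M * ‖ξ‖ ^ (2 * s) * ‖uhat ξ‖) := by
              have := (besselWeight_pos (-s) ξ).le
              gcongr
          _ = M * (besselWeight (-s) ξ * ‖ξ‖ ^ (2 * s) * ‖uhat ξ‖) := by ring
          _ ≤ M * (besselWeight s ξ * ‖uhat ξ‖) := by gcongr
      calc _ ≤ _ := norm_sub_le _ _
        _ ≤ _ := add_le_add (hb _ (hm ε hε ξ)) (hb _ (hm₀ ξ))
        _ = _ := by ring
    · refine .of_forall fun ξ => ?_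
      have h1 := (((hlim ξ).mul_const (uhat ξ)).const_mul (besselWeight (-s) ξ : ℂ)).sub_const
        ((besselWeight (-s) ξ : ℂ) * (m₀ ξ * uhat ξ))
      simpa using h1
  rw [tendsto_zero_iff_norm_tendsto_zero]
  have h1 := (ENNReal.tendsto_toReal ENNReal.zero_ne_top).comp key
  refine h1.congr' ?_
  filter_upwards [eventually_mem_nhdsWithin] with ε hε
  have hε' : 0 < ε := hε
  simp only [dif_pos hε', Function.comp_apply]
  rw [← MemLp.toLp_sub, Lp.norm_toLp]
  exact congrArg _ ((hh ε hε).sub hg).eLpNorm_eq.symm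

end Sobolev

/-! ### The weighted gradient and divergence as Fourier multipliers -/

section Operators

open scoped FourierTransform

variable {n : ℕ} {s ε : ℝ}

theorem norm_le_sum_norm_apply (v : E n) : ‖v‖ ≤ ∑ i, ‖v i‖ := by
  conv_lhs => rw [← (EuclideanSpace.basisFun (Fin n) ℝ).sum_repr v]
  refine (norm_sum_le _ _).trans_eq (Finset.sum_congr rfl fun i _ => ?_)
  simp [norm_smul]

theorem measurableSet_offBall (ε : ℝ) (x : E n) : MeasurableSet (offBall ε x) :=
  measurableSet_lt measurable_const (measurable_id.sub measurable_const).norm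

theorem indicator_offBall_comp_add {F : Type*} [Zero F] (ε : ℝ) (x : E n) (f : E n → F) :
    (fun w => (offBall ε x).indicator f (x + w))
      = {w : E n | ε < ‖w‖}.indicator fun w => f (x + w) := by
  ext w
  simp [Set.indicator, offBall]

theorem integral_offBall {F : Type*} [NormedAddCommGroup F] [NormedSpace ℝ F] (ε : ℝ) (x : E n)
    (f : E n → F) :
    ∫ y in offBall ε x, f y = ∫ w, {w : E n | ε < ‖w‖}.indicator (fun w => f (x + w)) w := by
  rw [← integral_indicator (measurableSet_offBall ε x), ← indicator_offBall_comp_add,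
    integral_add_left_eq_self]

theorem integrableOn_offBall_iff {F : Type*} [NormedAddCommGroup F] (x : E n) (f : E n → F) :
    IntegrableOn f (offBall ε x)
      ↔ Integrable ({w : E n | ε < ‖w‖}.indicator fun w => f (x + w)) := by
  rw [← integrable_indicator_iff (measurableSet_offBall ε x), ← indicator_offBall_comp_add]
  refine ⟨fun h => h.comp_add_left x, fun h => ?_⟩
  simpa using h.comp_add_left (-x)

theorem memLp_two_of_bounded {F : Type*} [NormedAddCommGroup F] {K : E n → F} (hK : Integrable K)
    {B : ℝ} (hB : ∀ w, ‖K w‖ ≤ B) : MemLp K 2 (volume : Measure (E n)) := by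
  rw [memLp_two_iff_integrable_sq_norm hK.1]
  refine (hK.norm.const_mul B).mono' (hK.1.norm.pow 2) (.of_forall fun w => ?_)
  rw [Real.norm_of_nonneg (by positivity), sq]
  exact mul_le_mul_of_nonneg_right (hB w) (norm_nonneg _)

theorem memLp_comp_add {F : Type*} [NormedAddCommGroup F] {f : E n → F}
    (hf : MemLp f 2 (volume : Measure (E n))) (x : E n) :
    MemLp (fun w => f (x + w)) 2 (volume : Measure (E n)) :=
  hf.comp_measurePreserving (measurePreserving_add_left volume x)

theorem memLp_of_ofReal {f : E n → ℝ} (hf : MemLp (fun x => (f x : ℂ)) 2 (volume : Measure (E n))) :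
    MemLp f 2 (volume : Measure (E n)) := by
  simpa using hf.re

theorem memLp_truncKernel (hn : 1 ≤ n) (hs0 : 0 < s) (hε : 0 < ε) :
    MemLp (truncKernel n s ε) 2 (volume : Measure (E n)) :=
  memLp_two_of_bounded (integrable_truncKernel hn hs0 hε) (norm_truncKernel_le hs0 hε)

/-- Correlation of real functions with a real kernel. -/
theorem HasL2Fourier.real_correlation {K u : E n → ℝ} {uhat : E n → ℂ}
    (hu : HasL2Fourier (fun x => (u x : ℂ)) uhat) (hK1 : Integrable K)
    (hK2 : MemLp K 2 (volume : Measure (E n))) :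
    HasL2Fourier (fun x => ((∫ w, K w * u (x + w) : ℝ) : ℂ))
      (fun ξ => 𝓕⁻ (fun w => (K w : ℂ)) ξ * uhat ξ) := by
  have h := hu.correlation hK1.ofReal (hK2.ofReal (K := ℂ))
  refine h.congr_left (.of_forall fun x => ?_)
  simp only
  rw [← integral_complex_ofReal]
  simp

theorem sinSymbol_apply (hn : 1 ≤ n) (hs0 : 0 < s) (hs1 : s < 1) (ξ : E n) (i : Fin n) :
    sinSymbol n s ε ξ i
      = ∫ w, Real.sin (2 * Real.pi * inner ℝ w ξ) * truncKernel n s ε w i := by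
  have h := eval_integral_piLp
    (fun i => (integrable_sin_smul_truncKernel (ε := ε) hn hs0 hs1 ξ).eval_piLp i) i
  simpa [sinSymbol] using h

theorem fourierInv_ofReal {K : E n → ℝ} (hK : Integrable K) (ξ : E n) :
    𝓕⁻ (fun w => (K w : ℂ)) ξ
      = ((∫ w, Real.cos (2 * Real.pi * inner ℝ w ξ) * K w : ℝ) : ℂ)
        + Complex.I * ((∫ w, Real.sin (2 * Real.pi * inner ℝ w ξ) * K w : ℝ) : ℂ) := by
  have hc : Integrable fun w => Real.cos (2 * Real.pi * inner ℝ w ξ) * K w :=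
    hK.bdd_mul (c := 1) (by fun_prop : Continuous fun w : E n =>
      Real.cos (2 * Real.pi * inner ℝ w ξ)).aestronglyMeasurable
      (.of_forall fun w => Real.abs_cos_le_one _)
  have hs : Integrable fun w => Real.sin (2 * Real.pi * inner ℝ w ξ) * K w :=
    hK.bdd_mul (c := 1) (by fun_prop : Continuous fun w : E n =>
      Real.sin (2 * Real.pi * inner ℝ w ξ)).aestronglyMeasurable
      (.of_forall fun w => Real.abs_sin_le_one _)
  rw [Real.fourierInv_eq, ← integral_complex_ofReal, ← integral_complex_ofReal,
    ← integral_const_mul, ← integral_add hc.ofReal (hs.ofReal.const_mul _)]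
  refine integral_congr_ae (.of_forall fun w => ?_)
  simp only
  rw [Circle.smul_def, Real.fourierChar_apply, Complex.exp_mul_I, ← Complex.ofReal_cos,
    ← Complex.ofReal_sin, smul_eq_mul]
  push_cast
  ring

/-- The cosine part vanishes because the kernel is odd. -/
theorem fourierInv_truncKernel (hn : 1 ≤ n) (hs0 : 0 < s) (hs1 : s < 1) (hε : 0 < ε) (ξ : E n)
    (i : Fin n) :
    𝓕⁻ (fun w => (truncKernel n s ε w i : ℂ)) ξ = Complex.I * (sinSymbol n s ε ξ i : ℂ) := by
  rw [fourierInv_ofReal ((integrable_truncKernel hn hs0 hε).eval_piLp i),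
    sinSymbol_apply hn hs0 hs1,
    integral_eq_zero_of_odd (f := fun w =>
      Real.cos (2 * Real.pi * inner ℝ w ξ) * truncKernel n s ε w i), Complex.ofReal_zero, zero_add]
  intro w
  simp [truncKernel_neg, inner_neg_left]

theorem HasL2Fourier.truncKernel_correlation (hn : 1 ≤ n) (hs0 : 0 < s) (hs1 : s < 1) (hε : 0 < ε)
    {u : E n → ℝ} {uhat : E n → ℂ} (hu : HasL2Fourier (fun x => (u x : ℂ)) uhat) (i : Fin n) :
    HasL2Fourier (fun x => ((∫ w, truncKernel n s ε w i * u (x + w) : ℝ) : ℂ))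
      (fun ξ => Complex.I * (sinSymbol n s ε ξ i : ℂ) * uhat ξ) := by
  have h := hu.real_correlation ((integrable_truncKernel hn hs0 hε).eval_piLp i)
    ((memLp_truncKernel hn hs0 hε).eval_piLp i)
  simpa only [fourierInv_truncKernel hn hs0 hs1 hε] using h

/-! #### The gradient -/

theorem indicator_gradIntegrand (u : E n → ℝ) (x : E n) :
    ({w : E n | ε < ‖w‖}.indicator fun w =>
        gradIntegrand (fracWeight n s) (fracKernel n) u x (x + w))
      = fun w => u (x + w) • truncKernel n s ε w - u x • truncKernel n s ε w := by
  ext1 w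
  have h : gradIntegrand (fracWeight n s) (fracKernel n) u x (x + w)
      = (u (x + w) - u x) • vecKernel n s w := by
    rw [gradIntegrand, mul_smul, fracWeight_smul_fracKernel, add_sub_cancel_left]
  rw [← sub_smul]
  by_cases hw : ε < ‖w‖
  · rw [Set.indicator_of_mem (by exact hw), truncKernel_of_lt hw, h]
  · rw [Set.indicator_of_notMem (by exact hw), truncKernel_of_not_lt hw, smul_zero]

theorem integrable_smul_truncKernel (hn : 1 ≤ n) (hs0 : 0 < s) (hε : 0 < ε) {u : E n → ℝ}
    (hu : MemLp u 2 (volume : Measure (E n))) (x : E n) :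
    Integrable fun w => u (x + w) • truncKernel n s ε w :=
  memLp_one_iff_integrable.1 ((memLp_truncKernel hn hs0 hε).smul (memLp_comp_add hu x))

theorem integrableOn_gradIntegrand (hn : 1 ≤ n) (hs0 : 0 < s) (hε : 0 < ε) {u : E n → ℝ}
    (hu : MemLp u 2 (volume : Measure (E n))) (x : E n) :
    IntegrableOn (gradIntegrand (fracWeight n s) (fracKernel n) u x) (offBall ε x) := by
  rw [integrableOn_offBall_iff, indicator_gradIntegrand]
  exact (integrable_smul_truncKernel hn hs0 hε hu x).sub
    ((integrable_truncKernel hn hs0 hε).fun_smul _)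

/-- The term with u(x) disappears because the truncated kernel has integral zero, so the truncated
gradient is a pure correlation. -/
theorem integral_gradIntegrand_apply (hn : 1 ≤ n) (hs0 : 0 < s) (hε : 0 < ε) {u : E n → ℝ}
    (hu : MemLp u 2 (volume : Measure (E n))) (x : E n) (i : Fin n) :
    (∫ y in offBall ε x, gradIntegrand (fracWeight n s) (fracKernel n) u x y) i
      = ∫ w, truncKernel n s ε w i * u (x + w) := by
  have h := integrable_smul_truncKernel hn hs0 hε hu x
  rw [integral_offBall, indicator_gradIntegrand,
    integral_sub h ((integrable_truncKernel hn hs0 hε).fun_smul _), integral_smul,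
    integral_truncKernel, smul_zero, sub_zero, eval_integral_piLp fun i => h.eval_piLp i]
  simp [mul_comm]

theorem hasL2Fourier_gradient (hn : 1 ≤ n) (hs0 : 0 < s) (hs1 : s < 1) (hε : 0 < ε)
    {u : E n → ℝ} {uhat : E n → ℂ} (hu : HasL2Fourier (fun x => (u x : ℂ)) uhat) (i : Fin n) :
    HasL2Fourier (fun x => (((∫ y in offBall ε x,
        gradIntegrand (fracWeight n s) (fracKernel n) u x y) i : ℝ) : ℂ))
      (fun ξ => Complex.I * (sinSymbol n s ε ξ i : ℂ) * uhat ξ) :=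
  (hu.truncKernel_correlation hn hs0 hs1 hε i).congr_left (.of_forall fun x => by
    simp only
    rw [integral_gradIntegrand_apply hn hs0 hε (memLp_of_ofReal hu.memLp)])

theorem rpow_le_besselWeight (hs0 : 0 < s) (ξ : E n) : ‖ξ‖ ^ s ≤ besselWeight s ξ := by
  have h : ‖ξ‖ ^ s = (‖ξ‖ ^ 2) ^ (s / 2) := by
    rw [← Real.rpow_two, ← Real.rpow_mul (norm_nonneg _)]
    ring_nf
  rw [h, besselWeight]
  exact Real.rpow_le_rpow (by positivity) (by linarith) (by positivity)

theorem norm_sinSymbol_apply_mul_le {M : ℝ} (hM0 : 0 ≤ M) (hs0 : 0 < s)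
    (hM : ∀ ε (ξ : E n), ‖sinSymbol n s ε ξ‖ ≤ M * ‖ξ‖ ^ s) (ξ : E n) (i : Fin n) (z : ℂ) :
    ‖Complex.I * (sinSymbol n s ε ξ i : ℂ) * z‖ ≤ M * ‖(besselWeight s ξ : ℂ) * z‖ := by
  rw [norm_mul, norm_mul, norm_mul, Complex.norm_I, one_mul, Complex.norm_real, Complex.norm_real,
    Real.norm_of_nonneg (besselWeight_pos s ξ).le, ← mul_assoc]
  refine mul_le_mul_of_nonneg_right ?_ (norm_nonneg _)
  calc ‖sinSymbol n s ε ξ i‖ ≤ ‖sinSymbol n s ε ξ‖ := PiLp.norm_apply_le _ _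
    _ ≤ M * ‖ξ‖ ^ s := hM ε ξ
    _ ≤ M * besselWeight s ξ := mul_le_mul_of_nonneg_left (rpow_le_besselWeight hs0 ξ) hM0

theorem memLp_sinSymbol_mul (hn : 1 ≤ n) (hs0 : 0 < s) (hs1 : s < 1) {uhat : E n → ℂ}
    (hm : AEStronglyMeasurable uhat (volume : Measure (E n)))
    (huhat : MemLp (fun ξ => (besselWeight s ξ : ℂ) * uhat ξ) 2 (volume : Measure (E n)))
    (i : Fin n) :
    MemLp (fun ξ => Complex.I * (sinSymbol n s ε ξ i : ℂ) * uhat ξ) 2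
      (volume : Measure (E n)) := by
  obtain ⟨M, hM0, hM⟩ := norm_sinSymbol_le (n := n) hn hs0 hs1
  refine (huhat.norm.const_mul M).of_le ?_ (.of_forall fun ξ =>
    (norm_sinSymbol_apply_mul_le hM0 hs0 hM ξ i _).trans (le_abs_self _))
  have h : Measurable fun ξ : E n => sinSymbol n s ε ξ i :=
    (EuclideanSpace.proj (𝕜 := ℝ) i).continuous.measurable.comp measurable_sinSymbol
  exact ((Complex.measurable_ofReal.comp h).const_mul _).aestronglyMeasurable.mul hm

theorem tendsto_sinSymbol_mul (hn : 1 ≤ n) (hs0 : 0 < s) (hs1 : s < 1) {uhat : E n → ℂ}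
    (hm : AEStronglyMeasurable uhat (volume : Measure (E n)))
    (huhat : MemLp (fun ξ => (besselWeight s ξ : ℂ) * uhat ξ) 2 (volume : Measure (E n)))
    (i : Fin n) :
    Tendsto (fun ε => eLpNorm (fun ξ => Complex.I * (sinSymbol n s ε ξ i : ℂ) * uhat ξ
      - Complex.I * (sinSymbol n s 0 ξ i : ℂ) * uhat ξ) 2 volume) (𝓝[>] 0) (𝓝 0) := by
  obtain ⟨M, hM0, hM⟩ := norm_sinSymbol_le (n := n) hn hs0 hs1
  refine tendsto_eLpNorm_two_of_dominated
    (H := fun ξ => 2 * M * ‖(besselWeight s ξ : ℂ) * uhat ξ‖) (.of_forall fun ε => ?_)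
    (huhat.norm.const_mul _) (.of_forall fun ε => .of_forall fun ξ => ?_) (.of_forall fun ξ => ?_)
  · exact ((memLp_sinSymbol_mul hn hs0 hs1 hm huhat i).sub
      (memLp_sinSymbol_mul hn hs0 hs1 hm huhat i)).1
  · refine (norm_sub_le _ _).trans ((add_le_add (norm_sinSymbol_apply_mul_le hM0 hs0 hM ξ i _)
      (norm_sinSymbol_apply_mul_le hM0 hs0 hM ξ i _)).trans_eq (by ring))
  · have h1 : Tendsto (fun ε => sinSymbol n s ε ξ i) (𝓝[>] 0) (𝓝 (sinSymbol n s 0 ξ i)) :=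
      ((EuclideanSpace.proj (𝕜 := ℝ) i).continuous.tendsto _).comp (tendsto_sinSymbol hn hs0 hs1 ξ)
    have h2 := (((Complex.continuous_ofReal.tendsto _).comp h1).const_mul Complex.I).mul_const
      (uhat ξ) |>.sub_const (Complex.I * (sinSymbol n s 0 ξ i : ℂ) * uhat ξ)
    simpa using h2

/-- Every weighted gradient has the expected Fourier transform. -/
theorem IsWeightedGradient.hasL2Fourier (hn : 1 ≤ n) (hs0 : 0 < s) (hs1 : s < 1)
    {u : E n → ℝ} {uhat : E n → ℂ} (hu : HasL2Fourier (fun x => (u x : ℂ)) uhat)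
    (huhat : MemLp (fun ξ => (besselWeight s ξ : ℂ) * uhat ξ) 2 (volume : Measure (E n)))
    {g : E n → E n} (hg : IsWeightedGradient (fracWeight n s) (fracKernel n) u g) (i : Fin n) :
    HasL2Fourier (fun x => (g x i : ℂ))
      (fun ξ => Complex.I * (sinSymbol n s 0 ξ i : ℂ) * uhat ξ) := by
  obtain ⟨hg2, -, -, hlim⟩ := hg
  refine HasL2Fourier.of_tendsto (l := 𝓝[>] (0 : ℝ)) (eventually_mem_nhdsWithin.mono fun ε hε =>
      hasL2Fourier_gradient hn hs0 hs1 hε hu i) ((hg2.eval_piLp i).ofReal (K := ℂ))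
    (memLp_sinSymbol_mul hn hs0 hs1 hu.memLp_hat.1 huhat i)
    (tendsto_sinSymbol_mul hn hs0 hs1 hu.memLp_hat.1 huhat i) ?_
  refine tendsto_of_tendsto_of_tendsto_of_le_of_le tendsto_const_nhds hlim (fun _ => zero_le)
    fun ε => eLpNorm_mono fun x => ?_
  rw [← Complex.ofReal_sub, Complex.norm_real]
  exact PiLp.norm_apply_le (_ - g x) i

/-- The weighted gradient of a function in `H^s` exists. -/
theorem exists_isWeightedGradient (hn : 1 ≤ n) (hs0 : 0 < s) (hs1 : s < 1)
    {u : E n → ℝ} {uhat : E n → ℂ} (hu : HasL2Fourier (fun x => (u x : ℂ)) uhat)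
    (huhat : MemLp (fun ξ => (besselWeight s ξ : ℂ) * uhat ξ) 2 (volume : Measure (E n))) :
    ∃ g, IsWeightedGradient (fracWeight n s) (fracKernel n) u g := by
  have hu2 := memLp_of_ofReal hu.memLp
  choose G hG using fun i : Fin n => exists_hasL2Fourier_of_hat
    (memLp_sinSymbol_mul (ε := 0) hn hs0 hs1 hu.memLp_hat.1 huhat i)
  have hmem : ∀ ε, 0 < ε → MemLp (fun x => ∫ y in offBall ε x,
      gradIntegrand (fracWeight n s) (fracKernel n) u x y) 2 (volume : Measure (E n)) :=
    fun ε hε => memLp_piLp_iff.2 fun i =>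
      memLp_of_ofReal (hasL2Fourier_gradient hn hs0 hs1 hε hu i).memLp
  have hg2 : MemLp (fun x => WithLp.toLp 2 fun i => (G i x).re : E n → E n) 2 volume :=
    memLp_piLp_iff.2 fun i => by simpa using (hG i).memLp.re
  -- The truncated gradients are real, so replacing the L² limits G i by their real parts does not
  -- increase the distance to them.
  refine ⟨fun x => WithLp.toLp 2 fun i => (G i x).re, hg2,
    fun ε hε => .of_forall fun x => integrableOn_gradIntegrand hn hs0 hε hu2 x, hmem, ?_⟩
  have hsum : Tendsto (fun ε => ∑ i, eLpNorm (fun ξ =>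
      Complex.I * (sinSymbol n s ε ξ i : ℂ) * uhat ξ
        - Complex.I * (sinSymbol n s 0 ξ i : ℂ) * uhat ξ) 2 volume)
      (𝓝[>] 0) (𝓝 (∑ _i : Fin n, 0)) :=
    tendsto_finsetSum _ fun i _ => tendsto_sinSymbol_mul hn hs0 hs1 hu.memLp_hat.1 huhat i
  rw [Finset.sum_const_zero] at hsum
  refine tendsto_of_tendsto_of_tendsto_of_le_of_le' tendsto_const_nhds hsum
    (.of_forall fun _ => zero_le) (eventually_mem_nhdsWithin.mono fun ε hε => ?_)
  have hd := fun i => (hasL2Fourier_gradient hn hs0 hs1 hε hu i).sub (hG i)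
  calc _ ≤ eLpNorm (∑ i, fun x => ‖(((∫ y in offBall ε x,
        gradIntegrand (fracWeight n s) (fracKernel n) u x y) i : ℝ) : ℂ) - G i x‖) 2
        (volume : Measure (E n)) := by
        refine eLpNorm_mono_real fun x => ?_
        rw [Finset.sum_apply]
        refine (norm_le_sum_norm_apply _).trans (Finset.sum_le_sum fun i _ => ?_)
        have h := Complex.abs_re_le_norm ((((∫ y in offBall ε x,
          gradIntegrand (fracWeight n s) (fracKernel n) u x y) i : ℝ) : ℂ) - G i x)
        rw [Complex.sub_re, Complex.ofReal_re] at h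
        exact h
    _ ≤ ∑ i, eLpNorm (fun x => ‖(((∫ y in offBall ε x,
        gradIntegrand (fracWeight n s) (fracKernel n) u x y) i : ℝ) : ℂ) - G i x‖) 2
        (volume : Measure (E n)) := eLpNorm_sum_le (fun i _ => (hd i).memLp.1.norm) one_le_two
    _ = _ := Finset.sum_congr rfl fun i _ => by rw [eLpNorm_norm, (hd i).eLpNorm_eq]

/-! #### The divergence -/

/-- The weight is symmetric, so the integrand is (g(x) + g(x+w))·k(w). -/
theorem indicator_divIntegrand (g : E n → E n) (x : E n) :
    ({w : E n | ε < ‖w‖}.indicator fun w =>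
        divIntegrand (fracWeight n s) (fracKernel n) g x (x + w))
      = fun w => ∑ i, (g x i * truncKernel n s ε w i + truncKernel n s ε w i * g (x + w) i) := by
  ext1 w
  have hsymm : fracWeight n s (x + w) x = fracWeight n s x (x + w) := by
    rw [fracWeight, fracWeight, norm_sub_rev]
  have h : divIntegrand (fracWeight n s) (fracKernel n) g x (x + w)
      = inner ℝ (g x + g (x + w)) (vecKernel n s w) := by
    rw [divIntegrand, hsymm, ← smul_add, real_inner_smul_left, ← real_inner_smul_right,
      fracWeight_smul_fracKernel, add_sub_cancel_left]
  by_cases hw : ε < ‖w‖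
  · rw [Set.indicator_of_mem (by exact hw), truncKernel_of_lt hw, h, PiLp.inner_apply]
    refine Finset.sum_congr rfl fun i _ => ?_
    simp
    ring
  · rw [Set.indicator_of_notMem (by exact hw), truncKernel_of_not_lt hw]
    simp

theorem integrable_divTerm (hn : 1 ≤ n) (hs0 : 0 < s) (hε : 0 < ε) {g : E n → E n}
    (hg : MemLp g 2 (volume : Measure (E n))) (x : E n) (i : Fin n) :
    Integrable fun w => truncKernel n s ε w i * g (x + w) i :=
  ((memLp_truncKernel hn hs0 hε).eval_piLp i).integrable_mul
    (memLp_comp_add (hg.eval_piLp i) x)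

theorem integrableOn_divIntegrand (hn : 1 ≤ n) (hs0 : 0 < s) (hε : 0 < ε) {g : E n → E n}
    (hg : MemLp g 2 (volume : Measure (E n))) (x : E n) :
    IntegrableOn (divIntegrand (fracWeight n s) (fracKernel n) g x) (offBall ε x) := by
  rw [integrableOn_offBall_iff, indicator_divIntegrand]
  exact integrable_finsetSum _ fun i _ =>
    (((integrable_truncKernel hn hs0 hε).eval_piLp i).const_mul _).add
      (integrable_divTerm hn hs0 hε hg x i)

theorem integral_divIntegrand (hn : 1 ≤ n) (hs0 : 0 < s) (hε : 0 < ε) {g : E n → E n}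
    (hg : MemLp g 2 (volume : Measure (E n))) (x : E n) :
    ∫ y in offBall ε x, divIntegrand (fracWeight n s) (fracKernel n) g x y
      = ∑ i, ∫ w, truncKernel n s ε w i * g (x + w) i := by
  have hk := fun i => (integrable_truncKernel hn hs0 hε).eval_piLp i
  rw [integral_offBall, indicator_divIntegrand]
  beta_reduce
  rw [integral_finsetSum _ fun i _ =>
    ((hk i).const_mul (g x i)).fun_add (integrable_divTerm hn hs0 hε hg x i)]
  refine Finset.sum_congr rfl fun i _ => ?_
  rw [integral_add ((hk i).const_mul (g x i)) (integrable_divTerm hn hs0 hε hg x i),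
    integral_const_mul, ← eval_integral_piLp hk, integral_truncKernel]
  simp

/-- Only the divergence is truncated here; the gradient is already the limit. The symbols i V_ε and
i V_0 multiply to -V_ε·V_0. -/
theorem hasL2Fourier_divergence (hn : 1 ≤ n) (hs0 : 0 < s) (hs1 : s < 1) (hε : 0 < ε)
    {g : E n → E n} (hg : MemLp g 2 (volume : Measure (E n))) {uhat : E n → ℂ}
    (hgi : ∀ i, HasL2Fourier (fun x => (g x i : ℂ))
      (fun ξ => Complex.I * (sinSymbol n s 0 ξ i : ℂ) * uhat ξ)) :
    HasL2Fourier (fun x => ((∫ y in offBall ε x,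
        divIntegrand (fracWeight n s) (fracKernel n) g x y : ℝ) : ℂ))
      (fun ξ => ((-inner ℝ (sinSymbol n s ε ξ) (sinSymbol n s 0 ξ) : ℝ) : ℂ) * uhat ξ) := by
  have h := HasL2Fourier.sum Finset.univ fun i _ =>
    (hgi i).truncKernel_correlation hn hs0 hs1 hε i
  refine (h.congr_left (.of_forall fun x => ?_)).congr_right (.of_forall fun ξ => ?_)
  · simp only
    rw [integral_divIntegrand hn hs0 hε hg, Complex.ofReal_sum]
  · simp only [PiLp.inner_apply, RCLike.inner_apply, conj_trivial]
    push_cast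
    rw [neg_mul, Finset.sum_mul, ← Finset.sum_neg_distrib]
    refine Finset.sum_congr rfl fun i _ => ?_
    linear_combination (sinSymbol n s ε ξ i : ℂ) * (sinSymbol n s 0 ξ i : ℂ) * uhat ξ * Complex.I_sq

end Operators

/-! ### The fractional Laplacian as a Fourier multiplier -/

section FractionalLaplacian

open scoped FourierTransform

variable {n : ℕ} {s ε : ℝ}

/-- The truncated kernel of the fractional Laplacian. -/
noncomputable def lapKernel (n : ℕ) (s ε : ℝ) : E n → ℝ :=
  {w : E n | ε < ‖w‖}.indicator fun w => ‖w‖ ^ (-((n : ℝ) + 2 * s))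

/-- The symbol of the truncated fractional Laplacian. -/
noncomputable def lapSymbol (n : ℕ) (s ε : ℝ) (ξ : E n) : ℝ :=
  fracLapConst n s * ∫ w, (1 - Real.cos (2 * Real.pi * inner ℝ w ξ)) * lapKernel n s ε w

theorem lapKernel_nonneg (w : E n) : 0 ≤ lapKernel n s ε w :=
  Set.indicator_nonneg (fun _ _ => by positivity) _

theorem lapKernel_le (w : E n) : lapKernel n s ε w ≤ ‖w‖ ^ (-((n : ℝ) + 2 * s)) :=
  Set.indicator_le_self' (fun _ _ => by positivity) _

theorem lapKernel_neg (w : E n) : lapKernel n s ε (-w) = lapKernel n s ε w := by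
  simp [lapKernel, Set.indicator]

theorem integrable_lapKernel (hn : 1 ≤ n) (hs0 : 0 < s) (hε : 0 < ε) :
    Integrable (lapKernel n s ε) :=
  integrable_norm_rpow_indicator hn (by positivity) hε

theorem memLp_lapKernel (hn : 1 ≤ n) (hs0 : 0 < s) (hε : 0 < ε) :
    MemLp (lapKernel n s ε) 2 (volume : Measure (E n)) := by
  refine memLp_two_of_bounded (integrable_lapKernel hn hs0 hε)
    (B := ε ^ (-((n : ℝ) + 2 * s))) fun w => ?_
  rw [Real.norm_of_nonneg (lapKernel_nonneg w), lapKernel]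
  refine Set.indicator_apply_le' (fun hw => ?_) fun _ => by positivity
  exact Real.rpow_le_rpow_of_nonpos hε (le_of_lt hw) (by linarith [Nat.cast_nonneg (α := ℝ) n])

theorem integrable_one_sub_cos (hn : 1 ≤ n) (hs0 : 0 < s) (hs1 : s < 1) (ξ : E n) :
    Integrable fun w : E n =>
      (1 - Real.cos (2 * Real.pi * inner ℝ w ξ)) * ‖w‖ ^ (-((n : ℝ) + 2 * s)) := by
  have h := integrable_one_sub_cos_mul (V := E n) (by simp; omega) hs0 hs1 ξ
  simpa only [finrank_euclideanSpace_fin] using h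

theorem one_sub_cos_nonneg (t : ℝ) : 0 ≤ 1 - Real.cos t := sub_nonneg.2 (Real.cos_le_one t)

theorem integrable_one_sub_cos_mul_lapKernel (hn : 1 ≤ n) (hs0 : 0 < s) (hε : 0 < ε) (ξ : E n) :
    Integrable fun w : E n =>
      (1 - Real.cos (2 * Real.pi * inner ℝ w ξ)) * lapKernel n s ε w := by
  refine (integrable_lapKernel hn hs0 hε).bdd_mul (c := 2) (by fun_prop : Continuous fun w : E n =>
      1 - Real.cos (2 * Real.pi * inner ℝ w ξ)).aestronglyMeasurable (.of_forall fun w => ?_)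
  rw [Real.norm_of_nonneg (one_sub_cos_nonneg _)]
  linarith [Real.neg_one_le_cos (2 * Real.pi * inner ℝ w ξ)]

theorem fracLapConst_mul_integral (hn : 1 ≤ n) (hs0 : 0 < s) (hs1 : s < 1) (ξ : E n) :
    fracLapConst n s * ∫ w : E n, (1 - Real.cos (2 * Real.pi * inner ℝ w ξ))
      * ‖w‖ ^ (-((n : ℝ) + 2 * s)) = (2 * Real.pi * ‖ξ‖) ^ (2 * s) := by
  have h := fracLapConst_mul_integral_one_sub_cos (V := E n) (by simp; omega) hs0 hs1 ξ
  simpa only [finrank_euclideanSpace_fin] using h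

theorem lapSymbol_nonneg (hs0 : 0 < s) (hs1 : s < 1) (ξ : E n) : 0 ≤ lapSymbol n s ε ξ :=
  mul_nonneg (fracLapConst_pos hs0 hs1).le (integral_nonneg fun _ =>
    mul_nonneg (one_sub_cos_nonneg _) (lapKernel_nonneg _))

theorem lapSymbol_le (hn : 1 ≤ n) (hs0 : 0 < s) (hs1 : s < 1) (hε : 0 < ε) (ξ : E n) :
    lapSymbol n s ε ξ ≤ (2 * Real.pi * ‖ξ‖) ^ (2 * s) := by
  rw [← fracLapConst_mul_integral hn hs0 hs1]
  exact mul_le_mul_of_nonneg_left (integral_mono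
    (integrable_one_sub_cos_mul_lapKernel hn hs0 hε ξ) (integrable_one_sub_cos hn hs0 hs1 ξ)
    fun w => mul_le_mul_of_nonneg_left (lapKernel_le w) (one_sub_cos_nonneg _))
    (fracLapConst_pos hs0 hs1).le

theorem tendsto_lapSymbol (hn : 1 ≤ n) (hs0 : 0 < s) (hs1 : s < 1) (ξ : E n) :
    Tendsto (fun ε => lapSymbol n s ε ξ) (𝓝[>] 0) (𝓝 ((2 * Real.pi * ‖ξ‖) ^ (2 * s))) := by
  rw [← fracLapConst_mul_integral hn hs0 hs1]
  refine Tendsto.const_mul _ (tendsto_integral_filter_of_dominated_convergence _ ?_ ?_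
    (integrable_one_sub_cos hn hs0 hs1 ξ) (.of_forall fun w => ?_))
  · exact eventually_mem_nhdsWithin.mono fun ε hε =>
      (integrable_one_sub_cos_mul_lapKernel hn hs0 hε ξ).1
  · refine .of_forall fun ε => .of_forall fun w => ?_
    rw [Real.norm_of_nonneg (mul_nonneg (one_sub_cos_nonneg _) (lapKernel_nonneg _))]
    exact mul_le_mul_of_nonneg_left (lapKernel_le w) (one_sub_cos_nonneg _)
  · rcases eq_or_ne w 0 with rfl | hw
    · simp
    · refine tendsto_const_nhds.congr' ?_
      filter_upwards [Ioo_mem_nhdsGT (norm_pos_iff.2 hw)] with ε hε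
      rw [lapKernel, Set.indicator_of_mem (by exact hε.2)]

theorem fourierInv_lapKernel (hn : 1 ≤ n) (hs0 : 0 < s) (hε : 0 < ε) (ξ : E n) :
    𝓕⁻ (fun w => (lapKernel n s ε w : ℂ)) ξ
      = ((∫ w, Real.cos (2 * Real.pi * inner ℝ w ξ) * lapKernel n s ε w : ℝ) : ℂ) := by
  rw [fourierInv_ofReal (integrable_lapKernel hn hs0 hε), integral_eq_zero_of_odd (f := fun w =>
      Real.sin (2 * Real.pi * inner ℝ w ξ) * lapKernel n s ε w), Complex.ofReal_zero, mul_zero,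
    add_zero]
  intro w
  simp [lapKernel_neg, inner_neg_left]

theorem indicator_fracLapIntegrand (u : E n → ℝ) (x : E n) :
    ({w : E n | ε < ‖w‖}.indicator fun w => fracLapIntegrand s u x (x + w))
      = fun w => fracLapConst n s * (lapKernel n s ε w * u x - lapKernel n s ε w * u (x + w)) := by
  ext1 w
  by_cases hw : ε < ‖w‖
  · rw [lapKernel, Set.indicator_of_mem (by exact hw), Set.indicator_of_mem (by exact hw),
      fracLapIntegrand, sub_add_cancel_left, norm_neg, Real.rpow_neg (norm_nonneg _)]
    ring
  · rw [lapKernel, Set.indicator_of_notMem (by exact hw), Set.indicator_of_notMem (by exact hw)]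
    ring

theorem integrable_lapKernel_mul (hn : 1 ≤ n) (hs0 : 0 < s) (hε : 0 < ε) {u : E n → ℝ}
    (hu : MemLp u 2 (volume : Measure (E n))) (x : E n) :
    Integrable fun w => lapKernel n s ε w * u (x + w) :=
  (memLp_lapKernel hn hs0 hε).integrable_mul (memLp_comp_add hu x)

theorem integrableOn_fracLapIntegrand (hn : 1 ≤ n) (hs0 : 0 < s) (hε : 0 < ε) {u : E n → ℝ}
    (hu : MemLp u 2 (volume : Measure (E n))) (x : E n) :
    IntegrableOn (fracLapIntegrand s u x) (offBall ε x) := by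
  rw [integrableOn_offBall_iff, indicator_fracLapIntegrand]
  exact (((integrable_lapKernel hn hs0 hε).mul_const _).sub
    (integrable_lapKernel_mul hn hs0 hε hu x)).const_mul _

theorem integral_fracLapIntegrand (hn : 1 ≤ n) (hs0 : 0 < s) (hε : 0 < ε) {u : E n → ℝ}
    (hu : MemLp u 2 (volume : Measure (E n))) (x : E n) :
    ∫ y in offBall ε x, fracLapIntegrand s u x y
      = fracLapConst n s * ((∫ w, lapKernel n s ε w) * u x
        - ∫ w, lapKernel n s ε w * u (x + w)) := by
  rw [integral_offBall, indicator_fracLapIntegrand]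
  beta_reduce
  rw [integral_const_mul, integral_sub ((integrable_lapKernel hn hs0 hε).mul_const _)
    (integrable_lapKernel_mul hn hs0 hε hu x), integral_mul_const]

/-- The truncated kernel is integrable, so u(x) and u(y) may be separated; the symbol is the total
mass minus the cosine transform. -/
theorem hasL2Fourier_fracLap (hn : 1 ≤ n) (hs0 : 0 < s) (hε : 0 < ε)
    {u : E n → ℝ} {uhat : E n → ℂ} (hu : HasL2Fourier (fun x => (u x : ℂ)) uhat) :
    HasL2Fourier (fun x => ((∫ y in offBall ε x, fracLapIntegrand s u x y : ℝ) : ℂ))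
      (fun ξ => (lapSymbol n s ε ξ : ℂ) * uhat ξ) := by
  have h := ((hu.const_mul ((∫ w, lapKernel n s ε w : ℝ) : ℂ)).sub
    (hu.real_correlation (integrable_lapKernel hn hs0 hε)
      (memLp_lapKernel hn hs0 hε))).const_mul (fracLapConst n s : ℂ)
  refine (h.congr_left (.of_forall fun x => ?_)).congr_right (.of_forall fun ξ => ?_)
  · simp only
    rw [integral_fracLapIntegrand hn hs0 hε (memLp_of_ofReal hu.memLp)]
    push_cast
    ring
  · simp only
    have hk := integrable_lapKernel (n := n) (s := s) (ε := ε) hn hs0 hε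
    have hsub : ∫ w, (1 - Real.cos (2 * Real.pi * inner ℝ w ξ)) * lapKernel n s ε w
        = (∫ w, lapKernel n s ε w)
          - ∫ w, Real.cos (2 * Real.pi * inner ℝ w ξ) * lapKernel n s ε w := by
      rw [← integral_sub hk]
      · simp only [sub_mul, one_mul]
      · have h1 := hk.sub (integrable_one_sub_cos_mul_lapKernel hn hs0 hε ξ)
        refine h1.congr (.of_forall fun w => ?_)
        simp only [Pi.sub_apply]
        ring
    rw [fourierInv_lapKernel hn hs0 hε, lapSymbol, hsub]
    push_cast
    ring

theorem memLp_laplacian_hat (hs0 : 0 < s) {uhat : E n → ℂ}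
    (hm : AEStronglyMeasurable uhat (volume : Measure (E n)))
    (huhat : MemLp (fun ξ => (besselWeight s ξ : ℂ) * uhat ξ) 2 (volume : Measure (E n))) :
    MemLp (fun ξ => (besselWeight (-s) ξ : ℂ)
      * ((((2 * Real.pi * ‖ξ‖) ^ (2 * s) : ℝ) : ℂ) * uhat ξ)) 2 (volume : Measure (E n)) := by
  refine (huhat.norm.const_mul ((2 * Real.pi) ^ (2 * s))).of_le ?_ (.of_forall fun ξ => ?_)
  · refine ((Complex.continuous_ofReal.comp (continuous_besselWeight _)).aestronglyMeasurable).mul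
      (AEStronglyMeasurable.mul ?_ hm)
    exact (Complex.continuous_ofReal.comp ((continuous_const.mul continuous_norm).rpow_const
      fun ξ => Or.inr (by positivity))).aestronglyMeasurable
  · have hw := besselWeight_neg_mul_rpow_le hs0.le ξ
    rw [Real.mul_rpow Real.two_pi_pos.le (norm_nonneg _), norm_mul, norm_mul, norm_mul, norm_norm,
      norm_mul, Complex.norm_real, Complex.norm_real, Complex.norm_real,
      Real.norm_of_nonneg (besselWeight_pos _ ξ).le, Real.norm_of_nonneg (besselWeight_pos _ ξ).le,
      Real.norm_of_nonneg (by positivity), Real.norm_of_nonneg (by positivity)]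
    calc besselWeight (-s) ξ * ((2 * Real.pi) ^ (2 * s) * ‖ξ‖ ^ (2 * s) * ‖uhat ξ‖)
        = (2 * Real.pi) ^ (2 * s) * (besselWeight (-s) ξ * ‖ξ‖ ^ (2 * s) * ‖uhat ξ‖) := by ring
      _ ≤ _ := by gcongr

end FractionalLaplacian

/-! ### Identification of the operators -/

section Identification

variable {n : ℕ} {s : ℝ}

theorem IsPVIntegral.unique {k : E n → E n → ℝ} {F G : 𝓢'(E n, ℂ)} (hF : IsPVIntegral s k F)
    (hG : IsPVIntegral s k G) : F = G :=
  hF.2.unique hG.2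

theorem two_pi_mul_norm_rpow (ξ : E n) :
    (2 * Real.pi * ‖ξ‖) ^ (2 * s) = ((2 * Real.pi) ^ s) ^ 2 * ‖ξ‖ ^ (2 * s) := by
  rw [Real.mul_rpow Real.two_pi_pos.le (norm_nonneg _), mul_comm 2 s,
    Real.rpow_mul Real.two_pi_pos.le, Real.rpow_two]

variable {u : E n → ℝ} {uhat : E n → ℂ} {F : 𝓢'(E n, ℂ)}

theorem isFracLaplacian (hn : 1 ≤ n) (hs0 : 0 < s) (hs1 : s < 1)
    (hu : HasL2Fourier (fun x => (u x : ℂ)) uhat)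
    (huhat : MemLp (fun ξ => (besselWeight s ξ : ℂ) * uhat ξ) 2 (volume : Measure (E n)))
    (hF : HasSobolevFourier (-s) F
      fun ξ => (((2 * Real.pi * ‖ξ‖) ^ (2 * s) : ℝ) : ℂ) * uhat ξ) :
    IsFracLaplacian s u F := by
  refine ⟨fun ε hε => .of_forall fun x =>
    integrableOn_fracLapIntegrand hn hs0 hε (memLp_of_ofReal hu.memLp) x, ?_⟩
  refine HasSobolevFourier.tendstoSobolev hs0.le huhat
    (M := ((2 * Real.pi) ^ s) ^ 2) (by positivity)
    (fun ε hε => hasL2Fourier_fracLap hn hs0 hε hu) (fun ε hε ξ => ?_)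
    (fun ξ => (Complex.continuous_ofReal.tendsto _).comp (tendsto_lapSymbol hn hs0 hs1 ξ)) hF
  rw [Complex.norm_real, Real.norm_of_nonneg (lapSymbol_nonneg hs0 hs1 ξ),
    ← two_pi_mul_norm_rpow]
  exact lapSymbol_le hn hs0 hs1 hε ξ

/-- A kernel which is a constant multiple of the fractional kernel gives a multiple of the
fractional Laplacian. -/
theorem isUnweightedLaplacian (hn : 1 ≤ n) (hs0 : 0 < s) (hs1 : s < 1) {γ : E n → E n → ℝ} {c : ℝ}
    (hγ : ∀ x y : E n, x ≠ y → 2 * γ x y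
      = -(fracLapConst n s * c) * (1 / ‖x - y‖ ^ ((n : ℝ) + 2 * s)))
    (hu : HasL2Fourier (fun x => (u x : ℂ)) uhat)
    (huhat : MemLp (fun ξ => (besselWeight s ξ : ℂ) * uhat ξ) 2 (volume : Measure (E n)))
    (hF : HasSobolevFourier (-s) F
      fun ξ => (((2 * Real.pi * ‖ξ‖) ^ (2 * s) : ℝ) : ℂ) * uhat ξ) :
    IsUnweightedLaplacian s γ u ((c : ℂ) • F) := by
  have heq : ∀ x : E n, lapIntegrand γ u x = fun y => c * fracLapIntegrand s u x y := by
    intro x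
    ext1 y
    rw [lapIntegrand, fracLapIntegrand]
    -- On the diagonal u(y) - u(x) = 0, so the unspecified value γ(x,x) plays no role.
    rcases eq_or_ne x y with rfl | hxy
    · simp
    · linear_combination (u y - u x) * hγ x y hxy
  refine ⟨fun ε hε => .of_forall fun x => ?_, ?_⟩
  · rw [heq]
    exact (integrableOn_fracLapIntegrand hn hs0 hε (memLp_of_ofReal hu.memLp) x).const_mul c
  simp_rw [heq, integral_const_mul]
  have hF' := hF.smul (c : ℂ)
  simp_rw [← mul_assoc] at hF'
  refine HasSobolevFourier.tendstoSobolev hs0.le huhat (m := fun ε ξ => (c : ℂ) * lapSymbol n s ε ξ)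
    (M := |c| * ((2 * Real.pi) ^ s) ^ 2) (by positivity)
    (fun ε hε => ?_) (fun ε hε ξ => ?_) (fun ξ => ((Complex.continuous_ofReal.tendsto _).comp
      (tendsto_lapSymbol hn hs0 hs1 ξ)).const_mul _) hF'
  · have h := (hasL2Fourier_fracLap hn hs0 hε hu).const_mul (c : ℂ)
    simpa only [Complex.ofReal_mul, mul_assoc] using h
  · rw [norm_mul, Complex.norm_real, Complex.norm_real,
      Real.norm_of_nonneg (lapSymbol_nonneg hs0 hs1 ξ), mul_assoc, ← two_pi_mul_norm_rpow]
    exact mul_le_mul_of_nonneg_left (lapSymbol_le hn hs0 hs1 hε ξ) (abs_nonneg _)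

/-- The divergence of any weighted gradient is the expected multiple of the fractional
Laplacian. -/
theorem IsWeightedGradient.isWeightedDivergence (hn : 1 ≤ n) (hs0 : 0 < s) (hs1 : s < 1)
    {e : E n} (he : ‖e‖ = 1) {g : E n → E n}
    (hg : IsWeightedGradient (fracWeight n s) (fracKernel n) u g)
    (hu : HasL2Fourier (fun x => (u x : ℂ)) uhat)
    (huhat : MemLp (fun ξ => (besselWeight s ξ : ℂ) * uhat ξ) 2 (volume : Measure (E n)))
    (hF : HasSobolevFourier (-s) F
      fun ξ => (((2 * Real.pi * ‖ξ‖) ^ (2 * s) : ℝ) : ℂ) * uhat ξ) :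
    IsWeightedDivergence s (fracWeight n s) (fracKernel n) g
      (((-(‖sinSymbol n s 0 e‖ / (2 * Real.pi) ^ s) ^ 2 : ℝ) : ℂ) • F) := by
  obtain ⟨M, hM0, hM⟩ := norm_sinSymbol_le (n := n) hn hs0 hs1
  have hpow : ∀ ξ : E n, ‖ξ‖ ^ s * ‖ξ‖ ^ s = ‖ξ‖ ^ (2 * s) := fun ξ => by
    rw [mul_comm 2 s, Real.rpow_mul (norm_nonneg _), Real.rpow_two, sq]
  refine ⟨fun ε hε => .of_forall fun x => integrableOn_divIntegrand hn hs0 hε hg.1 x, ?_⟩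
  have hF' := hF.smul ((-(‖sinSymbol n s 0 e‖ / (2 * Real.pi) ^ s) ^ 2 : ℝ) : ℂ)
  simp_rw [← mul_assoc] at hF'
  refine HasSobolevFourier.tendstoSobolev hs0.le huhat (M := M * M) (by positivity)
    (fun ε hε => hasL2Fourier_divergence hn hs0 hs1 hε hg.1
      (hg.hasL2Fourier hn hs0 hs1 hu huhat)) (fun ε hε ξ => ?_) (fun ξ => ?_) hF'
  · rw [Complex.norm_real, norm_neg]
    calc _ ≤ ‖sinSymbol n s ε ξ‖ * ‖sinSymbol n s 0 ξ‖ := norm_inner_le_norm _ _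
      _ ≤ (M * ‖ξ‖ ^ s) * (M * ‖ξ‖ ^ s) :=
        mul_le_mul (hM ε ξ) (hM 0 ξ) (norm_nonneg _) (by positivity)
      _ = _ := by rw [← hpow]; ring
  · have h1 := (((tendsto_sinSymbol hn hs0 hs1 ξ).inner
      (tendsto_const_nhds (x := sinSymbol n s 0 ξ)) (𝕜 := ℝ)).neg)
    have h2 := (Complex.continuous_ofReal.tendsto _).comp h1
    -- The frequencies carry a factor 2π in this Fourier convention, hence the division by (2π)^s.
    have h3 : -inner ℝ (sinSymbol n s 0 ξ) (sinSymbol n s 0 ξ)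
        = -(‖sinSymbol n s 0 e‖ / (2 * Real.pi) ^ s) ^ 2 * (2 * Real.pi * ‖ξ‖) ^ (2 * s) := by
      have : (2 * Real.pi) ^ s ≠ 0 := (Real.rpow_pos_of_pos Real.two_pi_pos s).ne'
      rw [real_inner_self_eq_norm_sq, norm_sinSymbol_zero hs0 he ξ, two_pi_mul_norm_rpow, ← hpow]
      field_simp
    rw [h3, Complex.ofReal_mul] at h2
    exact h2

end Identification

end NonlocalCalculus

theorem corollary4p5 (n : ℕ) (hn : 1 ≤ n) (s : ℝ) (hs0 : 0 < s) (hs1 : s < 1) :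
    (∀ x y : E n, fracWeight n s x y • fracKernel n x y
      = ‖y - x‖ ^ (-((n : ℝ) + s + 1)) • (y - x)) ∧
    ∃ D : ℝ, IsSphereConst n s D ∧
      -- the equivalence kernel: its principal value integral exists and is evaluated
      (∀ x y : E n, x ≠ y →
        (∀ ε : ℝ, 0 < ε → IntegrableOn
          (equivIntegrand (fracWeight n s) (fracKernel n) x y) (awayFrom ε x y)) ∧
        Tendsto (fun ε : ℝ => ∫ z in awayFrom ε x y,
            equivIntegrand (fracWeight n s) (fracKernel n) x y z)
          (𝓝[>] 0) (𝓝 (2 * equivKernel (fracWeight n s) (fracKernel n) x y)) ∧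
        2 * equivKernel (fracWeight n s) (fracKernel n) x y
          = -(fracLapConst n s * D / dirConst s ^ 2) * (1 / ‖x - y‖ ^ ((n : ℝ) + 2 * s))) ∧
      -- the operators: all of them are defined on `H^s`, single-valued, and agree
      (∀ u : E n → ℝ, MemHs s u →
        ∃ F : 𝓢'(E n, ℂ), TemperedDistribution.MemSobolev (-s) 2 F ∧
          ∀ Λ : 𝓢'(E n, ℂ),
            (IsFracLaplacian s u Λ ↔ Λ = F) ∧
            (IsWeightedLaplacian s (fracWeight n s) (fracKernel n) u Λ
              ↔ Λ = ((D / dirConst s ^ 2 : ℝ) : ℂ) • F) ∧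
            (IsUnweightedLaplacian s (equivKernel (fracWeight n s) (fracKernel n)) u Λ
              ↔ Λ = ((D / dirConst s ^ 2 : ℝ) : ℂ) • F)) := by
  have hG : dirConst s ≠ 0 := (dirConst_pos hs0 hs1).ne'
  obtain ⟨e, he⟩ : ∃ e : E n, ‖e‖ = 1 := ⟨EuclideanSpace.single ⟨0, hn⟩ 1, by simp⟩
  -- The left side is D / G_s² for the D of `isSphereConst_neg_sq`; the right side is the factor
  -- found both for the kernel and for the operators.
  have hc : -(‖sinSymbol n s 0 e‖ * dirConst s / (2 * Real.pi) ^ s) ^ 2 / dirConst s ^ 2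
      = -(‖sinSymbol n s 0 e‖ / (2 * Real.pi) ^ s) ^ 2 := by
    have : (2 * Real.pi) ^ s ≠ 0 := (Real.rpow_pos_of_pos Real.two_pi_pos s).ne'
    field_simp
  have hker : ∀ x y : E n, x ≠ y → 2 * equivKernel (fracWeight n s) (fracKernel n) x y
      = -(fracLapConst n s * -(‖sinSymbol n s 0 e‖ / (2 * Real.pi) ^ s) ^ 2)
        * (1 / ‖x - y‖ ^ ((n : ℝ) + 2 * s)) := fun x y hxy => by
    rw [two_mul_equivKernel hn hs0 hs1 he hxy, norm_sub_rev, Real.rpow_neg (norm_nonneg _)]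
    ring
  refine ⟨fun x y => fracWeight_smul_fracKernel x y, _, isSphereConst_neg_sq hn hs0 hs1 he,
    fun x y hxy => ⟨fun ε hε => integrableOn_equivIntegrand hn hs0 hε x y, ?_, ?_⟩, fun u hu => ?_⟩
  · have h := tendsto_integral_equivIntegrand hn hs0 hs1 he hxy
    rwa [← two_mul_equivKernel hn hs0 hs1 he hxy] at h
  · rw [hker x y hxy, mul_div_assoc, hc]
  obtain ⟨uhat, hu1, hu2⟩ := hu.exists_hasL2Fourier hs0.le
  obtain ⟨F, hF⟩ := exists_hasSobolevFourier (memLp_laplacian_hat hs0 hu1.memLp_hat.1 hu2)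
  refine ⟨F, hF.memSobolev, fun Λ => ?_⟩
  rw [hc]
  have hlap := isFracLaplacian hn hs0 hs1 hu1 hu2 hF
  have hunw := isUnweightedLaplacian hn hs0 hs1 hker hu1 hu2 hF
  refine ⟨⟨fun h => IsPVIntegral.unique h hlap, fun h => h ▸ hlap⟩, ⟨?_, ?_⟩,
    ⟨fun h => IsPVIntegral.unique h hunw, fun h => h ▸ hunw⟩⟩
  -- The gradient g is determined only almost everywhere, but any choice has the same Fourier
  -- transform and thus the same divergence.
  · rintro ⟨g, hg, hΛ⟩
    exact IsPVIntegral.unique hΛ (hg.isWeightedDivergence hn hs0 hs1 he hu1 hu2 hF)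
  · rintro rfl
    obtain ⟨g, hg⟩ := exists_isWeightedGradient hn hs0 hs1 hu1 hu2
    exact ⟨g, hg, hg.isWeightedDivergence hn hs0 hs1 he hu1 hu2 hF⟩
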